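/- **Setting.** Let $\mathfrak g$ be a complex Lie algebra with a $*$-structure (a conjugate-linear involution with $[x,y]^*=[y^*,x^*]$; e.g. the complexification of a compact Lie algebra), $U\mathfrak g$ its enveloping Hopf $*$-algebra, $\rho$ a finite-dimensional $*$-representation of $\mathfrak g$ by matrices $\rho(x)^i{}_j$. Let $\mathcal A$ be the Weyl (sign $+$) or Clifford (sign $-$) algebra: generators $a^i,a^+_i$, relations $a^ia^j=\pm a^ja^i$, $a^+_ia^+_j=\pm a^+_ja^+_i$, $a^ia^+_j=\delta^i_j\pm a^+_ja^i$, with $\star$-structure $(a^i)^\star=a^+_i$, and let $\sigma:U\mathfrak g\to\mathcal A$ be the homomorphism with $\sigma(X)=\rho(X)^i{}_j\,a^+_ia^j$ for $X\in\mathfrak g$. Let $\mathcal F\in (U\mathfrak g\otimes U\mathfrak g)[[h]]$ be a unitary twist with real formal parameter $h$: $\mathcal F=1\otimes1+O(h)$, $(\varepsilon\otimes\mathrm{id})\mathcal F=1=(\mathrm{id}\otimes\varepsilon)\mathcal F$, $(\mathcal F\otimes1)(\Delta\otimes\mathrm{id})\mathcal F=(1\otimes\mathcal F)(\mathrm{id}\otimes\Delta)\mathcal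 F$, $\mathcal F^{*\otimes*}=\mathcal F^{-1}$. Write $\gamma=S(\mathcal F^{-1(1)})\mathcal F^{-1(2)}$, $\gamma'=\mathcal F^{(2)}S(\mathcal F^{(1)})$, $R=(\rho\otimes\rho)(\mathcal F_{21}\mathcal F^{-1})$, and in $\mathcal A[[h]]$ $$A^+_i=\sigma(\mathcal F^{(1)})a^+_i\sigma(S\mathcal F^{(2)}\gamma),\qquad A^i=\sigma(\gamma'S\mathcal F^{-1(2)})a^i\sigma(\mathcal F^{-1(1)}).$$ For constants $c_1,c_2$ and a matrix $R$, the quantum commutation relations (QCR) are $$\tilde A^i\tilde A^j=c_1R^{ij}_{vu}\tilde A^u\tilde A^v,\quad \tilde A^+_i\tilde A^+_j=c_1R^{vu}_{ij}\tilde A^+_u\tilde A^+_v,\quad \tilde A^i\tilde A^+_j=\delta^i_j+c_2R^{ui}_{jv}\tilde A^+_u\tilde A^v .$$ A $*$-representation of the QCR on a Hilbert space $\mathcal H$ consists of closed operators $\tilde A^i,\tilde A^+_i$ with $\tilde A^+_i\subset(\tilde A^i)^\dagger$ and a dense subspace $\mathcal D$ contained in the domain of the product of any two of them, such that the QCR hold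 on $\mathcal D$ and $\sum_i\tilde A^+_i\tilde A^i$ is essentially self-adjoint on $\mathcal D$. A Fock representation $\pi$ of $\mathcal A$ is a representation on a dense subspace $\mathcal D$ of a Hilbert space $\mathcal H$ with $\pi(a^+_i)$ formally adjoint to $\pi(a^i)$ and a family of orthonormal vacua $\Omega_l$, $\pi(a^i)\Omega_l=0$, such that $\mathcal D$ is the span of the vectors $\pi(a^+_{i_1}\cdots a^+_{i_k})\Omega_l$ (irreducible: exactly one vacuum). Operators on $\mathcal D$ are identified with their closures. Let $\alpha=1+O(h)\in\mathcal A[[h]]$ be unitary, $\alpha^\star=\alpha^{-1}$. **(1)** In $\mathcal A[[h]]$ the elements $f_\alpha(\tilde A^i)=\alpha A^i\alpha^{-1}$, $f_\alpha(\tilde A^+_i)=\alpha A^+_i\alpha^{-1}$ satisfy the QCR with this $R$ and $c_1=c_2=\pm1$, and $f_\alpha(\tilde A^i)^\star=f_\alpha(\tilde A^+_i)$. **(2)** Let $\pi$ be a Fock representation with at least one vacuum, and let $h$ be a real number at which the series $(\rho^i{}_j\otimes\pi\circ\sigma)(\mathcal F)v$ converge (unconditionally) for all $i,j$ and $v\in\mathcal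 D$. Then the entries of $R$ converge, the series $\Pi(\tilde A^i)=\pi(A^i)$, $\Pi(\tilde A^+_i)=\pi(A^+_i)$ converge on $\mathcal D$ to operators $\mathcal D\to\mathcal D$, and (the closures of) these form a $*$-representation of the QCR on $\mathcal H$ with domain $\mathcal D$. If moreover $\pi(\alpha)v$ and $\pi(\alpha^\star)v$ converge absolutely for all $v\in\mathcal D$, then $\pi(\alpha)$ extends to a unitary operator on $\mathcal H$ and $\Pi_\alpha=\pi(\alpha)\Pi(\cdot)\pi(\alpha)^{-1}$ is a $*$-representation of the QCR with domain $\pi(\alpha)\mathcal D$. **(3)** The same holds for the $U_hsu(2)$-covariant algebras, for every $q=e^h>0$: modes $\uparrow,\downarrow$, $R=\mathrm{diag}(q,1,1,q)$ plus the entry $R^{\downarrow\uparrow}_{\uparrow\downarrow}=q-q^{-1}$, $c_1=\pm q^{\mp1}$, $c_2=\pm q^{\pm1}$, and $$f(\tilde A^+_i)=a^+_l\,(F^{-1})^l{}_i\,g(n),\quad f(\tilde A^i)=g(n)\,F^i{}_l\,a^l,\quad g(n)=\sqrt{\tfrac{(n+1)_{q^{\pm2}}}{n+1}},\quad F=\begin{pmatrix}a(j,j_0)&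 b(j,j_0)j_-\\ -j_+b(j,j_0)& a(j,j_0-1)\end{pmatrix},\quad F^{-1}=\begin{pmatrix}a(j,j_0)& -b(j,j_0)j_-\\ j_+b(j,j_0)& a(j,j_0-1)\end{pmatrix},$$ where $n=a^+_\uparrow a^\uparrow+a^+_\downarrow a^\downarrow$, $j_+=a^+_\uparrow a^\downarrow$, $j_-=a^+_\downarrow a^\uparrow$, $j_0=\frac12(a^+_\uparrow a^\uparrow-a^+_\downarrow a^\downarrow)$, $j\ge0$ is the spin, $j(j+1)=j_-j_++j_0(j_0+1)$, $(x)_z=\frac{z^x-1}{z-1}$, $[x]_q=\frac{q^x-q^{-x}}{q-q^{-1}}$ (limits at $z=1$, $q=1$), and $$a(j,j_0)=\tfrac{q^{(j-j_0)/2}}{\sqrt{(1+2j)[1+2j]_q}}\Big[\sqrt{(1+j+j_0)[1+j+j_0]_q}+q^{-\frac{1+2j}2}\sqrt{(j-j_0)[j-j_0]_q}\Big],$$ $$b(j,j_0)=\tfrac{q^{(j-j_0)/2}}{\sqrt{(1+2j)[1+2j]_q}}\Big[\sqrt{\tfrac{[1+j+j_0]_q}{1+j+j_0}}-q^{-\frac{1+2j}2}\sqrt{\tfrac{[j-j_0]_q}{j-j_0}}\Big].$$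 That is, for every Fock representation $\pi$, $\Pi=\pi\circ f$ is a $*$-representation of the QCR with domain $\mathcal D$, and so is $\Pi_\alpha$, with domain $\pi(\alpha)\mathcal D$, for every unitary $\alpha$ for which $\pi(\alpha),\pi(\alpha^\star)$ converge absolutely on $\mathcal D$ at $h=\log q$. **(4)** Let $0<q<1$, $E>0$, and let $\pi$ be an irreducible Fock representation of the two-mode Weyl algebra, $\Pi=\pi\circ f$. The Pusz–Woronowicz representations have an orthonormal basis $|\eta,\eta_\downarrow\rangle$ labelled by class 1: $(\frac{q^{2m_1}}{q^2-1},\frac{q^{2m_2}}{q^2-1})$; class 2: $(q^{2n_1}E,\frac{q^{2m_1}}{q^2-1})$; class 3: $(0,\frac{q^{2m_1}}{q^2-1})$; class 4: $(q^{2n_1}E,q^{2n_2}E)$; class 5: $(q^{2n_1}E,0)$ ($m_1\ge m_2\ge0$, $n_1<n_2$ integers), with $$\tilde A^\uparrow|\eta,\eta_\downarrow\rangle=z_\uparrow\sqrt{\eta-\eta_\downarrow}\,|q^{-2}\eta,\eta_\downarrow\rangle,\qquad \tilde A^\downarrow|\eta,\eta_\downarrow\rangle=z_\downarrow\sqrt{\eta_\downarrow-\tfrac1{q^2-1}}\,|q^{-2}\eta,q^{-2}\eta_\downarrow\rangle,$$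 $$\tilde A^+_\uparrow|\eta,\eta_\downarrow\rangle=\bar z_\uparrow\sqrt{q^2\eta-\eta_\downarrow}\,|q^2\eta,\eta_\downarrow\rangle,\qquad \tilde A^+_\downarrow|\eta,\eta_\downarrow\rangle=\bar z_\downarrow\sqrt{q^2\eta_\downarrow-\tfrac1{q^2-1}}\,|q^2\eta,q^2\eta_\downarrow\rangle$$ and phases $|z_\uparrow|=|z_\downarrow|=1$. With $\tilde N^i=\tilde A^+_i\tilde A^i$ (no sum), $\tilde N=\tilde N^\uparrow+\tilde N^\downarrow$, put $\Lambda_\downarrow=1+(q^2-1)\tilde N^\downarrow$, $\Lambda_\uparrow=[1+(q^2-1)\tilde N]/[1+(q^2-1)\tilde N^\downarrow]$ and $$f^{-1}(\tilde A^i)=\tilde A^i\sqrt{\frac{\log\Lambda_i}{2\tilde N^i\log q}},\qquad f^{-1}(\tilde A^+_i)=\sqrt{\frac{\log\Lambda_i}{2\tilde N^i\log q}}\;\tilde A^+_i .$$ Then: (a) $\Lambda_\uparrow,\Lambda_\downarrow$ take only positive values on the basis vectors (so that $f^{-1}$ is well defined) if and only if the class is 1; (b) the representation is unitarily equivalent to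 $\Pi$ if and only if the class is 1; (c) for class 1 one and the same unitary operator carries $\tilde A^i,\tilde A^+_i$ to $\Pi(\tilde A^i),\Pi(\tilde A^+_i)$ and $f^{-1}(\tilde A^i),f^{-1}(\tilde A^+_i)$ to $\pi(a^i),\pi(a^+_i)$. -/

import Mathlib

open scoped TensorProduct LinearPMap

attribute [local instance] LieRing.ofAssociativeRing

noncomputable section

namespace FockDef

/-! ### Conjugate-linear anti-homomorphisms -/

/-- The opposite algebra with complex-conjugate scalars: an algebra homomorphism
`B → ConjOp C` is a conjugate-linear anti-homomorphism `B → C`. -/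
def ConjOp (B : Type*) : Type _ := Bᵐᵒᵖ

instance {B : Type*} [Ring B] : Ring (ConjOp B) := inferInstanceAs (Ring Bᵐᵒᵖ)

instance {B : Type*} [Ring B] [Algebra ℂ B] : Algebra ℂ (ConjOp B) :=
  letI : Algebra ℂ (ConjOp B) := inferInstanceAs (Algebra ℂ Bᵐᵒᵖ)
  Algebra.compHom (ConjOp B) (starRingEnd ℂ)

/-- The identity map `B → ConjOp B`. -/
def ConjOp.mk {B : Type*} (b : B) : ConjOp B := MulOpposite.op b

/-- The identity map `ConjOp B → B`. -/
def ConjOp.get {B : Type*} (b : ConjOp B) : B := MulOpposite.unop b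

section ConjOp
set_option linter.unusedSectionVars false
variable {B : Type*} [Ring B] [Algebra ℂ B]

theorem ConjOp.get_mk (x : B) : (ConjOp.mk x).get = x := rfl
theorem ConjOp.get_mul (x y : ConjOp B) : (x * y).get = y.get * x.get := rfl
theorem ConjOp.get_add (x y : ConjOp B) : (x + y).get = x.get + y.get := rfl
theorem ConjOp.get_zero : (0 : ConjOp B).get = 0 := rfl
theorem ConjOp.get_one : (1 : ConjOp B).get = 1 := rfl
theorem ConjOp.get_smul (c : ℂ) (x : ConjOp B) : (c • x).get = (starRingEnd ℂ c) • x.get := rfl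
theorem ConjOp.get_algebraMap (c : ℂ) :
    (algebraMap ℂ (ConjOp B) c).get = algebraMap ℂ B (starRingEnd ℂ c) := rfl
theorem ConjOp.get_sub (x y : ConjOp B) : (x - y).get = x.get - y.get := rfl
theorem ConjOp.ext {x y : ConjOp B} (h : x.get = y.get) : x = y :=
  MulOpposite.unop_injective h

/-- The square of an algebra homomorphism `B → ConjOp B`, as a homomorphism `B → B`. -/
def ConjOp.sq (f : B →ₐ[ℂ] ConjOp B) : B →ₐ[ℂ] B where
  toFun x := (f (f x).get).get
  map_one' := by simp [ConjOp.get_one]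
  map_mul' x y := by simp [ConjOp.get_mul]
  map_zero' := by simp [ConjOp.get_zero]
  map_add' x y := by simp [ConjOp.get_add]
  commutes' c := by simp [ConjOp.get_algebraMap]

/-- The star ring structure defined by an involutive `B → ConjOp B`. -/
abbrev ConjOp.starRing (f : B →ₐ[ℂ] ConjOp B) (hf : ConjOp.sq f = AlgHom.id ℂ B) : StarRing B where
  star x := (f x).get
  star_involutive x := DFunLike.congr_fun hf x
  star_mul x y := by simp [ConjOp.get_mul]
  star_add x y := by simp [ConjOp.get_add]

end ConjOp

/-! ### The Hopf `*`-algebra `U 𝔤` -/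

/-- A complex `*`-Lie algebra: a complex Lie algebra with a conjugate-linear involution
satisfying `[x, y]^* = [y^*, x^*]`; the elements with `x^* = -x` form a real form. -/
class StarLieAlgebra (𝔤 : Type*) [LieRing 𝔤] [LieAlgebra ℂ 𝔤] [StarAddMonoid 𝔤] : Prop where
  star_smul : ∀ (c : ℂ) (x : 𝔤), star (c • x) = (starRingEnd ℂ c) • star x
  star_lie : ∀ x y : 𝔤, star ⁅x, y⁆ = ⁅star y, star x⁆

/-- The universal enveloping algebra of `𝔤`. -/
abbrev U (𝔤 : Type*) [LieRing 𝔤] [LieAlgebra ℂ 𝔤] := UniversalEnvelopingAlgebra ℂ 𝔤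

section Hopf
variable (𝔤 : Type*) [LieRing 𝔤] [LieAlgebra ℂ 𝔤]

/-- The inclusion of `𝔤` into `U 𝔤`. -/
abbrev inc (x : 𝔤) : U 𝔤 := UniversalEnvelopingAlgebra.ι ℂ x

/-- The cocommutative coproduct, `Δ x = x ⊗ 1 + 1 ⊗ x` on `𝔤`. -/
def comul : U 𝔤 →ₐ[ℂ] U 𝔤 ⊗[ℂ] U 𝔤 :=
  UniversalEnvelopingAlgebra.lift ℂ
    { toFun := fun x => inc 𝔤 x ⊗ₜ[ℂ] 1 + 1 ⊗ₜ[ℂ] inc 𝔤 x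
      map_add' := fun x y => by simp [TensorProduct.add_tmul, TensorProduct.tmul_add]; abel
      map_smul' := fun c x => by simp [TensorProduct.smul_tmul']
      map_lie' := fun {x y} => by
        simp [LieRing.of_associative_ring_bracket, add_mul, mul_add, TensorProduct.sub_tmul,
          TensorProduct.tmul_sub]
        abel }

/-- The counit, zero on `𝔤`. -/
def counit : U 𝔤 →ₐ[ℂ] ℂ := UniversalEnvelopingAlgebra.lift ℂ 0

/-- The antipode as a homomorphism to the opposite algebra, `S x = -x` on `𝔤`. -/
def antipodeOp : U 𝔤 →ₐ[ℂ] (U 𝔤)ᵐᵒᵖ :=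
  UniversalEnvelopingAlgebra.lift ℂ
    { toFun := fun x => MulOpposite.op (-inc 𝔤 x)
      map_add' := fun x y => by simp [add_comm]
      map_smul' := fun c x => by simp
      map_lie' := fun {x y} => by
        simp [LieRing.of_associative_ring_bracket, ← MulOpposite.op_mul, ← MulOpposite.op_sub] }

/-- The antipode. -/
def antipode : U 𝔤 →ₗ[ℂ] U 𝔤 :=
  (MulOpposite.opLinearEquiv ℂ).symm.toLinearMap ∘ₗ (antipodeOp 𝔤).toLinearMap

variable [StarAddMonoid 𝔤] [StarLieAlgebra 𝔤]

/-- The `*`-structure of `U 𝔤`: the conjugate-linear anti-homomorphism that extends the one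
of `𝔤`. -/
def starU : U 𝔤 →ₐ[ℂ] ConjOp (U 𝔤) :=
  UniversalEnvelopingAlgebra.lift ℂ
    { toFun := fun x => ConjOp.mk (inc 𝔤 (star x))
      map_add' := fun x y => ConjOp.ext (by
        simp [ConjOp.get_add, ConjOp.get_mk])
      map_smul' := fun c x => ConjOp.ext (by
        simp [ConjOp.get_smul, ConjOp.get_mk, StarLieAlgebra.star_smul])
      map_lie' := fun {x y} => ConjOp.ext (by
        simp [LieRing.of_associative_ring_bracket, ConjOp.get_sub, ConjOp.get_mul,
          ConjOp.get_mk, StarLieAlgebra.star_lie]) }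

theorem starU_inc (x : 𝔤) : starU 𝔤 (inc 𝔤 x) = ConjOp.mk (inc 𝔤 (star x)) :=
  UniversalEnvelopingAlgebra.lift_ι_apply ℂ _ x

theorem starU_sq : ConjOp.sq (starU 𝔤) = AlgHom.id ℂ (U 𝔤) := by
  apply UniversalEnvelopingAlgebra.hom_ext
  ext x
  change (starU 𝔤 (starU 𝔤 (inc 𝔤 x)).get).get = inc 𝔤 x
  rw [starU_inc, ConjOp.get_mk, starU_inc, ConjOp.get_mk, star_star]

instance : StarRing (U 𝔤) := ConjOp.starRing (starU 𝔤) (starU_sq 𝔤)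

instance : StarModule ℂ (U 𝔤) where
  star_smul c x := by
    change (starU 𝔤 (c • x)).get = (starRingEnd ℂ c) • (starU 𝔤 x).get
    rw [map_smul, ConjOp.get_smul]

end Hopf

/-! ### Formal power series in `h` -/

/-- A linear map applied to every coefficient. -/
def psMap {M N : Type*} [Semiring M] [Module ℂ M] [Semiring N] [Module ℂ N]
    (L : M →ₗ[ℂ] N) (f : PowerSeries M) : PowerSeries N :=
  PowerSeries.mk fun n => L (PowerSeries.coeff n f)

/-- The star applied to every coefficient (the parameter `h` is real). -/
def psStar {M : Type*} [Semiring M] [StarRing M] (f : PowerSeries M) : PowerSeries M :=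
  PowerSeries.mk fun n => star (PowerSeries.coeff n f)

/-! ### Twists -/

section Twist
variable (𝔤 : Type*) [LieRing 𝔤] [LieAlgebra ℂ 𝔤]

/-- A (triangular) twist `F` in `(U 𝔤 ⊗ U 𝔤)[[h]]`, together with its inverse. -/
structure Twist where
  F : PowerSeries (U 𝔤 ⊗[ℂ] U 𝔤)
  Finv : PowerSeries (U 𝔤 ⊗[ℂ] U 𝔤)
  mul_inv : F * Finv = 1
  inv_mul : Finv * F = 1
  /-- `(ε ⊗ id) F = 1` -/
  counit_left : psMap ((Algebra.TensorProduct.lid ℂ (U 𝔤)).toLinearMap ∘ₗ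
    (Algebra.TensorProduct.map (counit 𝔤) (AlgHom.id ℂ (U 𝔤))).toLinearMap) F = 1
  /-- `(id ⊗ ε) F = 1` -/
  counit_right : psMap ((Algebra.TensorProduct.rid ℂ ℂ (U 𝔤)).toLinearMap ∘ₗ
    (Algebra.TensorProduct.map (AlgHom.id ℂ (U 𝔤)) (counit 𝔤)).toLinearMap) F = 1
  /-- `F = 1 ⊗ 1 + O(h)` -/
  coeff_zero : PowerSeries.coeff 0 F = 1
  /-- `(F ⊗ 1) (Δ ⊗ id)(F) = (1 ⊗ F) (id ⊗ Δ)(F)` -/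
  cocycle :
    psMap (Algebra.TensorProduct.assoc ℂ ℂ ℂ (U 𝔤) (U 𝔤) (U 𝔤)).toLinearMap
      (psMap (Algebra.TensorProduct.includeLeft :
          U 𝔤 ⊗[ℂ] U 𝔤 →ₐ[ℂ] (U 𝔤 ⊗[ℂ] U 𝔤) ⊗[ℂ] U 𝔤).toLinearMap F *
        psMap (Algebra.TensorProduct.map (comul 𝔤) (AlgHom.id ℂ (U 𝔤))).toLinearMap F) =
      psMap (Algebra.TensorProduct.includeRight :
          U 𝔤 ⊗[ℂ] U 𝔤 →ₐ[ℂ] U 𝔤 ⊗[ℂ] (U 𝔤 ⊗[ℂ] U 𝔤)).toLinearMap F *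
        psMap (Algebra.TensorProduct.map (AlgHom.id ℂ (U 𝔤)) (comul 𝔤)).toLinearMap F

variable {𝔤}

/-- `F` is unitary: `F^{* ⊗ *} = F⁻¹`. -/
def Twist.IsUnitary [StarAddMonoid 𝔤] [StarLieAlgebra 𝔤] (T : Twist 𝔤) : Prop :=
  psStar T.F = T.Finv

/-- `γ = S(F⁻¹⁽¹⁾) F⁻¹⁽²⁾`. -/
def Twist.gamma (T : Twist 𝔤) : PowerSeries (U 𝔤) :=
  psMap (LinearMap.mul' ℂ (U 𝔤) ∘ₗ TensorProduct.map (antipode 𝔤) LinearMap.id) T.Finv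

/-- `γ' = F⁽²⁾ S(F⁽¹⁾)`. -/
def Twist.gamma' (T : Twist 𝔤) : PowerSeries (U 𝔤) :=
  psMap (LinearMap.mul' ℂ (U 𝔤) ∘ₗ TensorProduct.map LinearMap.id (antipode 𝔤) ∘ₗ
    (TensorProduct.comm ℂ (U 𝔤) (U 𝔤)).toLinearMap) T.F

/-- The universal triangular structure `F₂₁ F⁻¹`. -/
def Twist.universalR (T : Twist 𝔤) : PowerSeries (U 𝔤 ⊗[ℂ] U 𝔤) :=
  psMap (TensorProduct.comm ℂ (U 𝔤) (U 𝔤)).toLinearMap T.F * T.Finv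

end Twist

/-! ### The Weyl and Clifford algebras -/

/-- Bose (Weyl algebra) or Fermi (Clifford algebra) statistics. -/
inductive Stat
  | bose
  | fermi

/-- The sign `±` of the (anti)commutation relations. -/
def Stat.sgn : Stat → ℂ
  | bose => 1
  | fermi => -1

section Classical
set_option linter.unusedSectionVars false
variable (s : Stat) (ι : Type*) [Fintype ι] [DecidableEq ι]

/-- Free generators: `inl i` is the annihilator `a^i`, `inr i` is the creator `a^+_i`. -/
abbrev FreeGen := FreeAlgebra ℂ (ι ⊕ ι)

/-- The canonical (anti)commutation relations. -/
inductive CRel : FreeGen ι → FreeGen ι → Prop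
  | ann (i j : ι) : CRel (FreeAlgebra.ι ℂ (Sum.inl i) * FreeAlgebra.ι ℂ (Sum.inl j))
      (s.sgn • (FreeAlgebra.ι ℂ (Sum.inl j) * FreeAlgebra.ι ℂ (Sum.inl i)))
  | cre (i j : ι) : CRel (FreeAlgebra.ι ℂ (Sum.inr i) * FreeAlgebra.ι ℂ (Sum.inr j))
      (s.sgn • (FreeAlgebra.ι ℂ (Sum.inr j) * FreeAlgebra.ι ℂ (Sum.inr i)))
  | mix (i j : ι) : CRel (FreeAlgebra.ι ℂ (Sum.inl i) * FreeAlgebra.ι ℂ (Sum.inr j))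
      ((if i = j then 1 else 0) +
        s.sgn • (FreeAlgebra.ι ℂ (Sum.inr j) * FreeAlgebra.ι ℂ (Sum.inl i)))

/-- The Weyl (`bose`) or Clifford (`fermi`) algebra with modes `ι`. -/
def CAlg : Type _ := RingQuot (CRel s ι)

instance : Ring (CAlg s ι) := inferInstanceAs (Ring (RingQuot (CRel s ι)))

instance : Algebra ℂ (CAlg s ι) := (inferInstance : Algebra ℂ (RingQuot (CRel s ι)))

/-- The quotient map from the free algebra. -/
def toC : FreeGen ι →ₐ[ℂ] CAlg s ι := RingQuot.mkAlgHom ℂ (CRel s ι)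

variable {ι}

theorem toC_rel {x y : FreeGen ι} (h : CRel s ι x y) : toC s ι x = toC s ι y :=
  RingQuot.mkAlgHom_rel ℂ h

/-- The universal property of the Weyl/Clifford algebra. -/
def liftC {B : Type*} [Ring B] [Algebra ℂ B] (f : FreeGen ι →ₐ[ℂ] B)
    (hf : ∀ ⦃x y⦄, CRel s ι x y → f x = f y) : CAlg s ι →ₐ[ℂ] B :=
  RingQuot.liftAlgHom ℂ ⟨f, hf⟩

theorem liftC_toC {B : Type*} [Ring B] [Algebra ℂ B] (f : FreeGen ι →ₐ[ℂ] B)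
    (hf : ∀ ⦃x y⦄, CRel s ι x y → f x = f y) (x : FreeGen ι) :
    liftC s f hf (toC s ι x) = f x :=
  RingQuot.liftAlgHom_mkAlgHom_apply ℂ f hf x

theorem homC_ext {B : Type*} [Ring B] [Algebra ℂ B] (f g : CAlg s ι →ₐ[ℂ] B)
    (h : f.comp (toC s ι) = g.comp (toC s ι)) : f = g :=
  RingQuot.ringQuot_ext' ℂ f g h

/-- The annihilator `a^i`. -/
def ann (i : ι) : CAlg s ι := toC s ι (FreeAlgebra.ι ℂ (Sum.inl i))

/-- The creator `a^+_i`. -/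
def cre (i : ι) : CAlg s ι := toC s ι (FreeAlgebra.ι ℂ (Sum.inr i))

theorem ann_mul_ann (i j : ι) : ann s i * ann s j = s.sgn • (ann s j * ann s i) := by
  have h := toC_rel s (CRel.ann (s := s) i j)
  rw [map_mul, map_smul, map_mul] at h
  exact h

theorem cre_mul_cre (i j : ι) : cre s i * cre s j = s.sgn • (cre s j * cre s i) := by
  have h := toC_rel s (CRel.cre (s := s) i j)
  rw [map_mul, map_smul, map_mul] at h
  exact h

theorem ann_mul_cre (i j : ι) :
    ann s i * cre s j = (if i = j then 1 else 0) + s.sgn • (cre s j * ann s i) := by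
  have h := toC_rel s (CRel.mix (s := s) i j)
  rw [map_mul, map_add, map_smul, map_mul] at h
  refine h.trans ?_
  split_ifs <;> simp [ann, cre]

theorem Stat.sgn_mul_sgn : s.sgn * s.sgn = 1 := by cases s <;> simp [Stat.sgn]

theorem Stat.conj_sgn : starRingEnd ℂ s.sgn = s.sgn := by cases s <;> simp [Stat.sgn]

variable (ι) in
/-- The `⋆`-structure of the Weyl/Clifford algebra, `(a^i)^⋆ = a^+_i`. -/
def starC : CAlg s ι →ₐ[ℂ] ConjOp (CAlg s ι) :=
  liftC s (FreeAlgebra.lift ℂ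
    (Sum.elim (fun i => ConjOp.mk (cre s i)) (fun i => ConjOp.mk (ann s i)))) (by
      intro x y h
      apply ConjOp.ext
      cases h with
      | ann i j =>
        simp only [map_mul, map_smul, FreeAlgebra.lift_ι_apply, Sum.elim_inl,
          ConjOp.get_mul, ConjOp.get_smul, ConjOp.get_mk, Stat.conj_sgn]
        exact cre_mul_cre s j i
      | cre i j =>
        simp only [map_mul, map_smul, FreeAlgebra.lift_ι_apply, Sum.elim_inr,
          ConjOp.get_mul, ConjOp.get_smul, ConjOp.get_mk, Stat.conj_sgn]
        exact ann_mul_ann s j i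
      | mix i j =>
        simp only [map_mul, map_add, map_smul, FreeAlgebra.lift_ι_apply, Sum.elim_inl,
          Sum.elim_inr, ConjOp.get_mul, ConjOp.get_add, ConjOp.get_smul, ConjOp.get_mk,
          Stat.conj_sgn]
        rw [ann_mul_cre]
        congr 1
        by_cases hij : i = j
        · simp [hij, ConjOp.get_one]
        · simp [hij, Ne.symm hij, ConjOp.get_zero])

theorem starC_ann (i : ι) : starC s ι (ann s i) = ConjOp.mk (cre s i) := by
  simp [starC, ann, liftC_toC]

theorem starC_cre (i : ι) : starC s ι (cre s i) = ConjOp.mk (ann s i) := by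
  simp [starC, cre, liftC_toC]

theorem starC_sq : ConjOp.sq (starC s ι) = AlgHom.id ℂ (CAlg s ι) := by
  apply homC_ext
  apply FreeAlgebra.hom_ext
  funext x
  rcases x with i | i
  · change (starC s ι (starC s ι (ann s i)).get).get = ann s i
    rw [starC_ann, ConjOp.get_mk, starC_cre, ConjOp.get_mk]
  · change (starC s ι (starC s ι (cre s i)).get).get = cre s i
    rw [starC_cre, ConjOp.get_mk, starC_ann, ConjOp.get_mk]

instance : StarRing (CAlg s ι) := ConjOp.starRing (starC s ι) (starC_sq s)

/-- The commutators of the bilinears `a^+_i a^j` are those of matrix units. -/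
theorem bilinear_comm (i j k l : ι) :
    (cre s i * ann s j) * (cre s k * ann s l) - (cre s k * ann s l) * (cre s i * ann s j) =
      (if j = k then cre s i * ann s l else 0) - (if l = i then cre s k * ann s j else 0) := by
  have e (i j k l : ι) : (cre s i * ann s j) * (cre s k * ann s l) =
      (if j = k then cre s i * ann s l else 0) +
        s.sgn • (cre s i * cre s k * (ann s j * ann s l)) := by
    have : (cre s i * ann s j) * (cre s k * ann s l) =
        cre s i * (ann s j * cre s k) * ann s l := by noncomm_ring
    rw [this, ann_mul_cre]
    split_ifs
    · simp only [mul_add, add_mul, mul_one, mul_smul_comm, smul_mul_assoc, mul_assoc]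
    · simp only [mul_add, add_mul, mul_zero, zero_mul, mul_smul_comm, smul_mul_assoc, mul_assoc]
  rw [e i j k l, e k l i j, cre_mul_cre s k i, ann_mul_ann s l j]
  simp only [mul_smul_comm, smul_mul_assoc, smul_smul, Stat.sgn_mul_sgn, mul_one]
  abel

theorem jordan_mul (M N : Matrix ι ι ℂ) :
    (∑ i, ∑ j, M i j • (cre s i * ann s j)) * (∑ k, ∑ l, N k l • (cre s k * ann s l)) =
      ∑ p : ι × ι, ∑ r : ι × ι, (M p.1 p.2 * N r.1 r.2) •
        ((cre s p.1 * ann s p.2) * (cre s r.1 * ann s r.2)) := by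
  rw [← Fintype.sum_prod_type' (f := fun i j => M i j • (cre s i * ann s j)),
    ← Fintype.sum_prod_type' (f := fun i j => N i j • (cre s i * ann s j)),
    Finset.sum_mul_sum]
  refine Finset.sum_congr rfl fun p _ => Finset.sum_congr rfl fun r _ => ?_
  rw [smul_mul_smul_comm]

theorem jordan_lie (M N : Matrix ι ι ℂ) :
    ∑ i, ∑ j, ⁅M, N⁆ i j • (cre s i * ann s j) =
      ⁅∑ i, ∑ j, M i j • (cre s i * ann s j), ∑ k, ∑ l, N k l • (cre s k * ann s l)⁆ := by
  have hb (i j : ι) : ⁅M, N⁆ i j = ∑ k, M i k * N k j - ∑ k, M k j * N i k := by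
    have h : ⁅M, N⁆ i j = (M * N) i j - (N * M) i j := rfl
    rw [h, Matrix.mul_apply, Matrix.mul_apply]
    simp only [mul_comm]
  simp_rw [hb]
  rw [LieRing.of_associative_ring_bracket, jordan_mul, jordan_mul, Finset.sum_comm (f := fun p r : ι × ι => (N p.1 p.2 * M r.1 r.2) •
        ((cre s p.1 * ann s p.2) * (cre s r.1 * ann s r.2)))]
  have key (p r : ι × ι) :
      (M p.1 p.2 * N r.1 r.2) • ((cre s p.1 * ann s p.2) * (cre s r.1 * ann s r.2)) -
        (N r.1 r.2 * M p.1 p.2) • ((cre s r.1 * ann s r.2) * (cre s p.1 * ann s p.2)) =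
      (if p.2 = r.1 then (M p.1 p.2 * N r.1 r.2) • (cre s p.1 * ann s r.2) else 0) -
        (if r.2 = p.1 then (M p.1 p.2 * N r.1 r.2) • (cre s r.1 * ann s p.2) else 0) := by
    rw [mul_comm (N r.1 r.2), ← smul_sub, bilinear_comm, smul_sub, smul_ite, smul_ite, smul_zero]
  rw [← Finset.sum_sub_distrib]
  simp only [← Finset.sum_sub_distrib, key]
  simp only [Finset.sum_sub_distrib, Fintype.sum_prod_type, sub_smul, Finset.sum_smul]
  congr 1
  · refine Finset.sum_congr rfl fun i _ => ?_
    rw [Finset.sum_comm]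
    simp
  · simp only [Finset.sum_ite_eq', Finset.mem_univ, if_true]
    rw [Finset.sum_congr rfl fun x _ => Finset.sum_comm, Finset.sum_comm]
    exact Finset.sum_congr rfl fun x _ => Finset.sum_comm

/-- The Jordan–Schwinger homomorphism `M ↦ ∑ M^i_j a^+_i a^j`. -/
def jordan : Matrix ι ι ℂ →ₗ⁅ℂ⁆ CAlg s ι where
  toFun M := ∑ i, ∑ j, M i j • (cre s i * ann s j)
  map_add' M N := by simp [add_smul, Finset.sum_add_distrib]
  map_smul' c M := by simp [Finset.smul_sum, smul_smul]
  map_lie' {M N} := jordan_lie s M N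

variable {𝔤 : Type*} [LieRing 𝔤] [LieAlgebra ℂ 𝔤] (ρ : 𝔤 →ₗ⁅ℂ⁆ Matrix ι ι ℂ)

/-- `ρ` extended to `U 𝔤`. -/
def rhoU : U 𝔤 →ₐ[ℂ] Matrix ι ι ℂ := UniversalEnvelopingAlgebra.lift ℂ ρ

/-- `σ : U 𝔤 → 𝒜`, the extension of `σ(X) = ρ(X)^i_j a^+_i a^j`. -/
def sigma : U 𝔤 →ₐ[ℂ] CAlg s ι := UniversalEnvelopingAlgebra.lift ℂ ((jordan s).comp ρ)

variable {s ρ}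

/-- `x ⊗ y ↦ σ(x) c σ(S y)`. -/
def sandwich (s : Stat) (ρ : 𝔤 →ₗ⁅ℂ⁆ Matrix ι ι ℂ) (c : CAlg s ι) : U 𝔤 ⊗[ℂ] U 𝔤 →ₗ[ℂ] CAlg s ι :=
  LinearMap.mul' ℂ (CAlg s ι) ∘ₗ
    TensorProduct.map (LinearMap.mulRight ℂ c ∘ₗ (sigma s ρ).toLinearMap)
      ((sigma s ρ).toLinearMap ∘ₗ antipode 𝔤)

/-- `x ⊗ y ↦ σ(S y) c σ(x)`. -/
def sandwich' (s : Stat) (ρ : 𝔤 →ₗ⁅ℂ⁆ Matrix ι ι ℂ) (c : CAlg s ι) : U 𝔤 ⊗[ℂ] U 𝔤 →ₗ[ℂ] CAlg s ι :=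
  LinearMap.mul' ℂ (CAlg s ι) ∘ₗ
    TensorProduct.map (LinearMap.mulRight ℂ c ∘ₗ (sigma s ρ).toLinearMap ∘ₗ antipode 𝔤)
      (sigma s ρ).toLinearMap ∘ₗ (TensorProduct.comm ℂ (U 𝔤) (U 𝔤)).toLinearMap

/-- `f(Ã^+_i) = A^+_i = σ(F⁽¹⁾) a^+_i σ(S F⁽²⁾ γ)` in `𝒜[[h]]`. -/
def crePS (s : Stat) (ρ : 𝔤 →ₗ⁅ℂ⁆ Matrix ι ι ℂ) (T : Twist 𝔤) (i : ι) : PowerSeries (CAlg s ι) :=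
  psMap (sandwich s ρ (cre s i)) T.F * psMap (sigma s ρ).toLinearMap T.gamma

/-- `f(Ã^i) = A^i = σ(γ' S F⁻¹⁽²⁾) a^i σ(F⁻¹⁽¹⁾)` in `𝒜[[h]]`. -/
def annPS (s : Stat) (ρ : 𝔤 →ₗ⁅ℂ⁆ Matrix ι ι ℂ) (T : Twist 𝔤) (i : ι) : PowerSeries (CAlg s ι) :=
  psMap (sigma s ρ).toLinearMap T.gamma' * psMap (sandwich' s ρ (ann s i)) T.Finv

/-- The entries `R^{ij}_{hk}` of `(ρ ⊗ ρ)(F₂₁ F⁻¹)`. -/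
def RPS (ρ : 𝔤 →ₗ⁅ℂ⁆ Matrix ι ι ℂ) (T : Twist 𝔤) (i j h k : ι) : PowerSeries ℂ :=
  psMap (LinearMap.mul' ℂ ℂ ∘ₗ
    TensorProduct.map (Matrix.entryLinearMap ℂ ℂ i h ∘ₗ (rhoU ρ).toLinearMap)
      (Matrix.entryLinearMap ℂ ℂ j k ∘ₗ (rhoU ρ).toLinearMap)) T.universalR

/-- `x ⊗ y ↦ ρ(x)^i_j σ(y)`. -/
def rhoSigma (s : Stat) (ρ : 𝔤 →ₗ⁅ℂ⁆ Matrix ι ι ℂ) (i j : ι) : U 𝔤 ⊗[ℂ] U 𝔤 →ₗ[ℂ] CAlg s ι :=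
  (TensorProduct.lid ℂ (CAlg s ι)).toLinearMap ∘ₗ
    TensorProduct.map (Matrix.entryLinearMap ℂ ℂ i j ∘ₗ (rhoU ρ).toLinearMap)
      (sigma s ρ).toLinearMap

/-- The quantum commutation relations in a ring,
`A^i A^j = c₁ R^{ij}_{vu} A^u A^v`, `A^+_i A^+_j = c₁ R^{vu}_{ij} A^+_u A^+_v`,
`A^i A^+_j = δ^i_j + c₂ R^{ui}_{jv} A^+_u A^v`. -/
def SatisfiesQCR {T : Type*} [Ring T] (c₁ c₂ : T) (R : ι → ι → ι → ι → T) (A Ap : ι → T) : Prop :=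
  (∀ i j, A i * A j = c₁ * ∑ u, ∑ v, R i j v u * (A u * A v)) ∧
  (∀ i j, Ap i * Ap j = c₁ * ∑ u, ∑ v, R v u i j * (Ap u * Ap v)) ∧
  (∀ i j, A i * Ap j = (if i = j then 1 else 0) + c₂ * ∑ u, ∑ v, R u i j v * (Ap u * A v))

end Classical

/-! ### `*`-representations on Hilbert spaces -/

section Hilbert
variable {H : Type*} [NormedAddCommGroup H] [InnerProductSpace ℂ H]

open Classical in
/-- The value of a partially defined operator (`0` outside its domain). -/
def app (T : H →ₗ.[ℂ] H) (x : H) : H := if hx : x ∈ T.domain then T ⟨x, hx⟩ else 0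

/-- A `*`-representation of the quantum commutation relations (as in `SatisfiesQCR`) by
operators `B i` (annihilators) and `Bp i` (creators) with common dense domain `D`. -/
structure IsQCRStarRep [CompleteSpace H] {ι : Type*} [Fintype ι] [DecidableEq ι] (c₁ c₂ : ℂ)
    (R : ι → ι → ι → ι → ℂ) (B Bp : ι → H →ₗ.[ℂ] H) (D : Submodule ℂ H) : Prop where
  ann_closed : ∀ i, (B i).IsClosed
  cre_closed : ∀ i, (Bp i).IsClosed
  cre_le_adjoint : ∀ i, Bp i ≤ (B i)†
  dense : Dense (D : Set H)
  /-- `D` lies in the domain of the product of any two of the operators. -/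
  mem_domain : ∀ k l : ι ⊕ ι, ∀ x ∈ D,
    x ∈ (Sum.elim B Bp l).domain ∧ app (Sum.elim B Bp l) x ∈ (Sum.elim B Bp k).domain
  ann_ann : ∀ i j, ∀ x ∈ D, app (B i) (app (B j) x) =
    c₁ • ∑ u, ∑ v, R i j v u • app (B u) (app (B v) x)
  cre_cre : ∀ i j, ∀ x ∈ D, app (Bp i) (app (Bp j) x) =
    c₁ • ∑ u, ∑ v, R v u i j • app (Bp u) (app (Bp v) x)
  ann_cre : ∀ i j, ∀ x ∈ D, app (B i) (app (Bp j) x) =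
    (if i = j then x else 0) + c₂ • ∑ u, ∑ v, R u i j v • app (Bp u) (app (B v) x)
  /-- The number operator `∑ Ã^+_i Ã^i` is essentially self-adjoint on `D`. -/
  number_esa : ∃ N : H →ₗ.[ℂ] H, N.domain = D ∧
    (∀ x : N.domain, N x = ∑ i, app (Bp i) (app (B i) (x : H))) ∧ IsSelfAdjoint N.closure

/-- The closure of an operator on `H` with invariant domain `D`. -/
def closedOp {D : Submodule ℂ H} (B : Module.End ℂ D) : H →ₗ.[ℂ] H :=
  LinearPMap.closure ⟨D, D.subtype ∘ₗ B⟩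

/-- The operator `V T V⁻¹`, with domain `V (dom T)`. -/
def conj {K : Type*} [NormedAddCommGroup K] [InnerProductSpace ℂ K] (V : K ≃ₗᵢ[ℂ] H)
    (T : K →ₗ.[ℂ] K) : H →ₗ.[ℂ] H where
  domain := T.domain.comap (V.symm.toLinearEquiv : H →ₗ[ℂ] K)
  toFun := (V.toLinearEquiv : K →ₗ[ℂ] H) ∘ₗ T.toFun ∘ₗ
    ((V.symm.toLinearEquiv : H →ₗ[ℂ] K).comp
      (T.domain.comap (V.symm.toLinearEquiv : H →ₗ[ℂ] K)).subtype).codRestrict T.domain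
        (fun x => x.2)

variable {s : Stat} {ι : Type*} [Fintype ι] [DecidableEq ι] {D : Submodule ℂ H}

/-- `π` is a Fock `*`-representation of the CCR/CAR on `H`, a direct sum of Fock
representations with orthonormal vacua `Ω l`; the common invariant domain `D` is the span of the
vectors `π(a^+_{i₁} ⋯ a^+_{iₖ}) Ω l`. It is irreducible iff there is exactly one vacuum. -/
structure IsFockRep {L : Type*} (π : CAlg s ι →ₐ[ℂ] Module.End ℂ D) (Ω : L → D) : Prop where
  dense : Dense (D : Set H)
  adjoint : ∀ (i : ι) (x y : D),
    inner ℂ ((π (ann s i) x : D) : H) (y : H) = inner ℂ (x : H) ((π (cre s i) y : D) : H)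
  orthonormal : Orthonormal ℂ (fun l => (Ω l : H))
  vacuum : ∀ (i : ι) (l : L), π (ann s i) (Ω l) = 0
  span : Submodule.span ℂ
    (Set.range fun p : List ι × L => π (p.1.map (cre s)).prod (Ω p.2)) = ⊤

/-- `T` is the value at `h` of the operator-valued power series `π(α)`, on `D`. -/
def IsValue (π : CAlg s ι →ₐ[ℂ] Module.End ℂ D) (h : ℝ) (α : PowerSeries (CAlg s ι))
    (T : D → H) : Prop :=
  ∀ v : D, HasSum (fun n : ℕ => (h : ℂ) ^ n • ((π (PowerSeries.coeff n α) v : D) : H)) (T v)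

/-- The series `π(α)` converges at `h`, absolutely on every vector of `D`. -/
def ConvergesAt (π : CAlg s ι →ₐ[ℂ] Module.End ℂ D) (h : ℝ) (α : PowerSeries (CAlg s ι)) : Prop :=
  ∀ v : D, Summable fun n : ℕ => ‖(h : ℂ) ^ n • ((π (PowerSeries.coeff n α) v : D) : H)‖

/-- `α = 1 + O(h)` is unitary, `α^⋆ = α⁻¹`. -/
def IsUnitaryPS (α : PowerSeries (CAlg s ι)) : Prop :=
  PowerSeries.coeff 0 α = 1 ∧ α * psStar α = 1 ∧ psStar α * α = 1

end Hilbert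

/-! ### The deforming map for `U_h su(2)`; `0` stands for spin up, `1` for spin down -/

section SU2

/-- `[x]_q = (q^x - q^{-x}) / (q - q⁻¹)`, and `[x]_1 = x`. -/
def qsym (q x : ℝ) : ℝ := if q = 1 then x else (q ^ x - q ^ (-x)) / (q - q⁻¹)

/-- The function `a(j, j₀)`. -/
def aFun (q j j₀ : ℝ) : ℝ :=
  q ^ ((j - j₀) / 2) / √((1 + 2 * j) * qsym q (1 + 2 * j)) *
    (√((1 + j + j₀) * qsym q (1 + j + j₀)) +
      q ^ (-(1 + 2 * j) / 2) * √((j - j₀) * qsym q (j - j₀)))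

/-- The function `b(j, j₀)`. -/
def bFun (q j j₀ : ℝ) : ℝ :=
  q ^ ((j - j₀) / 2) / √((1 + 2 * j) * qsym q (1 + 2 * j)) *
    (√(qsym q (1 + j + j₀) / (1 + j + j₀)) -
      q ^ (-(1 + 2 * j) / 2) * √(qsym q (j - j₀) / (j - j₀)))

/-- The spin `j` (root of `j (j + 1) = 𝒞`) of the state with `m` spins up and `n` spins down. -/
def Stat.spin : Stat → ℕ → ℕ → ℝ
  | bose, m, n => ((m : ℝ) + n) / 2
  | fermi, m, n => |(m : ℝ) - n| / 2

/-- `q^{±2}`, the base of the `q`-numbers. -/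
def Stat.base : Stat → ℝ → ℝ
  | bose, q => q ^ 2
  | fermi, q => (q ^ 2)⁻¹

/-- `(n)_z = (z^n - 1) / (z - 1)`. -/
def qnum (z : ℝ) (n : ℕ) : ℝ := ∑ k ∈ Finset.range n, z ^ k

/-- The constant `± q^{∓1}` of the relations among annihilators and among creators. -/
def Stat.c₁ : Stat → ℝ → ℂ
  | bose, q => (q : ℂ)⁻¹
  | fermi, q => -(q : ℂ)

/-- The constant `± q^{±1}` of the mixed relations. -/
def Stat.c₂ : Stat → ℝ → ℂ
  | bose, q => (q : ℂ)
  | fermi, q => -(q : ℂ)⁻¹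

/-- The `R`-matrix of `U_h sl(2)` in the fundamental representation: diagonal `q, 1, 1, q` and
`R^{↓↑}_{↑↓} = q - q⁻¹`. -/
def su2R (q : ℝ) (i j h k : Fin 2) : ℂ :=
  if i = h ∧ j = k then (if i = j then (q : ℂ) else 1)
  else if i = 1 ∧ j = 0 ∧ h = 0 ∧ k = 1 then (q : ℂ) - (q : ℂ)⁻¹ else 0

variable {H : Type*} [NormedAddCommGroup H] [InnerProductSpace ℂ H] {D : Submodule ℂ H}
  {s : Stat} (π : CAlg s (Fin 2) →ₐ[ℂ] Module.End ℂ D)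

/-- `T = φ(n^↑, n^↓)`: `T` multiplies by `φ m n` every vector of `D` on which
`n^↑ = a^+_↑ a^↑` and `n^↓ = a^+_↓ a^↓` take the values `m` and `n`. -/
def IsNumFun (φ : ℕ → ℕ → ℝ) (T : Module.End ℂ D) : Prop :=
  ∀ (m n : ℕ) (v : D), π (cre s 0 * ann s 0) v = (m : ℂ) • v →
    π (cre s 1 * ann s 1) v = (n : ℂ) • v → T v = ((φ m n : ℝ) : ℂ) • v

open Classical in
/-- The operator `φ(n^↑, n^↓)` on `D`. In a Fock representation it exists and is unique, since
`D` is spanned by joint eigenvectors. -/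
def numFun (φ : ℕ → ℕ → ℝ) : Module.End ℂ D :=
  if hT : ∃ T, IsNumFun π φ T then hT.choose else 0

/-- `a(j, j₀ - t)`. -/
def aOp (q t : ℝ) : Module.End ℂ D :=
  numFun π fun m n => aFun q (s.spin m n) (((m : ℝ) - n) / 2 - t)

/-- `b(j, j₀)`. -/
def bOp (q : ℝ) : Module.End ℂ D :=
  numFun π fun m n => bFun q (s.spin m n) (((m : ℝ) - n) / 2)

/-- `f(n) = g(n) = √((n + 1)_{q^{±2}} / (n + 1))`. -/
def fOp (q : ℝ) : Module.End ℂ D :=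
  numFun π fun m n => √(qnum (s.base q) (m + n + 1) / ((m : ℝ) + n + 1))

/-- `σ(j_+)` -/
def jPlus : Module.End ℂ D := π (cre s 0 * ann s 1)

/-- `σ(j_-)` -/
def jMinus : Module.End ℂ D := π (cre s 1 * ann s 0)

/-- The matrix `(ρ ⊗ σ)(F)` of the unitary twist of `U_h su(2)`. -/
def su2F (q : ℝ) : Matrix (Fin 2) (Fin 2) (Module.End ℂ D) :=
  !![aOp π q 0, bOp π q * jMinus π; -(jPlus π * bOp π q), aOp π q 1]

/-- The matrix `(ρ ⊗ σ)(F⁻¹)`. -/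
def su2Finv (q : ℝ) : Matrix (Fin 2) (Fin 2) (Module.End ℂ D) :=
  !![aOp π q 0, -(bOp π q * jMinus π); jPlus π * bOp π q, aOp π q 1]

/-- `π(f(Ã^+_i)) = a^+_l σ(F⁻¹⁽²⁾) ρ(F⁻¹⁽¹⁾)^l_i f(n)`. -/
def su2Cre (q : ℝ) (i : Fin 2) : Module.End ℂ D :=
  (∑ l, π (cre s l) * su2Finv π q l i) * fOp π q

/-- `π(f(Ã^i)) = g(n) ρ(F⁽¹⁾)^i_l σ(F⁽²⁾) a^l`. -/
def su2Ann (q : ℝ) (i : Fin 2) : Module.End ℂ D :=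
  fOp π q * ∑ l, su2F π q i l * π (ann s l)

end SU2

/-! ### The Pusz–Woronowicz representations -/

section PW

/-- The five classes of Pusz–Woronowicz representations. -/
inductive PWClass
  | one
  | two
  | three
  | four
  | five

/-- The labels `(η, η_↓)` of the orthonormal basis of each representation. -/
def PWClass.labels (q E : ℝ) : PWClass → Set (ℝ × ℝ)
  | one => {p | ∃ m₁ m₂ : ℕ, m₂ ≤ m₁ ∧
      p = (q ^ (2 * m₁) / (q ^ 2 - 1), q ^ (2 * m₂) / (q ^ 2 - 1))}
  | two => {p | ∃ (n₁ : ℤ) (m₁ : ℕ), p = (q ^ (2 * n₁) * E, q ^ (2 * m₁) / (q ^ 2 - 1))}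
  | three => {p | ∃ m₁ : ℕ, p = (0, q ^ (2 * m₁) / (q ^ 2 - 1))}
  | four => {p | ∃ n₁ n₂ : ℤ, n₁ < n₂ ∧ p = (q ^ (2 * n₁) * E, q ^ (2 * n₂) * E)}
  | five => {p | ∃ n₁ : ℤ, p = (q ^ (2 * n₁) * E, 0)}

variable {K : Type*} [NormedAddCommGroup K] [InnerProductSpace ℂ K] {S : Set (ℝ × ℝ)}
  (b : HilbertBasis S ℂ K)

open Classical in
/-- The basis vector `|η, η_↓⟩`, and `0` if `(η, η_↓)` is not a label. -/
def ket (p : ℝ × ℝ) : K := if hp : p ∈ S then b ⟨p, hp⟩ else 0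

/-- The closure of the operator that is defined on the span of the basis by its values on the basis
vectors. -/
def onBasis (g : ℝ × ℝ → K) : K →ₗ.[ℂ] K :=
  LinearPMap.closure ⟨Submodule.span ℂ (Set.range b),
    (Module.Basis.span b.orthonormal.linearIndependent).constr ℂ fun p : S => g p⟩

/-- Eigenvalue of `Ñ^↑ = Ã^+_↑ Ã^↑` (`i = 0`) or `Ñ^↓ = Ã^+_↓ Ã^↓` (`i = 1`) on `|η, η_↓⟩`. -/
def nuVal (q : ℝ) (i : Fin 2) (p : ℝ × ℝ) : ℝ :=
  if i = 0 then p.1 - p.2 else p.2 - 1 / (q ^ 2 - 1)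

/-- The label of `Ã^+_i |η, η_↓⟩`. -/
def up (q : ℝ) (i : Fin 2) (p : ℝ × ℝ) : ℝ × ℝ :=
  if i = 0 then (q ^ 2 * p.1, p.2) else (q ^ 2 * p.1, q ^ 2 * p.2)

/-- The label of `Ã^i |η, η_↓⟩`. -/
def down (q : ℝ) (i : Fin 2) (p : ℝ × ℝ) : ℝ × ℝ :=
  if i = 0 then (p.1 / q ^ 2, p.2) else (p.1 / q ^ 2, p.2 / q ^ 2)

/-- `Ã^i` in the Pusz–Woronowicz representation with phases `z`:
`Ã^↑ |η, η_↓⟩ = z_↑ √(η - η_↓) |q⁻² η, η_↓⟩`,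
`Ã^↓ |η, η_↓⟩ = z_↓ √(η_↓ - 1 / (q² - 1)) |q⁻² η, q⁻² η_↓⟩`. -/
def pwAnn (q : ℝ) (z : Fin 2 → ℂ) (i : Fin 2) : K →ₗ.[ℂ] K :=
  onBasis b fun p => (z i * (√(nuVal q i p) : ℝ)) • ket b (down q i p)

/-- `Ã^+_i` in the Pusz–Woronowicz representation:
`Ã^+_↑ |η, η_↓⟩ = z̄_↑ √(q² η - η_↓) |q² η, η_↓⟩`,
`Ã^+_↓ |η, η_↓⟩ = z̄_↓ √(q² η_↓ - 1 / (q² - 1)) |q² η, q² η_↓⟩`. -/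
def pwCre (q : ℝ) (z : Fin 2 → ℂ) (i : Fin 2) : K →ₗ.[ℂ] K :=
  onBasis b fun p => (starRingEnd ℂ (z i) * (√(nuVal q i (up q i p)) : ℝ)) • ket b (up q i p)

/-- The argument `1 + (q² - 1) Ñ^↓` (`i = 1`) or
`[1 + (q² - 1) Ñ] / [1 + (q² - 1) Ñ^↓]` (`i = 0`) of the logarithm in `f⁻¹(Ã^i)`. -/
def logArg (q : ℝ) (i : Fin 2) (p : ℝ × ℝ) : ℝ :=
  if i = 0 then (1 + (q ^ 2 - 1) * (nuVal q 0 p + nuVal q 1 p)) / (1 + (q ^ 2 - 1) * nuVal q 1 p)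
  else 1 + (q ^ 2 - 1) * nuVal q 1 p

/-- `f⁻¹` is well defined on a representation: the arguments of both logarithms are positive. -/
def InvDefined (q : ℝ) (S : Set (ℝ × ℝ)) : Prop := ∀ p ∈ S, ∀ i, 0 < logArg q i p

/-- The factor `√(log[…] / (2 Ñ^i log q))` of `f⁻¹(Ã^i)`. -/
def invFactor (q : ℝ) (i : Fin 2) (p : ℝ × ℝ) : ℝ :=
  √(Real.log (logArg q i p) / (2 * nuVal q i p * Real.log q))

/-- `f⁻¹(Ã^i) = Ã^i √(log[…] / (2 Ñ^i log q))`. -/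
def invAnn (q : ℝ) (z : Fin 2 → ℂ) (i : Fin 2) : K →ₗ.[ℂ] K :=
  onBasis b fun p =>
    (z i * (√(nuVal q i p) : ℝ) * (invFactor q i p : ℝ)) • ket b (down q i p)

/-- `f⁻¹(Ã^+_i) = √(log[…] / (2 Ñ^i log q)) Ã^+_i`. -/
def invCre (q : ℝ) (z : Fin 2 → ℂ) (i : Fin 2) : K →ₗ.[ℂ] K :=
  onBasis b fun p =>
    (starRingEnd ℂ (z i) * (√(nuVal q i (up q i p)) : ℝ) * (invFactor q i (up q i p) : ℝ)) •
      ket b (up q i p)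

end PW

end FockDef

end

open FockDef

/-! The deformed generators are the classical ones dressed by the matrix (ρ ⊗ σ)(F). The a^+_i form
a tensor operator: σ(x) passes through a^+_i at the price of a coproduct (`sigma_mul_cre`). Together
with the cocycle condition and βγ = 1 (`Twist.beta_mul_gamma`) this collapses the defining formula
to A^+_i = a^+_l (ρ ⊗ σ)(F⁻¹)^l_i (`crePS_eq`), and the star turns it into A^i = (ρ ⊗ σ)(F)^i_l a^l.
A product of two dressed generators becomes a product of two bare ones times an entry of F₂₃ (id ⊗
Δ)F, of its inverse, or of (id ⊗ Δ)F times the leg exchange of (id ⊗ Δ)F⁻¹. Since F₂₃ (id ⊗ Δ)F =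
F₁₂ (Δ ⊗ id)F and Δ is cocommutative, exchanging the first two legs costs exactly R: the sign in the
relations comes from the bare generators, R from the dressing (`satisfiesQCR_formal`).

On a Fock space every vector lies in a finite-dimensional subspace invariant under σ(U𝔤). There
pointwise convergence is absolute, passes to adjoints (hence from F to F⁻¹, by unitarity) and to
products (`Evals.mul`), so formal identities become operator identities on D. The entries of R
converge because one-particle vectors transform by ρ. The matrices F⁻¹ and F cancel in Σ A^+_i A^i,
which is therefore the classical number operator; its eigenvectors span D, so N ± i map D onto D and
N is essentially self-adjoint (`isSelfAdjoint_closedOp`). For a unitary series α, the inner product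
of two limits is a Cauchy product in which only the constant term survives, so π(α) extends to a
unitary operator.

For U_h su(2) no twist series is used. On vectors with occupation numbers (m, n) the generators act
as multiples of the classical ones, with weights r^n √((m+1)_z/(m+1)) and √((n+1)_z/(n+1)) for the
creators, where z = r² = q^{±2}. For bosons this is because one of the two square roots drops out of
each combination of a and b that occurs; for fermions only a few occupation numbers are possible.
The relations are then identities between q-numbers.

The labels of class 1 correspond to pairs (m, n), and the Pusz–Woronowicz weights are the ones just
described, so sending basis vectors to normalized number vectors is the equivalence. In every other
class Ã^↑ is a weighted shift without kernel, even after closure, whereas Π(Ã^↑) annihilates the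
Fock vacuum (`class_eq_one_of_conj`). -/

namespace FockDef

/-! ### Closed operators with a common invariant dense domain -/

section Operators
variable {H : Type*} [NormedAddCommGroup H] [InnerProductSpace ℂ H] {D : Submodule ℂ H}

/-- An operator on `D` as a partially defined operator on `H`. -/
abbrev rawOp (B : Module.End ℂ D) : H →ₗ.[ℂ] H := ⟨D, D.subtype ∘ₗ B⟩

theorem app_eq {T : H →ₗ.[ℂ] H} {x y : H} (h : (x, y) ∈ T.graph) : app T x = y := by
  obtain ⟨z, hz, hy⟩ := (LinearPMap.mem_graph_iff T).1 h
  simp only at hz hy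
  subst hz
  simp [app, hy]

theorem mem_domain_of_mem_graph {T : H →ₗ.[ℂ] H} {x y : H} (h : (x, y) ∈ T.graph) :
    x ∈ T.domain := by
  obtain ⟨z, hz, -⟩ := (LinearPMap.mem_graph_iff T).1 h
  simp only at hz
  exact hz ▸ z.2

theorem mem_rawOp_graph (B : Module.End ℂ D) (x : D) : ((x : H), (B x : H)) ∈ (rawOp B).graph :=
  (LinearPMap.mem_graph_iff _).2 ⟨x, rfl, rfl⟩

theorem mem_rawOp_graph_iff (B : Module.End ℂ D) (p : H × H) :
    p ∈ (rawOp B).graph ↔ ∃ x : D, p = ((x : H), (B x : H)) := by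
  rw [LinearPMap.mem_graph_iff]
  constructor
  · rintro ⟨x, h1, h2⟩
    exact ⟨x, Prod.ext h1.symm h2.symm⟩
  · rintro ⟨x, rfl⟩
    exact ⟨x, rfl, rfl⟩

theorem mem_closedOp_graph (B : Module.End ℂ D) (x : D) :
    ((x : H), (B x : H)) ∈ (closedOp B).graph :=
  LinearPMap.le_graph_of_le (LinearPMap.le_closure _) (mem_rawOp_graph B x)

theorem mem_closedOp_domain (B : Module.End ℂ D) (x : D) : (x : H) ∈ (closedOp B).domain :=
  mem_domain_of_mem_graph (mem_closedOp_graph B x)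

@[simp]
theorem app_closedOp (B : Module.End ℂ D) (x : D) : app (closedOp B) x = B x :=
  app_eq (mem_closedOp_graph B x)

/-- The graph of the closure lies in every closed set that contains the graph. -/
theorem closure_graph_subset {K : Type*} [NormedAddCommGroup K] [InnerProductSpace ℂ K]
    {f : H →ₗ.[ℂ] K} {C : Set (H × K)} (hC : IsClosed C)
    (h : ∀ p ∈ f.graph, p ∈ C) {p : H × K} (hp : p ∈ f.closure.graph) : p ∈ C := by
  -- An operator that is not closable is its own `closure` by convention, so the claim needs no
  -- closability hypothesis.
  by_cases hf : f.IsClosable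
  · rw [← hf.graph_closure_eq_closure_graph] at hp
    exact closure_minimal (s := (f.graph : Set (H × K))) h hC hp
  · rw [LinearPMap.closure_def' hf] at hp
    exact h p hp

/-- `B` and `Bp` are formally adjoint on `D`. -/
def FormallyAdjoint (B Bp : Module.End ℂ D) : Prop :=
  ∀ x y : D, inner ℂ (B x : H) (y : H) = inner ℂ (x : H) (Bp y : H)

theorem FormallyAdjoint.symm {B Bp : Module.End ℂ D} (h : FormallyAdjoint B Bp) :
    FormallyAdjoint Bp B := fun x y => by
  rw [← inner_conj_symm, ← h y x, inner_conj_symm]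

theorem FormallyAdjoint.mul {B Bp C Cp : Module.End ℂ D} (h : FormallyAdjoint B Bp)
    (h' : FormallyAdjoint C Cp) : FormallyAdjoint (B * C) (Cp * Bp) := fun x y => by
  rw [Module.End.mul_apply, h, h', Module.End.mul_apply]

theorem FormallyAdjoint.sum {ι : Type*} (s : Finset ι) {B Bp : ι → Module.End ℂ D}
    (h : ∀ i, FormallyAdjoint (B i) (Bp i)) : FormallyAdjoint (∑ i ∈ s, B i) (∑ i ∈ s, Bp i) :=
  fun x y => by
    simp only [LinearMap.sum_apply, Submodule.coe_sum, sum_inner, inner_sum]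
    exact Finset.sum_congr rfl fun i _ => h i x y

/-- With one of the two pairs fixed, the identity is a closed condition on the other, so the
closures are reached one variable at a time. -/
theorem FormallyAdjoint.closure_inner {B Bp : Module.End ℂ D} (h : FormallyAdjoint B Bp)
    {p r : H × H} (hp : p ∈ (closedOp B).graph) (hr : r ∈ (closedOp Bp).graph) :
    inner ℂ p.2 r.1 = inner ℂ p.1 r.2 := by
  refine closure_graph_subset (C := {p | inner ℂ p.2 r.1 = inner ℂ p.1 r.2})
    (isClosed_eq (by fun_prop) (by fun_prop)) (fun p hp => ?_) hp
  refine closure_graph_subset (C := {r | inner ℂ p.2 r.1 = inner ℂ p.1 r.2})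
    (isClosed_eq (by fun_prop) (by fun_prop)) (fun r hr => ?_) hr
  obtain ⟨x, rfl⟩ := (mem_rawOp_graph_iff B p).1 hp
  obtain ⟨y, rfl⟩ := (mem_rawOp_graph_iff Bp r).1 hr
  exact h x y

theorem dense_closedOp_domain (hD : Dense (D : Set H)) (B : Module.End ℂ D) :
    Dense ((closedOp B).domain : Set H) :=
  hD.mono fun x hx => mem_closedOp_domain B ⟨x, hx⟩

/-- For symmetric N the number ⟨Nx, x⟩ is real, so the imaginary part of ⟨(N + i)x, x⟩ has absolute
value ‖x‖²; Cauchy–Schwarz does the rest. -/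
theorem FormallyAdjoint.norm_le {N : Module.End ℂ D} (h : FormallyAdjoint N N) (x : D) :
    ‖x‖ ≤ ‖(N + algebraMap ℂ _ Complex.I) x‖ := by
  have h1 : inner ℂ (((N + algebraMap ℂ _ Complex.I) x : D) : H) (x : H) =
      inner ℂ (N x : H) (x : H) - Complex.I * (‖x‖ : ℂ) ^ 2 := by
    simp [Module.algebraMap_end_apply, inner_self_eq_norm_sq_to_K, sub_eq_add_neg, mul_comm]
  have h2 : (inner ℂ (N x : H) (x : H) : ℂ).im = 0 := by
    rw [← Complex.conj_eq_iff_im, inner_conj_symm, h x x]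
  have h3 : ‖x‖ ^ 2 ≤ ‖(N + algebraMap ℂ _ Complex.I) x‖ * ‖x‖ := by
    have h4 : |(inner ℂ (((N + algebraMap ℂ _ Complex.I) x : D) : H) (x : H) : ℂ).im| =
        ‖x‖ ^ 2 := by
      rw [h1, Complex.sub_im, h2]
      have : (Complex.I * (‖x‖ : ℂ) ^ 2).im = ‖x‖ ^ 2 := by
        rw [← Complex.ofReal_pow, Complex.I_mul_im, Complex.ofReal_re]
      rw [this, zero_sub, abs_neg, abs_of_nonneg (sq_nonneg _)]
    rw [← h4]
    exact (Complex.abs_im_le_norm _).trans (norm_inner_le_norm _ _)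
  by_cases hx : ‖x‖ = 0
  · rw [hx]; exact norm_nonneg _
  · have : 0 < ‖x‖ := lt_of_le_of_ne (norm_nonneg _) (Ne.symm hx)
    rw [sq] at h3
    exact le_of_mul_le_mul_right h3 this

variable [CompleteSpace H]

/-- The adjoint of the densely defined `B` is a closed extension of `Bp`. -/
theorem FormallyAdjoint.isClosable {B Bp : Module.End ℂ D} (hD : Dense (D : Set H))
    (h : FormallyAdjoint B Bp) : (rawOp Bp).IsClosable := by
  rw [LinearPMap.isClosable_iff_exists_closed_extension]
  exact ⟨(rawOp B)†, LinearPMap.adjoint_isClosed hD,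
    LinearPMap.IsFormalAdjoint.le_adjoint hD fun x y => h x y⟩

theorem FormallyAdjoint.le_adjoint {B Bp : Module.End ℂ D} (hD : Dense (D : Set H))
    (h : FormallyAdjoint B Bp) : closedOp Bp ≤ (closedOp B)† :=
  LinearPMap.IsFormalAdjoint.le_adjoint (dense_closedOp_domain hD B) fun x y =>
    h.closure_inner (LinearPMap.mem_graph _ x) (LinearPMap.mem_graph _ y)

/-- A symmetric operator `N` with invariant dense domain is essentially self-adjoint if `N ± i`
are surjective. -/
theorem isSelfAdjoint_closedOp {N : Module.End ℂ D} (hD : Dense (D : Set H))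
    (h : FormallyAdjoint N N)
    (h1 : Function.Surjective (N + algebraMap ℂ (Module.End ℂ D) Complex.I))
    (h2 : Function.Surjective (N - algebraMap ℂ (Module.End ℂ D) Complex.I)) :
    IsSelfAdjoint (closedOp N) := by
  have hinj : Function.Injective (N + algebraMap ℂ (Module.End ℂ D) Complex.I) := by
    rw [injective_iff_map_eq_zero]
    intro x hx
    have := h.norm_le x
    rw [hx, norm_zero] at this
    exact norm_le_zero_iff.1 this
  let e := LinearEquiv.ofBijective _ ⟨hinj, h1⟩
  -- By `norm_le` the inverse of N + i is a contraction on D; `J` is its continuous extension to H,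
  -- the resolvent of the closure.
  let J0 : D →L[ℂ] H := (D.subtype ∘ₗ e.symm.toLinearMap).mkContinuous 1 fun x => by
    rw [one_mul]
    calc ‖e.symm x‖ ≤ ‖e (e.symm x)‖ := h.norm_le _
      _ = ‖x‖ := by rw [e.apply_symm_apply]
  let J : H →L[ℂ] H := J0.extend D.subtypeL
  have hJ (x : D) : J x = e.symm x :=
    ContinuousLinearMap.extend_eq J0 hD.denseRange_val isUniformEmbedding_subtype_val.isUniformInducing x
  have hcl : (closedOp N).IsClosed := (h.isClosable hD).closure_isClosed
  -- Membership in the graph of the closure is a closed condition on `w`, and on D it says that `J`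
  -- inverts N + i.
  have hgr (w : H) : (J w, w - Complex.I • J w) ∈ (closedOp N).graph := by
    have hc : IsClosed {w : H | (J w, w - Complex.I • J w) ∈ (closedOp N).graph} :=
      IsClosed.preimage (f := fun w => (J w, w - Complex.I • J w)) (by fun_prop) hcl
    have : (D : Set H) ⊆ {w : H | (J w, w - Complex.I • J w) ∈ (closedOp N).graph} := by
      intro x hx
      have h3 : N (e.symm ⟨x, hx⟩) + Complex.I • e.symm ⟨x, hx⟩ = ⟨x, hx⟩ := by
        exact e.apply_symm_apply ⟨x, hx⟩
      have h4 : x - Complex.I • (e.symm ⟨x, hx⟩ : H) = N (e.symm ⟨x, hx⟩) := by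
        have := congrArg (Subtype.val) h3
        simp only [Submodule.coe_add, Submodule.coe_smul] at this
        exact sub_eq_iff_eq_add.2 this.symm
      rw [Set.mem_ofPred_eq]
      rw [show J x = e.symm ⟨x, hx⟩ from hJ ⟨x, hx⟩, h4]
      exact mem_closedOp_graph N _
    have := closure_minimal this hc
    rw [hD.closure_eq] at this
    exact this (Set.mem_univ w)
  rw [LinearPMap.isSelfAdjoint_def]
  have hle := h.le_adjoint hD
  refine le_antisymm (LinearPMap.le_of_le_graph ?_) hle
  have hdd := dense_closedOp_domain hD N
  intro p hp
  obtain ⟨y, hy1, hy2⟩ := (LinearPMap.mem_graph_iff _).1 hp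
  have key := hgr (p.2 + Complex.I • p.1)
  set d := J (p.2 + Complex.I • p.1) with hd
  -- For (p.1, p.2) in the graph of the adjoint, `d` solves (N + i)d = p.2 + i p.1 in the closure.
  -- The difference p.1 - d is orthogonal to the range of N - i, which is the dense subspace D.
  have hz : p.1 - d = 0 := by
    apply hD.eq_zero_of_inner_left ℂ
    intro v hv
    obtain ⟨u, hu⟩ := h2 ⟨v, hv⟩
    have hu' : v = (N u : H) - Complex.I • (u : H) := by
      have := congrArg Subtype.val hu
      simpa [Module.algebraMap_end_apply] using this.symm
    have e1 : inner ℂ p.2 (u : H) = inner ℂ p.1 (N u : H) := by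
      have := LinearPMap.adjoint_isFormalAdjoint hdd y ⟨u, mem_closedOp_domain N u⟩
      rw [hy1, hy2] at this
      rw [this]
      congr 1
      have := app_closedOp N u
      rwa [app, dif_pos (mem_closedOp_domain N u)] at this
    have e2 := h.closure_inner key (mem_closedOp_graph N u)
    simp only at e2
    rw [hu', inner_sub_right, inner_sub_left, inner_sub_left, ← e1, ← e2]
    simp only [inner_sub_left, inner_add_left, inner_smul_left, inner_smul_right, Complex.conj_I]
    ring
  have hpd : p.1 = d := sub_eq_zero.1 hz
  rw [← hpd, add_sub_cancel_right] at key
  exact key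

/-- Surjectivity of `N ± i` for operators with enough eigenvectors. -/
theorem surjective_of_eigenvectors {D : Type*} [AddCommGroup D] [Module ℂ D]
    {N : Module.End ℂ D} {S : Set D} (hS : Submodule.span ℂ S = ⊤)
    (h : ∀ v ∈ S, ∃ c : ℝ, N v = (c : ℂ) • v) {z : ℂ} (hz : z.im ≠ 0) :
    Function.Surjective (N + algebraMap ℂ (Module.End ℂ D) z) := by
  rw [← LinearMap.range_eq_top, ← top_le_iff, ← hS, Submodule.span_le]
  intro v hv
  obtain ⟨c, hc⟩ := h v hv
  have hne : (c : ℂ) + z ≠ 0 := fun h0 => hz (by simpa using congrArg Complex.im h0)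
  refine ⟨((c : ℂ) + z)⁻¹ • v, ?_⟩
  rw [map_smul, LinearMap.add_apply, hc, Module.algebraMap_end_apply, ← add_smul, smul_smul,
    inv_mul_cancel₀ hne, one_smul]

variable {ι : Type*} [Fintype ι] [DecidableEq ι]

/-- Operators on a common invariant dense domain that satisfy the relations define a
`*`-representation if the number operator has enough eigenvectors. -/
theorem isQCRStarRep_closedOp (hD : Dense (D : Set H)) {c₁ c₂ : ℂ} {R : ι → ι → ι → ι → ℂ}
    {B Bp : ι → Module.End ℂ D} (hadj : ∀ i, FormallyAdjoint (B i) (Bp i))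
    (hq : SatisfiesQCR (algebraMap ℂ (Module.End ℂ D) c₁) (algebraMap ℂ (Module.End ℂ D) c₂)
      (fun i j h k => algebraMap ℂ (Module.End ℂ D) (R i j h k)) B Bp)
    {S : Set D} (hS : Submodule.span ℂ S = ⊤)
    (h : ∀ v ∈ S, ∃ c : ℝ, (∑ i, Bp i * B i) v = (c : ℂ) • v) :
    IsQCRStarRep c₁ c₂ R (fun i => closedOp (B i)) (fun i => closedOp (Bp i)) D where
  ann_closed i := ((hadj i).symm.isClosable hD).closure_isClosed
  cre_closed i := ((hadj i).isClosable hD).closure_isClosed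
  cre_le_adjoint i := (hadj i).le_adjoint hD
  dense := hD
  mem_domain k l x hx := by
    have aux (k : ι ⊕ ι) : Sum.elim (fun i => closedOp (B i)) (fun i => closedOp (Bp i)) k =
        closedOp (Sum.elim B Bp k) := by cases k <;> rfl
    rw [aux, aux]
    refine ⟨mem_closedOp_domain _ ⟨x, hx⟩, ?_⟩
    rw [app_closedOp _ ⟨x, hx⟩]
    exact mem_closedOp_domain _ _
  ann_ann i j x hx := by
    lift x to D using hx
    have := congrArg Subtype.val (LinearMap.congr_fun (hq.1 i j) x)
    simpa [Module.algebraMap_end_apply, Finset.smul_sum, smul_smul, mul_comm] using this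
  cre_cre i j x hx := by
    lift x to D using hx
    have := congrArg Subtype.val (LinearMap.congr_fun (hq.2.1 i j) x)
    simpa [Module.algebraMap_end_apply, Finset.smul_sum, smul_smul, mul_comm] using this
  ann_cre i j x hx := by
    lift x to D using hx
    have := congrArg Subtype.val (LinearMap.congr_fun (hq.2.2 i j) x)
    split_ifs with hij <;>
      simpa [Module.algebraMap_end_apply, hij, Finset.smul_sum, smul_smul, mul_comm] using this
  number_esa := by
    refine ⟨rawOp (∑ i, Bp i * B i), rfl, fun x => ?_, ?_⟩
    · change (((∑ i, Bp i * B i) x : D) : H) = ∑ i, app _ (app _ ((x : D) : H))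
      simp
    · have hN : FormallyAdjoint (∑ i, Bp i * B i) (∑ i, Bp i * B i) :=
        FormallyAdjoint.sum _ fun i => (hadj i).symm.mul (hadj i)
      refine isSelfAdjoint_closedOp hD hN (surjective_of_eigenvectors hS h (by simp)) ?_
      rw [sub_eq_add_neg, ← map_neg]
      exact surjective_of_eigenvectors hS h (by simp)

end Operators

/-! ### Transport by unitary operators -/

section Transport
variable {H K : Type*} [NormedAddCommGroup H] [InnerProductSpace ℂ H]
  [NormedAddCommGroup K] [InnerProductSpace ℂ K] (V : K ≃ₗᵢ[ℂ] H)

/-- Graphs turn `conj` into a preimage under a homeomorphism of products, from which its behaviour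
under closure is read off. -/
theorem mem_conj_graph_iff (T : K →ₗ.[ℂ] K) (p : H × H) :
    p ∈ (conj V T).graph ↔ (V.symm p.1, V.symm p.2) ∈ T.graph := by
  simp only [LinearPMap.mem_graph_iff]
  constructor
  · rintro ⟨x, h1, h2⟩
    refine ⟨⟨V.symm x, x.2⟩, by simp [h1], ?_⟩
    rw [← h2]
    change _ = V.symm (V _)
    rw [V.symm_apply_apply]
    rfl
  · rintro ⟨x, h1, h2⟩
    refine ⟨⟨p.1, ?_⟩, rfl, ?_⟩
    · change V.symm p.1 ∈ T.domain
      rw [← h1]; exact x.2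
    · rw [← V.apply_symm_apply p.2, ← h2]
      change V (T _) = V (T x)
      congr 2
      exact Subtype.ext h1.symm

theorem conj_isClosable {T : K →ₗ.[ℂ] K} (h : T.IsClosable) : (conj V T).IsClosable := by
  obtain ⟨g, hg, hle⟩ := LinearPMap.isClosable_iff_exists_closed_extension.1 h
  refine LinearPMap.isClosable_iff_exists_closed_extension.2 ⟨conj V g, ?_, ?_⟩
  · have : ((conj V g).graph : Set (H × H)) =
        (fun p : H × H => (V.symm p.1, V.symm p.2)) ⁻¹' g.graph :=
      Set.ext fun p => mem_conj_graph_iff V g p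
    rw [LinearPMap.IsClosed, this]
    exact IsClosed.preimage (by fun_prop) hg
  · refine LinearPMap.le_of_le_graph fun p hp => ?_
    rw [mem_conj_graph_iff] at hp ⊢
    exact LinearPMap.le_graph_of_le hle hp

/-- V × V is a homeomorphism carrying graph to graph, so it commutes with topological closure;
closability ensures that the operator closures really are the closures of the graphs. -/
theorem conj_closure {T : K →ₗ.[ℂ] K} (h : T.IsClosable) :
    conj V T.closure = (conj V T).closure := by
  apply LinearPMap.eq_of_eq_graph
  apply SetLike.ext'
  let E : K × K ≃ₜ H × H := V.toHomeomorph.prodCongr V.toHomeomorph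
  have hE (T : K →ₗ.[ℂ] K) : ((conj V T).graph : Set (H × H)) = E.symm ⁻¹' T.graph :=
    Set.ext fun p => mem_conj_graph_iff V T p
  rw [← (conj_isClosable V h).graph_closure_eq_closure_graph, hE,
    ← h.graph_closure_eq_closure_graph, Submodule.topologicalClosure_coe,
    Submodule.topologicalClosure_coe, hE]
  exact E.symm.preimage_closure _

variable {D : Submodule ℂ K} {D' : Submodule ℂ H}

/-- `V (closure B) V⁻¹` is the closure of `B'` if `V` carries `D` to `D'` and `B` to `B'`. -/
theorem conj_closedOp (e : D ≃ₗ[ℂ] D') (he : ∀ x, (e x : H) = V x) {B : Module.End ℂ D}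
    {B' : Module.End ℂ D'} (hB : ∀ x, e (B x) = B' (e x)) (hc : (rawOp B).IsClosable) :
    conj V (closedOp B) = closedOp B' := by
  change conj V (rawOp B).closure = (rawOp B').closure
  rw [conj_closure V hc]
  congr 1
  apply LinearPMap.eq_of_eq_graph
  ext p
  rw [mem_conj_graph_iff, mem_rawOp_graph_iff, mem_rawOp_graph_iff]
  constructor
  · rintro ⟨x, hx⟩
    refine ⟨e x, ?_⟩
    rw [← hB, he, he]
    simp only [Prod.ext_iff] at hx ⊢
    rw [← hx.1, ← hx.2]; simp
  · rintro ⟨x, rfl⟩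
    refine ⟨e.symm x, ?_⟩
    have h1 : (x : H) = V (e.symm x) := by rw [← he, e.apply_symm_apply]
    have h2 : (B' x : H) = V (B (e.symm x)) := by rw [← he, hB, e.apply_symm_apply]
    simp [h1, h2]

/-- Unitary transport of the `*`-representation of `isQCRStarRep_closedOp`. -/
theorem isQCRStarRep_conj [CompleteSpace H] {ι : Type*} [Fintype ι] [DecidableEq ι]
    {D : Submodule ℂ H} (V : H ≃ₗᵢ[ℂ] H)
    (hD : Dense (D : Set H)) {c₁ c₂ : ℂ} {R : ι → ι → ι → ι → ℂ}
    {B Bp : ι → Module.End ℂ D} (hadj : ∀ i, FormallyAdjoint (B i) (Bp i))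
    (hq : SatisfiesQCR (algebraMap ℂ (Module.End ℂ D) c₁) (algebraMap ℂ (Module.End ℂ D) c₂)
      (fun i j h k => algebraMap ℂ (Module.End ℂ D) (R i j h k)) B Bp)
    {S : Set D} (hS : Submodule.span ℂ S = ⊤)
    (h : ∀ v ∈ S, ∃ c : ℝ, (∑ i, Bp i * B i) v = (c : ℂ) • v) :
    IsQCRStarRep c₁ c₂ R (fun i => conj V (closedOp (B i))) (fun i => conj V (closedOp (Bp i)))
      (D.map (V.toLinearEquiv : H →ₗ[ℂ] H)) := by
  let e : D ≃ₗ[ℂ] D.map (V.toLinearEquiv : H →ₗ[ℂ] H) := V.toLinearEquiv.submoduleMap D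
  have he (x : D) : (e x : H) = V x := rfl
  -- V restricts to a bijection `e` of D onto V D. Conjugation with `e` is an isomorphism of
  -- endomorphism algebras and carries all hypotheses of `isQCRStarRep_closedOp` to V D.
  let φ : Module.End ℂ D ≃ₐ[ℂ] Module.End ℂ (D.map (V.toLinearEquiv : H →ₗ[ℂ] H)) :=
    e.conjAlgEquiv ℂ
  have hφ (B : Module.End ℂ D) (x : D) : e (B x) = φ B (e x) := by
    simp [φ]
  have hφ' (B : Module.End ℂ D) (y) : φ B y = e (B (e.symm y)) := by
    rw [hφ, e.apply_symm_apply]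
  rw [funext fun i => conj_closedOp V e he (hφ (B i)) ((hadj i).symm.isClosable hD),
    funext fun i => conj_closedOp V e he (hφ (Bp i)) ((hadj i).isClosable hD)]
  refine isQCRStarRep_closedOp (S := e '' S) ?_ (fun i x y => ?_) ?_ ?_ ?_
  · rw [Submodule.map_coe]
    exact V.toHomeomorph.surjective.denseRange.dense_image V.continuous hD
  · rw [hφ', hφ', he, he]
    obtain ⟨x, rfl⟩ := e.surjective x
    obtain ⟨y, rfl⟩ := e.surjective y
    rw [e.symm_apply_apply, e.symm_apply_apply, he, he, V.inner_map_map, V.inner_map_map]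
    exact hadj i x y
  · obtain ⟨q1, q2, q3⟩ := hq
    refine ⟨fun i j => ?_, fun i j => ?_, fun i j => ?_⟩
    · have := congrArg φ (q1 i j)
      simpa only [map_mul, map_sum, AlgEquiv.commutes] using this
    · have := congrArg φ (q2 i j)
      simpa only [map_mul, map_sum, AlgEquiv.commutes] using this
    · have := congrArg φ (q3 i j)
      simpa only [map_mul, map_sum, map_add, apply_ite φ, map_one, map_zero,
        AlgEquiv.commutes] using this
  · rw [← LinearEquiv.coe_coe, Submodule.span_image, hS, Submodule.map_top]
    exact LinearEquiv.range e
  · rintro _ ⟨v, hv, rfl⟩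
    obtain ⟨c, hc⟩ := h v hv
    refine ⟨c, ?_⟩
    have : ∑ i, φ (Bp i) * φ (B i) = φ (∑ i, Bp i * B i) := by simp
    rw [this, ← hφ, hc, map_smul]

end Transport

/-! ### Cauchy products -/

open Finset.HasAntidiagonal in
/-- The Cauchy product of absolutely convergent series, for a separately continuous bounded
product `β`. -/
theorem hasSum_antidiagonal_of_summable_norm {E F G : Type*} [NormedAddCommGroup E]
    [NormedAddCommGroup F] [NormedAddCommGroup G] [CompleteSpace G] {β : E → F → G}
    (hl : ∀ (y : F) (f : ℕ → E) (s : E), HasSum f s → HasSum (fun n => β (f n) y) (β s y))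
    (hr : ∀ (x : E) (g : ℕ → F) (t : F), HasSum g t → HasSum (fun n => β x (g n)) (β x t))
    (hn : ∀ x y, ‖β x y‖ ≤ ‖x‖ * ‖y‖) {f : ℕ → E} {s : E} (hf : HasSum f s)
    (hf' : Summable fun n => ‖f n‖) {g : ℕ → F} {t : F} (hg : HasSum g t)
    (hg' : Summable fun n => ‖g n‖) :
    HasSum (fun n => ∑ p ∈ antidiagonal n, β (f p.1) (g p.2)) (β s t) := by
  -- Only separate continuity and the norm bound enter, so that `β` may be the sesquilinear inner
  -- product as well as scalar or complex multiplication.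
  have hs : Summable fun p : ℕ × ℕ => β (f p.1) (g p.2) := by
    refine Summable.of_norm_bounded
      (hf'.mul_of_nonneg hg' (fun _ => norm_nonneg _) fun _ => norm_nonneg _) fun p => hn _ _
  have h1 : HasSum (fun p : ℕ × ℕ => β (f p.1) (g p.2)) (β s t) := by
    have h2 := hs.hasSum.prod_fiberwise fun m => hr (f m) g t hg
    rw [← h2.unique (hl t f s hf)]
    exact hs.hasSum
  rw [← Finset.HasAntidiagonal.sigmaAntidiagonalEquivProd.hasSum_iff] at h1
  refine h1.sigma fun n => ?_
  have := hasSum_fintype fun p : antidiagonal n => β (f p.1.1) (g p.1.2)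
  rwa [← Finset.sum_coe_sort]

/-! ### Unitary operators from convergent unitary series. -/

section Unitary
set_option linter.unusedSectionVars false
variable {H : Type*} [NormedAddCommGroup H] [InnerProductSpace ℂ H] {D : Submodule ℂ H}
  {s : Stat} {ι : Type*} [Fintype ι] [DecidableEq ι]

theorem CAlg_induction {P : CAlg s ι → Prop} (scalar : ∀ c, P (algebraMap ℂ _ c))
    (ann : ∀ i, P (ann s i)) (cre : ∀ i, P (cre s i)) (mul : ∀ x y, P x → P y → P (x * y))
    (add : ∀ x y, P x → P y → P (x + y)) (x : CAlg s ι) : P x := by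
  obtain ⟨y, rfl⟩ := RingQuot.mkAlgHom_surjective ℂ (CRel s ι) x
  change P (toC s ι y)
  induction y using FreeAlgebra.induction with
  | grade0 r => rw [AlgHom.commutes]; exact scalar r
  | grade1 x => rcases x with i | i; exacts [ann i, cre i]
  | mul a b ha hb => rw [map_mul]; exact mul _ _ ha hb
  | add a b ha hb => rw [map_add]; exact add _ _ ha hb

theorem star_ann (i : ι) : star (ann s i) = cre s i := by
  change (starC s ι (ann s i)).get = _
  rw [starC_ann, ConjOp.get_mk]

theorem star_cre (i : ι) : star (cre s i) = ann s i := by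
  rw [← star_ann, star_star]

theorem star_algebraMap (c : ℂ) :
    star (algebraMap ℂ (CAlg s ι) c) = algebraMap ℂ _ (starRingEnd ℂ c) := by
  change (starC s ι (algebraMap ℂ _ c)).get = _
  rw [AlgHom.commutes, ConjOp.get_algebraMap]

theorem star_smul_CAlg (c : ℂ) (x : CAlg s ι) : star (c • x) = starRingEnd ℂ c • star x := by
  rw [Algebra.smul_def, star_mul, star_algebraMap, ← Algebra.commutes, ← Algebra.smul_def]

/-- Adjointness of the generators propagates: formal adjoints reverse products and conjugate scalars
exactly as `star` does. -/
theorem IsFockRep.formallyAdjoint {L : Type*} {π : CAlg s ι →ₐ[ℂ] Module.End ℂ D} {Ω : L → D}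
    (hπ : IsFockRep π Ω) (x : CAlg s ι) : FormallyAdjoint (π x) (π (star x)) := by
  induction x using CAlg_induction with
  | scalar c =>
    intro x y
    rw [star_algebraMap, AlgHom.commutes, AlgHom.commutes, Module.algebraMap_end_apply,
      Module.algebraMap_end_apply, Submodule.coe_smul, Submodule.coe_smul, inner_smul_left,
      inner_smul_right]
  | ann i => rw [star_ann]; exact hπ.adjoint i
  | cre i => rw [star_cre]; exact FormallyAdjoint.symm (hπ.adjoint i)
  | mul x y hx hy => rw [star_mul, map_mul, map_mul]; exact hx.mul hy
  | add x y hx hy =>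
    intro v w
    rw [star_add, map_add, map_add, LinearMap.add_apply, LinearMap.add_apply, Submodule.coe_add,
      Submodule.coe_add, inner_add_left, inner_add_right, hx, hy]

variable {π : CAlg s ι →ₐ[ℂ] Module.End ℂ D} [CompleteSpace H]

/-- The limit of the series `π(α)`. -/
noncomputable def valueMap {h : ℝ} {α : PowerSeries (CAlg s ι)} (hα : ConvergesAt π h α) :
    D →ₗ[ℂ] H where
  toFun v := ∑' n : ℕ, (h : ℂ) ^ n • ((π (PowerSeries.coeff n α) v : D) : H)
  map_add' v w := by
    rw [← (hα v).of_norm.tsum_add (hα w).of_norm]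
    simp
  map_smul' c v := by
    rw [RingHom.id_apply, ← (hα v).of_norm.tsum_const_smul c]
    refine tsum_congr fun n => ?_
    rw [map_smul, Submodule.coe_smul, smul_comm]

theorem hasSum_valueMap {h : ℝ} {α : PowerSeries (CAlg s ι)} (hα : ConvergesAt π h α) (v : D) :
    HasSum (fun n : ℕ => (h : ℂ) ^ n • ((π (PowerSeries.coeff n α) v : D) : H)) (valueMap hα v) :=
  (hα v).of_norm.hasSum

theorem coeff_psStar {M : Type*} [Semiring M] [StarRing M] (f : PowerSeries M) (n : ℕ) :
    PowerSeries.coeff n (psStar f) = star (PowerSeries.coeff n f) :=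
  PowerSeries.coeff_mk n _

theorem psStar_psStar {M : Type*} [Semiring M] [StarRing M] (f : PowerSeries M) :
    psStar (psStar f) = f := by
  ext n; simp [coeff_psStar]

/-- The inner product of the two limits is the Cauchy product Σ hⁿ ⟨v, π((α^⋆ α)ₙ) w⟩, in which only
n = 0 survives because α^⋆ α = 1. Absolute convergence justifies the product, and h being real lets
its powers pass the conjugate-linear slot. -/
theorem inner_valueMap (hadj : ∀ x, FormallyAdjoint (π x) (π (star x))) {h : ℝ}
    {α : PowerSeries (CAlg s ι)} (hα : ConvergesAt π h α) (hu : psStar α * α = 1) (v w : D) :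
    inner ℂ (valueMap hα v) (valueMap hα w) = inner ℂ (v : H) (w : H) := by
  have h1 := hasSum_antidiagonal_of_summable_norm (β := fun x y : H => inner ℂ x y)
    (fun y f s hf => hf.map (innerSLFlip ℂ y).toLinearMap.toAddMonoidHom
      (innerSLFlip ℂ y).continuous)
    (fun x f s hf => hf.mapL (innerSL ℂ x)) norm_inner_le_norm
    (hasSum_valueMap hα v) (hα v) (hasSum_valueMap hα w) (hα w)
  refine h1.unique ?_
  have h2 (n : ℕ) : ∑ p ∈ Finset.HasAntidiagonal.antidiagonal n,
      inner ℂ ((h : ℂ) ^ p.1 • ((π (PowerSeries.coeff p.1 α) v : D) : H))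
        ((h : ℂ) ^ p.2 • ((π (PowerSeries.coeff p.2 α) w : D) : H)) =
      (h : ℂ) ^ n * inner ℂ (v : H) (π (PowerSeries.coeff n (psStar α * α)) w : H) := by
    rw [PowerSeries.coeff_mul, map_sum, LinearMap.sum_apply, Submodule.coe_sum, inner_sum,
      Finset.mul_sum]
    refine Finset.sum_congr rfl fun p hp => ?_
    rw [inner_smul_left, inner_smul_right, hadj, coeff_psStar, map_mul, Module.End.mul_apply,
      ← Finset.HasAntidiagonal.mem_antidiagonal.1 hp, pow_add, map_pow, Complex.conj_ofReal, mul_assoc]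
  simp only [h2, hu]
  have h3 := hasSum_single (f := fun n : ℕ => (h : ℂ) ^ n *
    inner ℂ (v : H) (π (PowerSeries.coeff n (1 : PowerSeries (CAlg s ι))) w : H)) 0 (fun n hn => by
      simp [PowerSeries.coeff_one, hn])
  simpa using h3

theorem inner_valueMap_psStar (hadj : ∀ x, FormallyAdjoint (π x) (π (star x))) {h : ℝ}
    {α : PowerSeries (CAlg s ι)} (hα : ConvergesAt π h α) (hα' : ConvergesAt π h (psStar α))
    (v w : D) : inner ℂ (valueMap hα v) (w : H) = inner ℂ (v : H) (valueMap hα' w) := by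
  have h1 := (hasSum_valueMap hα v).map (innerSLFlip ℂ (w : H)).toLinearMap.toAddMonoidHom
      (innerSLFlip ℂ (w : H)).continuous
  have h2 := (hasSum_valueMap hα' w).mapL (innerSL ℂ (v : H))
  have h3 : ∀ n : ℕ, inner ℂ ((h : ℂ) ^ n • ((π (PowerSeries.coeff n α) v : D) : H)) (w : H) =
      inner ℂ (v : H) ((h : ℂ) ^ n • ((π (PowerSeries.coeff n (psStar α)) w : D) : H)) := fun n => by
    rw [inner_smul_left, inner_smul_right, hadj, coeff_psStar, map_pow, Complex.conj_ofReal]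
  exact ((funext h3 : (fun n : ℕ => _) = _) ▸ h1 : HasSum _ _).unique h2

/-- Two formally adjoint isometries of a dense subspace extend to inverse unitary operators. -/
theorem exists_linearIsometryEquiv_of_adjoint (hD : Dense (D : Set H)) (A W : D →ₗ[ℂ] H)
    (hA : ∀ v w, inner ℂ (A v) (A w) = inner ℂ (v : H) (w : H))
    (hW : ∀ v w, inner ℂ (W v) (W w) = inner ℂ (v : H) (w : H))
    (hAW : ∀ v w : D, inner ℂ (A v) (w : H) = inner ℂ (v : H) (W w)) :
    ∃ V : H ≃ₗᵢ[ℂ] H, ∀ v : D, V v = A v := by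
  have ext (A : D →ₗ[ℂ] H) (hA : ∀ v w, inner ℂ (A v) (A w) = inner ℂ (v : H) (w : H)) :
      ∃ B : H →L[ℂ] H, (∀ v : D, B v = A v) ∧ ∀ x, ‖B x‖ = ‖x‖ := by
    have hn (v : D) : ‖A v‖ = ‖v‖ := by
      rw [@norm_eq_sqrt_re_inner ℂ _ _ _ _ (A v), hA, ← norm_eq_sqrt_re_inner]; rfl
    let A0 : D →L[ℂ] H := A.mkContinuous 1 fun v => by rw [hn, one_mul]
    have h1 (v : D) : A0.extend D.subtypeL v = A v :=
      ContinuousLinearMap.extend_eq A0 hD.denseRange_val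
        isUniformEmbedding_subtype_val.isUniformInducing v
    refine ⟨A0.extend D.subtypeL, h1, fun x => ?_⟩
    have hc : IsClosed {x : H | ‖A0.extend D.subtypeL x‖ = ‖x‖} :=
      isClosed_eq (by fun_prop) (by fun_prop)
    have : (D : Set H) ⊆ {x : H | ‖A0.extend D.subtypeL x‖ = ‖x‖} := fun x hx => by
      rw [Set.mem_ofPred_eq, h1 ⟨x, hx⟩, hn]; rfl
    have := closure_minimal this hc
    rw [hD.closure_eq] at this
    exact this (Set.mem_univ x)
  obtain ⟨B, hB, hBn⟩ := ext A hA
  obtain ⟨C, hC, hCn⟩ := ext W hW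
  have hBC (x y : H) : inner ℂ (B x) y = inner ℂ x (C y) := by
    have hc : IsClosed {p : H × H | inner ℂ (B p.1) p.2 = inner ℂ p.1 (C p.2)} :=
      isClosed_eq (by fun_prop) (by fun_prop)
    have : (D : Set H) ×ˢ (D : Set H) ⊆
        {p : H × H | inner ℂ (B p.1) p.2 = inner ℂ p.1 (C p.2)} := fun p hp => by
      rw [Set.mem_ofPred_eq, hB ⟨p.1, hp.1⟩, hC ⟨p.2, hp.2⟩]
      exact hAW ⟨p.1, hp.1⟩ ⟨p.2, hp.2⟩
    have := closure_minimal this hc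
    rw [(hD.prod hD).closure_eq] at this
    exact this (Set.mem_univ (x, y))
  let Bi : H →ₗᵢ[ℂ] H := ⟨B.toLinearMap, hBn⟩
  let Ci : H →ₗᵢ[ℂ] H := ⟨C.toLinearMap, hCn⟩
  -- The isometries are mutually adjoint, so ⟨B C y, z⟩ = ⟨C y, C z⟩ = ⟨y, z⟩. Surjectivity thus
  -- comes from the adjoint being isometric too.
  have e1 (y : H) : B (C y) = y := by
    refine ext_inner_right ℂ fun z => ?_
    rw [hBC]
    exact Ci.inner_map_map y z
  have e2 (y : H) : C (B y) = y := by
    refine ext_inner_left ℂ fun z => ?_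
    rw [← hBC]
    exact Bi.inner_map_map z y
  exact ⟨⟨LinearEquiv.ofLinearMap B.toLinearMap C.toLinearMap (LinearMap.ext e1) (LinearMap.ext e2),
    hBn⟩, hB⟩

/-- A convergent unitary series extends to a unitary operator. -/
theorem exists_unitary_value (hD : Dense (D : Set H))
    (hadj : ∀ x, FormallyAdjoint (π x) (π (star x))) {h : ℝ} {α : PowerSeries (CAlg s ι)}
    (hu : IsUnitaryPS α) (hα : ConvergesAt π h α) (hα' : ConvergesAt π h (psStar α)) :
    ∃ V : H ≃ₗᵢ[ℂ] H, IsValue π h α (fun v => V (v : H)) := by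
  obtain ⟨V, hV⟩ := exists_linearIsometryEquiv_of_adjoint hD (valueMap hα) (valueMap hα')
    (inner_valueMap hadj hα hu.2.2)
    (inner_valueMap hadj hα' (by rw [psStar_psStar]; exact hu.2.1))
    (inner_valueMap_psStar hadj hα hα')
  refine ⟨V, fun v => ?_⟩
  simp only [hV]
  exact hasSum_valueMap hα v

end Unitary

/-! ### The Hopf `*`-algebra `U 𝔤` -/

section HopfLemmas
variable {𝔤 : Type*} [LieRing 𝔤] [LieAlgebra ℂ 𝔤]

/-- The elements with property `P` form a subalgebra containing 𝔤. The map of 𝔤 into it lifts to U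
𝔤, and by the universal property the lift followed by the inclusion is the identity. -/
theorem U_induction {P : U 𝔤 → Prop} (scalar : ∀ c, P (algebraMap ℂ _ c))
    (inc : ∀ x, P (inc 𝔤 x)) (mul : ∀ x y, P x → P y → P (x * y))
    (add : ∀ x y, P x → P y → P (x + y)) (x : U 𝔤) : P x := by
  let S : Subalgebra ℂ (U 𝔤) :=
    { carrier := {x | P x}
      mul_mem' := fun {a b} ha hb => mul a b ha hb
      add_mem' := fun {a b} ha hb => add a b ha hb
      algebraMap_mem' := scalar }
  let f : 𝔤 →ₗ⁅ℂ⁆ S :=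
    { toFun := fun x => ⟨FockDef.inc 𝔤 x, inc x⟩
      map_add' := fun x y => Subtype.ext (map_add _ x y)
      map_smul' := fun c x => Subtype.ext (map_smul _ c x)
      map_lie' := fun {x y} => Subtype.ext (LieHom.map_lie _ x y) }
  have h : S.val.comp (UniversalEnvelopingAlgebra.lift ℂ f) = AlgHom.id ℂ (U 𝔤) := by
    apply UniversalEnvelopingAlgebra.hom_ext
    ext x
    change ((UniversalEnvelopingAlgebra.lift ℂ f (FockDef.inc 𝔤 x) : S) : U 𝔤) = FockDef.inc 𝔤 x
    rw [UniversalEnvelopingAlgebra.lift_ι_apply]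
    rfl
  have h' := DFunLike.congr_fun h x
  change ((UniversalEnvelopingAlgebra.lift ℂ f x : S) : U 𝔤) = x at h'
  rw [← h']
  exact (UniversalEnvelopingAlgebra.lift ℂ f x).2

theorem comul_inc (x : 𝔤) : comul 𝔤 (inc 𝔤 x) = inc 𝔤 x ⊗ₜ[ℂ] 1 + 1 ⊗ₜ[ℂ] inc 𝔤 x :=
  UniversalEnvelopingAlgebra.lift_ι_apply ℂ _ x

theorem counit_inc (x : 𝔤) : counit 𝔤 (inc 𝔤 x) = 0 :=
  UniversalEnvelopingAlgebra.lift_ι_apply ℂ _ x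

theorem antipode_inc (x : 𝔤) : antipode 𝔤 (inc 𝔤 x) = -inc 𝔤 x := by
  change (antipodeOp 𝔤 (inc 𝔤 x)).unop = _
  rw [antipodeOp, UniversalEnvelopingAlgebra.lift_ι_apply]
  rfl

theorem antipode_mul (x y : U 𝔤) : antipode 𝔤 (x * y) = antipode 𝔤 y * antipode 𝔤 x := by
  change (antipodeOp 𝔤 (x * y)).unop = _
  rw [map_mul]
  rfl

theorem antipode_algebraMap (c : ℂ) : antipode 𝔤 (algebraMap ℂ _ c) = algebraMap ℂ _ c := by
  change (antipodeOp 𝔤 (algebraMap ℂ _ c)).unop = _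
  rw [AlgHom.commutes]
  rfl

theorem antipode_one : antipode 𝔤 1 = 1 := by
  have := antipode_algebraMap (𝔤 := 𝔤) 1
  rwa [map_one] at this

/-- Cocommutativity is what makes (Δ ⊗ id)F symmetric in its first two legs, and hence what produces
the R-matrix in `Twist.swap_cocycle`. -/
theorem comul_cocomm (x : U 𝔤) : Algebra.TensorProduct.comm ℂ (U 𝔤) (U 𝔤) (comul 𝔤 x) = comul 𝔤 x := by
  induction x using U_induction with
  | scalar c => rw [AlgHom.commutes, AlgEquiv.commutes]
  | inc x => rw [comul_inc, map_add, Algebra.TensorProduct.comm_tmul,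
      Algebra.TensorProduct.comm_tmul, add_comm]
  | mul x y hx hy => rw [map_mul, map_mul, hx, hy]
  | add x y hx hy => rw [map_add, map_add, hx, hy]

variable (𝔤) in
/-- `x ⊗ y ↦ x S(y)`. -/
noncomputable def mulAntipode : U 𝔤 ⊗[ℂ] U 𝔤 →ₗ[ℂ] U 𝔤 :=
  LinearMap.mul' ℂ (U 𝔤) ∘ₗ TensorProduct.map LinearMap.id (antipode 𝔤)

variable (𝔤) in
/-- `x ⊗ y ↦ S(x) y`. -/
noncomputable def antipodeMul : U 𝔤 ⊗[ℂ] U 𝔤 →ₗ[ℂ] U 𝔤 :=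
  LinearMap.mul' ℂ (U 𝔤) ∘ₗ TensorProduct.map (antipode 𝔤) LinearMap.id

@[simp]
theorem mulAntipode_tmul (x y : U 𝔤) : mulAntipode 𝔤 (x ⊗ₜ y) = x * antipode 𝔤 y := rfl

@[simp]
theorem antipodeMul_tmul (x y : U 𝔤) : antipodeMul 𝔤 (x ⊗ₜ y) = antipode 𝔤 x * y := rfl

/-- The antipode axiom with an arbitrary factor `X`, which makes it stable under products in `w`.
For w = x in 𝔤 and X = y ⊗ z, the terms y x S(z) and y S(z x) = -y x S(z) cancel. -/
theorem mulAntipode_mul_comul (X : U 𝔤 ⊗[ℂ] U 𝔤) (w : U 𝔤) :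
    mulAntipode 𝔤 (X * comul 𝔤 w) = counit 𝔤 w • mulAntipode 𝔤 X := by
  induction w using U_induction generalizing X with
  | scalar c =>
    rw [AlgHom.commutes, AlgHom.commutes, ← Algebra.commutes, ← Algebra.smul_def, map_smul]
    rfl
  | inc x =>
    rw [comul_inc, counit_inc, zero_smul]
    induction X using TensorProduct.induction_on with
    | zero => simp
    | tmul y z =>
      rw [mul_add, Algebra.TensorProduct.tmul_mul_tmul, Algebra.TensorProduct.tmul_mul_tmul,
        map_add, mulAntipode_tmul, mulAntipode_tmul, mul_one, mul_one, antipode_mul, antipode_inc,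
        neg_mul, mul_neg, mul_assoc, add_neg_cancel]
    | add X Y hX hY => rw [add_mul, map_add, hX, hY, add_zero]
  | mul x y hx hy => rw [map_mul (comul 𝔤), map_mul (counit 𝔤), ← mul_assoc, hy, hx, smul_smul, mul_comm]
  | add x y hx hy => rw [map_add, map_add, mul_add, map_add, hx, hy, add_smul]

/-- The mirror image of `mulAntipode_mul_comul`, with the coproduct on the left where S(x) y can
absorb it. -/
theorem antipodeMul_comul_mul (X : U 𝔤 ⊗[ℂ] U 𝔤) (w : U 𝔤) :
    antipodeMul 𝔤 (comul 𝔤 w * X) = counit 𝔤 w • antipodeMul 𝔤 X := by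
  induction w using U_induction generalizing X with
  | scalar c =>
    rw [AlgHom.commutes, AlgHom.commutes, ← Algebra.smul_def, map_smul]
    rfl
  | inc x =>
    rw [comul_inc, counit_inc, zero_smul]
    induction X using TensorProduct.induction_on with
    | zero => simp
    | tmul y z =>
      rw [add_mul, Algebra.TensorProduct.tmul_mul_tmul, Algebra.TensorProduct.tmul_mul_tmul,
        map_add, antipodeMul_tmul, antipodeMul_tmul, one_mul, one_mul, antipode_mul, antipode_inc,
        mul_neg, neg_mul, mul_assoc, neg_add_cancel]
    | add X Y hX hY => rw [mul_add, map_add, hX, hY, add_zero]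
  | mul x y hx hy => rw [map_mul (comul 𝔤), map_mul (counit 𝔤), mul_assoc, hx, hy, smul_smul]
  | add x y hx hy => rw [map_add, map_add, add_mul, map_add, hx, hy, add_smul]

theorem mulAntipode_comul (w : U 𝔤) : mulAntipode 𝔤 (comul 𝔤 w) = algebraMap ℂ _ (counit 𝔤 w) := by
  have h := mulAntipode_mul_comul 1 w
  rwa [one_mul, Algebra.TensorProduct.one_def, mulAntipode_tmul, antipode_one, mul_one,
    ← Algebra.algebraMap_eq_smul_one] at h

section Star
variable [StarAddMonoid 𝔤] [StarLieAlgebra 𝔤]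

theorem star_inc (x : 𝔤) : star (inc 𝔤 x) = inc 𝔤 (star x) := by
  change (starU 𝔤 (inc 𝔤 x)).get = _
  rw [starU_inc, ConjOp.get_mk]

theorem star_algebraMap_U (c : ℂ) :
    star (algebraMap ℂ (U 𝔤) c) = algebraMap ℂ _ (starRingEnd ℂ c) := by
  change (starU 𝔤 (algebraMap ℂ _ c)).get = _
  rw [AlgHom.commutes, ConjOp.get_algebraMap]

theorem star_antipode (x : U 𝔤) : star (antipode 𝔤 x) = antipode 𝔤 (star x) := by
  induction x using U_induction with
  | scalar c => rw [antipode_algebraMap, star_algebraMap_U, antipode_algebraMap]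
  | inc x => rw [antipode_inc, star_neg, star_inc, antipode_inc]
  | mul x y hx hy => rw [antipode_mul, star_mul, star_mul, antipode_mul, hx, hy]
  | add x y hx hy => rw [map_add, star_add, star_add, map_add, hx, hy]

end Star

end HopfLemmas

/-! ### Coefficientwise maps of power series -/

section PowerSeriesLemmas
variable {M N P : Type*} [Semiring M] [Algebra ℂ M] [Semiring N] [Algebra ℂ N]
  [Semiring P] [Algebra ℂ P]

open Finset.HasAntidiagonal

theorem coeff_psMap (L : M →ₗ[ℂ] N) (f : PowerSeries M) (n : ℕ) :
    PowerSeries.coeff n (psMap L f) = L (PowerSeries.coeff n f) :=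
  PowerSeries.coeff_mk n _

/-- An algebra homomorphism applied to every coefficient. -/
noncomputable abbrev mapPS (φ : M →ₐ[ℂ] N) : PowerSeries M →+* PowerSeries N :=
  PowerSeries.map (φ : M →+* N)

theorem psMap_algHom (φ : M →ₐ[ℂ] N) (f : PowerSeries M) :
    psMap φ.toLinearMap f = mapPS φ f := by
  ext n; simp [coeff_psMap]

theorem psMap_id (f : PowerSeries M) : psMap (LinearMap.id : M →ₗ[ℂ] M) f = f := by
  ext n; simp [coeff_psMap]

/-- A product identity for coefficients holds for power series. -/
theorem psMap_mul {Q : Type*} [Semiring Q] [Algebra ℂ Q] (L : N →ₗ[ℂ] Q) (φ : M →ₗ[ℂ] N)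
    (ψ : P →ₗ[ℂ] N) (L₁ : M →ₗ[ℂ] Q) (L₂ : P →ₗ[ℂ] Q)
    (h : ∀ x y, L (φ x * ψ y) = L₁ x * L₂ y) (f : PowerSeries M) (g : PowerSeries P) :
    psMap L (psMap φ f * psMap ψ g) = psMap L₁ f * psMap L₂ g := by
  ext n
  simp only [coeff_psMap, PowerSeries.coeff_mul, map_sum, h]

/-- The variant for maps that reverse the order of the factors; the antidiagonal is reindexed by its
flip. -/
theorem psMap_mul_swap {Q : Type*} [Semiring Q] [Algebra ℂ Q] (L : N →ₗ[ℂ] Q) (φ : M →ₗ[ℂ] N)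
    (ψ : P →ₗ[ℂ] N) (L₁ : M →ₗ[ℂ] Q) (L₂ : P →ₗ[ℂ] Q)
    (h : ∀ x y, L (φ x * ψ y) = L₂ y * L₁ x) (f : PowerSeries M) (g : PowerSeries P) :
    psMap L (psMap φ f * psMap ψ g) = psMap L₂ g * psMap L₁ f := by
  ext n
  simp only [coeff_psMap, PowerSeries.coeff_mul, map_sum, h]
  exact Finset.sum_equiv (Equiv.prodComm ℕ ℕ) (fun p => by simp [add_comm]) fun p _ => rfl

/-- Serves for matrix elements, where a product turns into a sum over the intermediate index. -/
theorem psMap_mul_sum {κ : Type*} [Fintype κ] (L : M →ₗ[ℂ] N)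
    (L₁ L₂ : κ → M →ₗ[ℂ] N) (h : ∀ x y, L (x * y) = ∑ k, L₁ k x * L₂ k y) (f g : PowerSeries M) :
    psMap L (f * g) = ∑ k, psMap (L₁ k) f * psMap (L₂ k) g := by
  ext n
  simp only [coeff_psMap, PowerSeries.coeff_mul, map_sum, h]
  rw [Finset.sum_comm]

theorem psStar_mul {M : Type*} [Semiring M] [StarRing M] (f g : PowerSeries M) :
    psStar (f * g) = psStar g * psStar f := by
  ext n
  simp only [coeff_psStar, PowerSeries.coeff_mul, star_sum, star_mul]
  exact Finset.sum_equiv (Equiv.prodComm ℕ ℕ) (fun p => by simp [add_comm]) fun p _ => rfl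

theorem psStar_psMap [StarRing M] [StarRing N] (L L' : M →ₗ[ℂ] N)
    (h : ∀ x, star (L x) = L' (star x)) (f : PowerSeries M) :
    psStar (psMap L f) = psMap L' (psStar f) := by
  ext n; simp [coeff_psStar, coeff_psMap, h]

theorem psStar_sum {κ : Type*} (s : Finset κ) {M : Type*} [Semiring M] [StarRing M]
    (f : κ → PowerSeries M) : psStar (∑ k ∈ s, f k) = ∑ k ∈ s, psStar (f k) := by
  ext n; simp [coeff_psStar]

theorem psStar_C {M : Type*} [Semiring M] [StarRing M] (a : M) :
    psStar (PowerSeries.C a) = PowerSeries.C (star a) := by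
  ext n
  rw [coeff_psStar, PowerSeries.coeff_C, PowerSeries.coeff_C]
  split_ifs <;> simp

end PowerSeriesLemmas

/-! ### Matrix elements of the twist -/

section Legs
variable (𝔤 : Type*) [LieRing 𝔤] [LieAlgebra ℂ 𝔤]

/-- `x ⊗ y ↦ x ⊗ y ⊗ 1`. -/
noncomputable def leg12 : U 𝔤 ⊗[ℂ] U 𝔤 →ₐ[ℂ] U 𝔤 ⊗[ℂ] (U 𝔤 ⊗[ℂ] U 𝔤) :=
  (Algebra.TensorProduct.assoc ℂ ℂ ℂ (U 𝔤) (U 𝔤) (U 𝔤)).toAlgHom.comp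
    Algebra.TensorProduct.includeLeft

/-- `x ⊗ y ↦ 1 ⊗ x ⊗ y`. -/
noncomputable def leg23 : U 𝔤 ⊗[ℂ] U 𝔤 →ₐ[ℂ] U 𝔤 ⊗[ℂ] (U 𝔤 ⊗[ℂ] U 𝔤) :=
  Algebra.TensorProduct.includeRight

/-- `Δ ⊗ id`. -/
noncomputable def comulLeft : U 𝔤 ⊗[ℂ] U 𝔤 →ₐ[ℂ] U 𝔤 ⊗[ℂ] (U 𝔤 ⊗[ℂ] U 𝔤) :=
  (Algebra.TensorProduct.assoc ℂ ℂ ℂ (U 𝔤) (U 𝔤) (U 𝔤)).toAlgHom.comp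
    (Algebra.TensorProduct.map (comul 𝔤) (AlgHom.id ℂ (U 𝔤)))

/-- `id ⊗ Δ`. -/
noncomputable def comulRight : U 𝔤 ⊗[ℂ] U 𝔤 →ₐ[ℂ] U 𝔤 ⊗[ℂ] (U 𝔤 ⊗[ℂ] U 𝔤) :=
  Algebra.TensorProduct.map (AlgHom.id ℂ (U 𝔤)) (comul 𝔤)

/-- `x ⊗ y ↦ y ⊗ x`. -/
noncomputable def flip12 : U 𝔤 ⊗[ℂ] U 𝔤 →ₐ[ℂ] U 𝔤 ⊗[ℂ] U 𝔤 :=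
  (Algebra.TensorProduct.comm ℂ (U 𝔤) (U 𝔤)).toAlgHom

/-- `x ⊗ y ⊗ z ↦ y ⊗ x ⊗ z`. -/
noncomputable def swap12 : U 𝔤 ⊗[ℂ] (U 𝔤 ⊗[ℂ] U 𝔤) →ₐ[ℂ] U 𝔤 ⊗[ℂ] (U 𝔤 ⊗[ℂ] U 𝔤) :=
  (Algebra.TensorProduct.leftComm ℂ (U 𝔤) (U 𝔤) (U 𝔤)).toAlgHom

variable {𝔤}

theorem leg12_tmul (x y : U 𝔤) : leg12 𝔤 (x ⊗ₜ y) = x ⊗ₜ (y ⊗ₜ 1) := rfl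

theorem leg23_apply (t : U 𝔤 ⊗[ℂ] U 𝔤) : leg23 𝔤 t = 1 ⊗ₜ t := rfl

theorem comulRight_tmul (x y : U 𝔤) : comulRight 𝔤 (x ⊗ₜ y) = x ⊗ₜ comul 𝔤 y := rfl

theorem comulLeft_tmul (x y : U 𝔤) :
    comulLeft 𝔤 (x ⊗ₜ y) = leg12 𝔤 (comul 𝔤 x) * (1 ⊗ₜ (1 ⊗ₜ y)) := by
  change Algebra.TensorProduct.assoc ℂ ℂ ℂ (U 𝔤) (U 𝔤) (U 𝔤) (comul 𝔤 x ⊗ₜ y) = _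
  induction comul 𝔤 x using TensorProduct.induction_on with
  | zero => simp
  | tmul a b => simp [leg12_tmul]
  | add a b ha hb => rw [TensorProduct.add_tmul, map_add, map_add, add_mul, ha, hb]

theorem flip12_tmul (x y : U 𝔤) : flip12 𝔤 (x ⊗ₜ y) = y ⊗ₜ x := rfl

theorem flip12_flip12 (t : U 𝔤 ⊗[ℂ] U 𝔤) : flip12 𝔤 (flip12 𝔤 t) = t :=
  (Algebra.TensorProduct.comm ℂ (U 𝔤) (U 𝔤)).symm_apply_apply t

theorem swap12_tmul (x y z : U 𝔤) : swap12 𝔤 (x ⊗ₜ (y ⊗ₜ z)) = y ⊗ₜ (x ⊗ₜ z) := rfl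

theorem swap12_leg12 (t : U 𝔤 ⊗[ℂ] U 𝔤) : swap12 𝔤 (leg12 𝔤 t) = leg12 𝔤 (flip12 𝔤 t) := by
  induction t using TensorProduct.induction_on with
  | zero => simp
  | tmul x y => rfl
  | add x y hx hy => simp only [map_add, hx, hy]

theorem swap12_comulLeft (t : U 𝔤 ⊗[ℂ] U 𝔤) : swap12 𝔤 (comulLeft 𝔤 t) = comulLeft 𝔤 t := by
  induction t using TensorProduct.induction_on with
  | zero => simp
  | tmul x y =>
    rw [comulLeft_tmul, map_mul, swap12_leg12, swap12_tmul]
    congr 2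
    exact comul_cocomm x
  | add x y hx hy => simp only [map_add, hx, hy]

namespace Twist
variable (T : Twist 𝔤)

/-- The reassociation in `cocycle` is absorbed into `leg12` and `comulLeft`. What remains are images
of F under algebra homomorphisms into a single algebra, which can be inverted and multiplied freely.
-/
theorem cocycle' : mapPS (leg12 𝔤) T.F * mapPS (comulLeft 𝔤) T.F =
    mapPS (leg23 𝔤) T.F * mapPS (comulRight 𝔤) T.F := by
  have h := T.cocycle
  have e : (Algebra.TensorProduct.assoc ℂ ℂ ℂ (U 𝔤) (U 𝔤) (U 𝔤)).toLinearMap =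
    (Algebra.TensorProduct.assoc ℂ ℂ ℂ (U 𝔤) (U 𝔤) (U 𝔤)).toAlgHom.toLinearMap := rfl
  rw [e] at h
  simp only [psMap_algHom, map_mul] at h
  refine Eq.trans ?_ h
  congr 1

theorem map_mul_inv {A : Type*} [Ring A] [Algebra ℂ A] (φ : U 𝔤 ⊗[ℂ] U 𝔤 →ₐ[ℂ] A) :
    mapPS φ T.F * mapPS φ T.Finv = 1 := by
  simp only [← map_mul, T.mul_inv, map_one]

theorem map_inv_mul {A : Type*} [Ring A] [Algebra ℂ A] (φ : U 𝔤 ⊗[ℂ] U 𝔤 →ₐ[ℂ] A) :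
    mapPS φ T.Finv * mapPS φ T.F = 1 := by
  simp only [← map_mul, T.inv_mul, map_one]

/-- The cocycle condition solved for F₂₃⁻¹ F₁₂; it yields both βγ = 1 and the mixed relation. -/
theorem leg23_inv_mul_leg12 : mapPS (leg23 𝔤) T.Finv * mapPS (leg12 𝔤) T.F =
    mapPS (comulRight 𝔤) T.F * mapPS (comulLeft 𝔤) T.Finv := by
  calc _ = mapPS (leg23 𝔤) T.Finv * (mapPS (leg12 𝔤) T.F * mapPS (comulLeft 𝔤) T.F) *
        mapPS (comulLeft 𝔤) T.Finv := by
        rw [mul_assoc, mul_assoc, T.map_mul_inv, mul_one]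
    _ = _ := by rw [T.cocycle', ← mul_assoc, T.map_inv_mul, one_mul]

theorem leg12_inv_mul_leg23 : mapPS (leg12 𝔤) T.Finv * mapPS (leg23 𝔤) T.F =
    mapPS (comulLeft 𝔤) T.F * mapPS (comulRight 𝔤) T.Finv := by
  calc _ = mapPS (leg12 𝔤) T.Finv * (mapPS (leg23 𝔤) T.F * mapPS (comulRight 𝔤) T.F) *
        mapPS (comulRight 𝔤) T.Finv := by
        rw [mul_assoc, mul_assoc, T.map_mul_inv, mul_one]
    _ = _ := by rw [← T.cocycle', ← mul_assoc, T.map_inv_mul, one_mul]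

/-- Both sides invert the two sides of the cocycle condition. -/
theorem inv_cocycle : mapPS (comulRight 𝔤) T.Finv * mapPS (leg23 𝔤) T.Finv =
    mapPS (comulLeft 𝔤) T.Finv * mapPS (leg12 𝔤) T.Finv := by
  refine left_inv_eq_right_inv (a := mapPS (leg23 𝔤) T.F * mapPS (comulRight 𝔤) T.F) ?_ ?_
  · rw [mul_assoc, ← mul_assoc (mapPS (leg23 𝔤) T.Finv), T.map_inv_mul, one_mul, T.map_inv_mul]
  · rw [← T.cocycle', mul_assoc, ← mul_assoc (mapPS (comulLeft 𝔤) T.F), T.map_mul_inv, one_mul,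
      T.map_mul_inv]

theorem map_map {A B C : Type*} [Ring A] [Algebra ℂ A] [Ring B] [Algebra ℂ B] [Ring C]
    [Algebra ℂ C] (φ : A →ₐ[ℂ] B) (ψ : B →ₐ[ℂ] C) (χ : A →ₐ[ℂ] C) (h : ∀ x, ψ (φ x) = χ x)
    (f : PowerSeries A) : mapPS ψ (mapPS φ f) = mapPS χ f := by
  ext n; simp [h]

theorem universalR_eq : T.universalR = mapPS (flip12 𝔤) T.F * T.Finv := by
  rw [universalR]
  congr 1
  ext n
  rw [coeff_psMap]
  rfl

theorem flip_universalR : mapPS (flip12 𝔤) T.universalR = T.F * mapPS (flip12 𝔤) T.Finv := by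
  rw [universalR_eq, map_mul, map_map _ _ (AlgHom.id ℂ _) flip12_flip12]
  congr 1

/-- Exchange of the first two legs of `(1 ⊗ F) (id ⊗ Δ)(F)`. -/
theorem swap_cocycle : mapPS (swap12 𝔤) (mapPS (leg23 𝔤) T.F * mapPS (comulRight 𝔤) T.F) =
    mapPS (leg12 𝔤) T.universalR * (mapPS (leg23 𝔤) T.F * mapPS (comulRight 𝔤) T.F) := by
  rw [← T.cocycle', map_mul, map_map _ _ _ swap12_comulLeft,
    map_map _ _ ((leg12 𝔤).comp (flip12 𝔤)) swap12_leg12, universalR_eq, map_mul,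
    map_map _ _ ((leg12 𝔤).comp (flip12 𝔤)) fun _ => rfl, mul_assoc,
    ← mul_assoc (mapPS (leg12 𝔤) T.Finv), T.map_inv_mul, one_mul]

/-- By `inv_cocycle` the product is (Δ ⊗ id)(F⁻¹) F₁₂⁻¹. Its first factor is symmetric under the
exchange, and replacing F₁₂⁻¹ by F₂₁⁻¹ costs F₁₂ F₂₁⁻¹, the flipped R-matrix, on the right. -/
theorem swap_inv_cocycle : mapPS (swap12 𝔤) (mapPS (comulRight 𝔤) T.Finv * mapPS (leg23 𝔤) T.Finv) =
    mapPS (comulRight 𝔤) T.Finv * mapPS (leg23 𝔤) T.Finv * mapPS (leg12 𝔤) (mapPS (flip12 𝔤) T.universalR) := by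
  rw [inv_cocycle, flip_universalR, map_mul, map_mul, map_map _ _ _ swap12_comulLeft,
    map_map _ _ ((leg12 𝔤).comp (flip12 𝔤)) swap12_leg12,
    map_map (flip12 𝔤) _ ((leg12 𝔤).comp (flip12 𝔤)) fun _ => rfl, mul_assoc,
    ← mul_assoc (mapPS (leg12 𝔤) T.Finv), T.map_inv_mul, one_mul]

/-- The source of R in the mixed relation. The flipped R-matrix F₁₂ F₂₁⁻¹ splits the right side into
F₂₃⁻¹ F₁₂ and the exchange of F₁₂⁻¹ F₂₃. The cocycle condition rewrites both, and the symmetric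
factors (Δ ⊗ id)F⁻¹ and (Δ ⊗ id)F cancel in the middle. -/
theorem comulRight_mul_swap : mapPS (comulRight 𝔤) T.F * mapPS (swap12 𝔤) (mapPS (comulRight 𝔤) T.Finv) =
    mapPS (leg23 𝔤) T.Finv * mapPS (leg12 𝔤) (mapPS (flip12 𝔤) T.universalR) *
      mapPS (swap12 𝔤) (mapPS (leg23 𝔤) T.F) := by
  have h : mapPS (swap12 𝔤) (mapPS (leg12 𝔤) T.Finv * mapPS (leg23 𝔤) T.F) =
      mapPS (comulLeft 𝔤) T.F * mapPS (swap12 𝔤) (mapPS (comulRight 𝔤) T.Finv) := by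
    rw [leg12_inv_mul_leg23, map_mul, map_map _ _ _ swap12_comulLeft]
  rw [flip_universalR, map_mul, map_map (flip12 𝔤) _ ((leg12 𝔤).comp (flip12 𝔤)) fun _ => rfl,
    ← map_map (leg12 𝔤) (swap12 𝔤) ((leg12 𝔤).comp (flip12 𝔤)) swap12_leg12, ← mul_assoc,
    leg23_inv_mul_leg12, mul_assoc, ← map_mul, h, mul_assoc,
    ← mul_assoc (mapPS (comulLeft 𝔤) T.Finv), T.map_inv_mul, one_mul]

end Twist
end Legs

section Formal
variable {𝔤 : Type*} [LieRing 𝔤] [LieAlgebra ℂ 𝔤] {ι : Type*} [Fintype ι] [DecidableEq ι]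
  (s : Stat) (ρ : 𝔤 →ₗ⁅ℂ⁆ Matrix ι ι ℂ)

/-! ### Exchange of `σ(x)` with the generators -/

/-- Moving a^+_i past a^+_k a^j produces the statistics sign twice, so the commutator is the same
for bosons and fermions: the creators transform as a vector under ρ. -/
theorem jordan_mul_cre (M : Matrix ι ι ℂ) (i : ι) :
    jordan s M * cre s i = ∑ l, M l i • cre s l + cre s i * jordan s M := by
  have h (k j : ι) : cre s k * ann s j * cre s i =
      (if j = i then cre s k else 0) + cre s i * (cre s k * ann s j) := by
    rw [mul_assoc, ann_mul_cre, mul_add, mul_smul_comm, ← mul_assoc, ← mul_assoc,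
      ← smul_mul_assoc, ← cre_mul_cre]
    split_ifs <;> simp
  change (∑ k, ∑ j, M k j • (cre s k * ann s j)) * cre s i = _ +
    cre s i * (∑ k, ∑ j, M k j • (cre s k * ann s j))
  simp only [Finset.sum_mul, Finset.mul_sum, smul_mul_assoc, mul_smul_comm, h, smul_add,
    Finset.sum_add_distrib, smul_ite, smul_zero, Finset.sum_ite_eq', Finset.mem_univ, if_true]

theorem ann_mul_jordan (M : Matrix ι ι ℂ) (i : ι) :
    ann s i * jordan s M = ∑ l, M i l • ann s l + jordan s M * ann s i := by
  have h (k j : ι) : ann s i * (cre s k * ann s j) =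
      (if i = k then ann s j else 0) + cre s k * ann s j * ann s i := by
    rw [← mul_assoc, ann_mul_cre, add_mul, smul_mul_assoc, mul_assoc, mul_assoc, ← mul_smul_comm,
      ← ann_mul_ann]
    split_ifs <;> simp
  change ann s i * (∑ k, ∑ j, M k j • (cre s k * ann s j)) = _ +
    (∑ k, ∑ j, M k j • (cre s k * ann s j)) * ann s i
  simp only [Finset.sum_mul, Finset.mul_sum, smul_mul_assoc, mul_smul_comm, h, smul_add,
    Finset.sum_add_distrib, smul_ite, smul_zero]
  congr 1
  rw [Finset.sum_comm]
  simp

theorem sigma_inc (x : 𝔤) : sigma s ρ (inc 𝔤 x) = jordan s (ρ x) :=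
  UniversalEnvelopingAlgebra.lift_ι_apply ℂ _ x

theorem rhoU_inc (x : 𝔤) : rhoU ρ (inc 𝔤 x) = ρ x :=
  UniversalEnvelopingAlgebra.lift_ι_apply ℂ _ x

theorem rhoSigma_tmul (i j : ι) (x y : U 𝔤) :
    rhoSigma s ρ i j (x ⊗ₜ y) = rhoU ρ x i j • sigma s ρ y := rfl

theorem rhoSigma_mul (i j : ι) (x y : U 𝔤 ⊗[ℂ] U 𝔤) :
    rhoSigma s ρ i j (x * y) = ∑ k, rhoSigma s ρ i k x * rhoSigma s ρ k j y := by
  induction x using TensorProduct.induction_on with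
  | zero => simp
  | add x x' hx hx' => simp only [add_mul, map_add, hx, hx', Finset.sum_add_distrib]
  | tmul a b =>
    induction y using TensorProduct.induction_on with
    | zero => simp
    | add y y' hy hy' => simp only [mul_add, map_add, hy, hy', Finset.sum_add_distrib]
    | tmul c d =>
      simp only [Algebra.TensorProduct.tmul_mul_tmul, rhoSigma_tmul, map_mul, Matrix.mul_apply,
        smul_mul_smul_comm, Finset.sum_smul]

theorem rhoSigma_one (i j : ι) :
    rhoSigma s ρ i j (1 : U 𝔤 ⊗[ℂ] U 𝔤) = if i = j then 1 else 0 := by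
  rw [Algebra.TensorProduct.one_def, rhoSigma_tmul, map_one, map_one, Matrix.one_apply]
  split_ifs <;> simp

theorem rhoSigma_one_tmul (i j : ι) (y : U 𝔤) :
    rhoSigma s ρ i j (1 ⊗ₜ y) = if i = j then sigma s ρ y else 0 := by
  rw [rhoSigma_tmul, map_one, Matrix.one_apply]
  split_ifs <;> simp

theorem rhoSigma_comul_algebraMap (i j : ι) (c : ℂ) :
    rhoSigma s ρ i j (comul 𝔤 (algebraMap ℂ _ c)) = if i = j then algebraMap ℂ _ c else 0 := by
  rw [AlgHom.commutes, Algebra.algebraMap_eq_smul_one, map_smul]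
  have h := congrArg (c • ·) (rhoSigma_one s ρ i j)
  refine h.trans ?_
  simp only [smul_ite, smul_zero, Algebra.algebraMap_eq_smul_one]

theorem rhoSigma_comul_inc (i j : ι) (x : 𝔤) :
    rhoSigma s ρ i j (comul 𝔤 (inc 𝔤 x)) =
      ρ x i j • 1 + if i = j then jordan s (ρ x) else 0 := by
  rw [comul_inc, map_add, rhoSigma_tmul, rhoSigma_one_tmul, rhoU_inc, sigma_inc, map_one]

/-- On 𝔤 this is the commutator `jordan_mul_cre`. It extends to U 𝔤 because Δ is multiplicative and
`rhoSigma` multiplies like a matrix. Everything about the dressed creators rests on this exchange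
rule. -/
theorem sigma_mul_cre (x : U 𝔤) (i : ι) :
    sigma s ρ x * cre s i = ∑ l, cre s l * rhoSigma s ρ l i (comul 𝔤 x) := by
  induction x using U_induction generalizing i with
  | scalar c =>
    simp only [rhoSigma_comul_algebraMap, mul_ite, mul_zero, Finset.sum_ite_eq', Finset.mem_univ,
      if_true]
    rw [AlgHom.commutes, Algebra.commutes]
  | inc x =>
    simp only [sigma_inc, jordan_mul_cre, rhoSigma_comul_inc, mul_add, Finset.sum_add_distrib,
      mul_ite, mul_zero, Finset.sum_ite_eq', Finset.mem_univ, if_true, mul_smul_comm, mul_one]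
  | mul x y hx hy =>
    simp only [map_mul, rhoSigma_mul, mul_assoc, hy, Finset.mul_sum]
    rw [Finset.sum_comm]
    simp only [← mul_assoc, hx, Finset.sum_mul]
  | add x y hx hy => simp only [map_add, add_mul, mul_add, hx, hy, Finset.sum_add_distrib]

/-- The counterpart for annihilators, which transform from the other side, so that σ(x) is moved to
the left. -/
theorem ann_mul_sigma (x : U 𝔤) (i : ι) :
    ann s i * sigma s ρ x = ∑ l, rhoSigma s ρ i l (comul 𝔤 x) * ann s l := by
  induction x using U_induction generalizing i with
  | scalar c =>
    simp only [rhoSigma_comul_algebraMap, ite_mul, zero_mul, Finset.sum_ite_eq, Finset.mem_univ,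
      if_true]
    rw [AlgHom.commutes, Algebra.commutes]
  | inc x =>
    simp only [sigma_inc, ann_mul_jordan, rhoSigma_comul_inc, add_mul, Finset.sum_add_distrib,
      ite_mul, zero_mul, Finset.sum_ite_eq, Finset.mem_univ, if_true, smul_mul_assoc, one_mul]
  | mul x y hx hy =>
    simp only [map_mul, rhoSigma_mul, ← mul_assoc, hx, Finset.sum_mul]
    rw [Finset.sum_comm]
    refine Finset.sum_congr rfl fun k _ => ?_
    rw [mul_assoc, hy, Finset.mul_sum]
    simp only [mul_assoc]
  | add x y hx hy => simp only [map_add, add_mul, mul_add, hx, hy, Finset.sum_add_distrib]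

/-- `x ⊗ y ⊗ z ↦ ρ(x)^i_k ρ(y)^j_m σ(z)`. -/
noncomputable def rhoRhoSigma (i j k m : ι) : U 𝔤 ⊗[ℂ] (U 𝔤 ⊗[ℂ] U 𝔤) →ₗ[ℂ] CAlg s ι :=
  (TensorProduct.lid ℂ (CAlg s ι)).toLinearMap ∘ₗ
    TensorProduct.map (Matrix.entryLinearMap ℂ ℂ i k ∘ₗ (rhoU ρ).toLinearMap)
      (rhoSigma s ρ j m)

theorem rhoRhoSigma_tmul (i j k m : ι) (x : U 𝔤) (t : U 𝔤 ⊗[ℂ] U 𝔤) :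
    rhoRhoSigma s ρ i j k m (x ⊗ₜ t) = rhoU ρ x i k • rhoSigma s ρ j m t := rfl

theorem rhoRhoSigma_mul (i j k m : ι) (x y : U 𝔤 ⊗[ℂ] (U 𝔤 ⊗[ℂ] U 𝔤)) :
    rhoRhoSigma s ρ i j k m (x * y) =
      ∑ p : ι × ι, rhoRhoSigma s ρ i j p.1 p.2 x * rhoRhoSigma s ρ p.1 p.2 k m y := by
  induction x using TensorProduct.induction_on with
  | zero => simp
  | add x x' hx hx' => simp only [add_mul, map_add, hx, hx', Finset.sum_add_distrib]
  | tmul a b =>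
    induction y using TensorProduct.induction_on with
    | zero => simp
    | add y y' hy hy' => simp only [mul_add, map_add, hy, hy', Finset.sum_add_distrib]
    | tmul c d =>
      simp only [Algebra.TensorProduct.tmul_mul_tmul, rhoRhoSigma_tmul, map_mul, Matrix.mul_apply,
        smul_mul_smul_comm, rhoSigma_mul, Fintype.sum_prod_type]
      rw [Finset.sum_smul]
      simp only [Finset.smul_sum]

theorem rhoRhoSigma_swap (i j k m : ι) (x : U 𝔤 ⊗[ℂ] (U 𝔤 ⊗[ℂ] U 𝔤)) :
    rhoRhoSigma s ρ i j k m (swap12 𝔤 x) = rhoRhoSigma s ρ j i m k x := by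
  induction x using TensorProduct.induction_on with
  | zero => simp
  | add x x' hx hx' => simp only [map_add, hx, hx']
  | tmul a t =>
    induction t using TensorProduct.induction_on with
    | zero => simp
    | add y y' hy hy' => simp only [TensorProduct.tmul_add, map_add, hy, hy']
    | tmul b c => rw [swap12_tmul, rhoRhoSigma_tmul, rhoRhoSigma_tmul, rhoSigma_tmul,
        rhoSigma_tmul, smul_comm]

theorem rhoRhoSigma_leg23 (i j k m : ι) (t : U 𝔤 ⊗[ℂ] U 𝔤) :
    rhoRhoSigma s ρ i j k m (leg23 𝔤 t) = if i = k then rhoSigma s ρ j m t else 0 := by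
  rw [leg23_apply, rhoRhoSigma_tmul, map_one, Matrix.one_apply]
  split_ifs <;> simp

/-- `x ⊗ y ↦ ρ(x)^i_k ρ(y)^j_m`. -/
noncomputable def rhoRho (i j k m : ι) : U 𝔤 ⊗[ℂ] U 𝔤 →ₗ[ℂ] ℂ :=
  LinearMap.mul' ℂ ℂ ∘ₗ
    TensorProduct.map (Matrix.entryLinearMap ℂ ℂ i k ∘ₗ (rhoU ρ).toLinearMap)
      (Matrix.entryLinearMap ℂ ℂ j m ∘ₗ (rhoU ρ).toLinearMap)

theorem rhoRho_tmul (i j k m : ι) (x y : U 𝔤) :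
    rhoRho ρ i j k m (x ⊗ₜ y) = rhoU ρ x i k * rhoU ρ y j m := rfl

theorem rhoRho_flip (i j k m : ι) (t : U 𝔤 ⊗[ℂ] U 𝔤) :
    rhoRho ρ i j k m (flip12 𝔤 t) = rhoRho ρ j i m k t := by
  induction t using TensorProduct.induction_on with
  | zero => simp
  | add x x' hx hx' => simp only [map_add, hx, hx']
  | tmul a b => rw [flip12_tmul, rhoRho_tmul, rhoRho_tmul, mul_comm]

theorem rhoRho_mul (i j k m : ι) (x y : U 𝔤 ⊗[ℂ] U 𝔤) :
    rhoRho ρ i j k m (x * y) =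
      ∑ p : ι × ι, rhoRho ρ i j p.1 p.2 x * rhoRho ρ p.1 p.2 k m y := by
  induction x using TensorProduct.induction_on with
  | zero => simp
  | add x x' hx hx' => simp only [add_mul, map_add, hx, hx', Finset.sum_add_distrib]
  | tmul a b =>
    induction y using TensorProduct.induction_on with
    | zero => simp
    | add y y' hy hy' => simp only [mul_add, map_add, hy, hy', Finset.sum_add_distrib]
    | tmul c d =>
      simp only [Algebra.TensorProduct.tmul_mul_tmul, rhoRho_tmul, map_mul, Matrix.mul_apply,
        Fintype.sum_prod_type, Finset.sum_mul_sum]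
      exact Finset.sum_congr rfl fun _ _ => Finset.sum_congr rfl fun _ _ => by ring

theorem rhoRhoSigma_leg12 (i j k m : ι) (t : U 𝔤 ⊗[ℂ] U 𝔤) :
    rhoRhoSigma s ρ i j k m (leg12 𝔤 t) = algebraMap ℂ _ (rhoRho ρ i j k m t) := by
  induction t using TensorProduct.induction_on with
  | zero => simp
  | add x x' hx hx' => simp only [map_add, hx, hx']
  | tmul a b =>
    rw [leg12_tmul, rhoRhoSigma_tmul, rhoSigma_tmul, rhoRho_tmul, map_one, smul_smul,
      Algebra.algebraMap_eq_smul_one]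

/-- Only the σ-leg meets the creator, so only the second leg is split by the coproduct. -/
theorem rhoSigma_mul_cre (i j m : ι) (t : U 𝔤 ⊗[ℂ] U 𝔤) :
    rhoSigma s ρ i j t * cre s m =
      ∑ k, cre s k * rhoRhoSigma s ρ i k j m (comulRight 𝔤 t) := by
  induction t using TensorProduct.induction_on with
  | zero => simp
  | add x x' hx hx' => simp only [map_add, add_mul, mul_add, hx, hx', Finset.sum_add_distrib]
  | tmul x y =>
    simp only [comulRight_tmul, rhoRhoSigma_tmul, rhoSigma_tmul, smul_mul_assoc, sigma_mul_cre,
      Finset.smul_sum, mul_smul_comm]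

theorem ann_mul_rhoSigma (i j m : ι) (t : U 𝔤 ⊗[ℂ] U 𝔤) :
    ann s m * rhoSigma s ρ i j t =
      ∑ k, rhoRhoSigma s ρ i m j k (comulRight 𝔤 t) * ann s k := by
  induction t using TensorProduct.induction_on with
  | zero => simp
  | add x x' hx hx' => simp only [map_add, add_mul, mul_add, hx, hx', Finset.sum_add_distrib]
  | tmul x y =>
    simp only [comulRight_tmul, rhoRhoSigma_tmul, rhoSigma_tmul, smul_mul_assoc, ann_mul_sigma,
      Finset.smul_sum, mul_smul_comm]

end Formal

section Formal
set_option linter.unusedSectionVars false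
variable {𝔤 : Type*} [LieRing 𝔤] [LieAlgebra ℂ 𝔤] {ι : Type*} [Fintype ι] [DecidableEq ι]
  (s : Stat) (ρ : 𝔤 →ₗ⁅ℂ⁆ Matrix ι ι ℂ)

/-! ### Matrix elements of formal power series -/

/-- The entries of `(ρ ⊗ σ)(f)`. -/
noncomputable def ent (f : PowerSeries (U 𝔤 ⊗[ℂ] U 𝔤)) (i j : ι) : PowerSeries (CAlg s ι) :=
  psMap (rhoSigma s ρ i j) f

/-- The entries of `(ρ ⊗ ρ ⊗ σ)(f)`. -/
noncomputable def ent₂ (f : PowerSeries (U 𝔤 ⊗[ℂ] (U 𝔤 ⊗[ℂ] U 𝔤))) (i j k m : ι) :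
    PowerSeries (CAlg s ι) :=
  psMap (rhoRhoSigma s ρ i j k m) f

variable {s ρ}

theorem ent_mul (f g : PowerSeries (U 𝔤 ⊗[ℂ] U 𝔤)) (i j : ι) :
    ent s ρ (f * g) i j = ∑ k, ent s ρ f i k * ent s ρ g k j :=
  psMap_mul_sum _ _ _ (rhoSigma_mul s ρ i j) f g

theorem ent_one (i j : ι) : ent s ρ (1 : PowerSeries (U 𝔤 ⊗[ℂ] U 𝔤)) i j = if i = j then 1 else 0 := by
  ext n
  rw [ent, coeff_psMap, PowerSeries.coeff_one]
  by_cases hn : n = 0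
  · rw [if_pos hn, rhoSigma_one]
    split_ifs <;> simp [hn]
  · rw [if_neg hn, map_zero]
    split_ifs <;> simp [PowerSeries.coeff_one, hn]

theorem ent₂_mul (f g : PowerSeries (U 𝔤 ⊗[ℂ] (U 𝔤 ⊗[ℂ] U 𝔤))) (i j k m : ι) :
    ent₂ s ρ (f * g) i j k m = ∑ p, ∑ r, ent₂ s ρ f i j p r * ent₂ s ρ g p r k m :=
  (psMap_mul_sum _ _ _ (rhoRhoSigma_mul s ρ i j k m) f g).trans
    (Fintype.sum_prod_type _)

theorem ent₂_swap (f : PowerSeries (U 𝔤 ⊗[ℂ] (U 𝔤 ⊗[ℂ] U 𝔤))) (i j k m : ι) :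
    ent₂ s ρ (mapPS (swap12 𝔤) f) i j k m = ent₂ s ρ f j i m k := by
  ext n
  rw [ent₂, ent₂, coeff_psMap, coeff_psMap, PowerSeries.coeff_map]
  exact rhoRhoSigma_swap s ρ i j k m _

theorem ent₂_leg23 (f : PowerSeries (U 𝔤 ⊗[ℂ] U 𝔤)) (i j k m : ι) :
    ent₂ s ρ (mapPS (leg23 𝔤) f) i j k m = if i = k then ent s ρ f j m else 0 := by
  ext n
  rw [ent₂, coeff_psMap, PowerSeries.coeff_map]
  refine (rhoRhoSigma_leg23 s ρ i j k m _).trans ?_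
  split_ifs
  · rw [ent, coeff_psMap]
  · rw [map_zero]

/-- The embedding of scalar series. -/
noncomputable abbrev scal (f : PowerSeries ℂ) : PowerSeries (CAlg s ι) :=
  PowerSeries.map (algebraMap ℂ (CAlg s ι)) f

theorem scal_commute (f : PowerSeries ℂ) (x : PowerSeries (CAlg s ι)) :
    scal f * x = x * scal f := by
  ext n
  rw [PowerSeries.coeff_mul, PowerSeries.coeff_mul]
  refine Finset.sum_equiv (Equiv.prodComm ℕ ℕ) (fun p => by simp [add_comm]) fun p _ => ?_
  simp only [PowerSeries.coeff_map, Equiv.prodComm_apply, Prod.fst_swap, Prod.snd_swap]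
  exact Algebra.commutes _ _

theorem scal_mul_left_comm (f : PowerSeries ℂ) (x y : PowerSeries (CAlg s ι)) :
    x * (scal f * y) = scal f * (x * y) := by
  rw [← mul_assoc, ← scal_commute, mul_assoc]

theorem ent₂_leg12 (f : PowerSeries (U 𝔤 ⊗[ℂ] U 𝔤)) (i j k m : ι) :
    ent₂ s ρ (mapPS (leg12 𝔤) f) i j k m = scal (psMap (rhoRho ρ i j k m) f) := by
  ext n
  rw [ent₂, coeff_psMap, PowerSeries.coeff_map, PowerSeries.coeff_map, coeff_psMap]
  exact rhoRhoSigma_leg12 s ρ i j k m _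

theorem RPS_eq (T : Twist 𝔤) (i j k m : ι) :
    RPS ρ T i j k m = psMap (rhoRho ρ i j k m) T.universalR := rfl

theorem ent₂_leg12_universalR (T : Twist 𝔤) (i j k m : ι) :
    ent₂ s ρ (mapPS (leg12 𝔤) T.universalR) i j k m = scal (RPS ρ T i j k m) :=
  ent₂_leg12 _ i j k m

theorem ent₂_leg12_flip_universalR (T : Twist 𝔤) (i j k m : ι) :
    ent₂ s ρ (mapPS (leg12 𝔤) (mapPS (flip12 𝔤) T.universalR)) i j k m =
      scal (RPS ρ T j i m k) := by
  rw [ent₂_leg12, RPS_eq]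
  congr 1
  ext n
  rw [coeff_psMap, coeff_psMap, PowerSeries.coeff_map]
  exact rhoRho_flip ρ i j k m _

theorem ent_mul_cre (f : PowerSeries (U 𝔤 ⊗[ℂ] U 𝔤)) (i j m : ι) :
    ent s ρ f i j * PowerSeries.C (cre s m) =
      ∑ k, PowerSeries.C (cre s k) * ent₂ s ρ (mapPS (comulRight 𝔤) f) i k j m := by
  ext n
  simp only [map_sum, PowerSeries.coeff_mul_C, PowerSeries.coeff_C_mul]
  rw [ent, coeff_psMap, rhoSigma_mul_cre]
  refine Finset.sum_congr rfl fun k _ => ?_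
  rw [ent₂, coeff_psMap, PowerSeries.coeff_map]
  rfl

theorem ann_mul_ent (f : PowerSeries (U 𝔤 ⊗[ℂ] U 𝔤)) (i j m : ι) :
    PowerSeries.C (ann s m) * ent s ρ f i j =
      ∑ k, ent₂ s ρ (mapPS (comulRight 𝔤) f) i m j k * PowerSeries.C (ann s k) := by
  ext n
  simp only [map_sum, PowerSeries.coeff_mul_C, PowerSeries.coeff_C_mul]
  rw [ent, coeff_psMap, ann_mul_rhoSigma]
  refine Finset.sum_congr rfl fun k _ => ?_
  rw [ent₂, coeff_psMap, PowerSeries.coeff_map]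
  rfl

/-! ### The deformed generators -/

namespace Twist
variable (T : Twist 𝔤)

/-- `β = F⁽¹⁾ S(F⁽²⁾)`, the inverse of `γ`. -/
noncomputable def beta : PowerSeries (U 𝔤) := psMap (mulAntipode 𝔤) T.F

theorem gamma_eq : T.gamma = psMap (antipodeMul 𝔤) T.Finv := rfl

variable (𝔤) in
/-- `(ε ⊗ id)`. -/
noncomputable def counitLeft : U 𝔤 ⊗[ℂ] U 𝔤 →ₐ[ℂ] U 𝔤 :=
  (Algebra.TensorProduct.lid ℂ (U 𝔤)).toAlgHom.comp
    (Algebra.TensorProduct.map (counit 𝔤) (AlgHom.id ℂ (U 𝔤)))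

variable (𝔤) in
/-- `(id ⊗ ε)`. -/
noncomputable def counitRight : U 𝔤 ⊗[ℂ] U 𝔤 →ₐ[ℂ] U 𝔤 :=
  (Algebra.TensorProduct.rid ℂ ℂ (U 𝔤)).toAlgHom.comp
    (Algebra.TensorProduct.map (AlgHom.id ℂ (U 𝔤)) (counit 𝔤))

theorem counitLeft_tmul (x y : U 𝔤) : counitLeft 𝔤 (x ⊗ₜ y) = counit 𝔤 x • y := rfl

theorem counitRight_tmul (x y : U 𝔤) : counitRight 𝔤 (x ⊗ₜ y) = counit 𝔤 y • x := rfl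

theorem counitLeft_F : mapPS (counitLeft 𝔤) T.F = 1 := by
  rw [← T.counit_left, ← psMap_algHom]
  rfl

theorem counitRight_F : mapPS (counitRight 𝔤) T.F = 1 := by
  rw [← T.counit_right, ← psMap_algHom]
  rfl

theorem counitLeft_Finv : mapPS (counitLeft 𝔤) T.Finv = 1 := by
  rw [← one_mul (mapPS (counitLeft 𝔤) T.Finv), ← T.counitLeft_F, ← map_mul, T.mul_inv, map_one,
    T.counitLeft_F]

variable (𝔤) in
/-- `x ⊗ y ⊗ z ↦ x S(y) z`. -/
noncomputable def mulAntipodeMul : U 𝔤 ⊗[ℂ] (U 𝔤 ⊗[ℂ] U 𝔤) →ₗ[ℂ] U 𝔤 :=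
  LinearMap.mul' ℂ (U 𝔤) ∘ₗ TensorProduct.map LinearMap.id (antipodeMul 𝔤)

theorem mulAntipodeMul_tmul (x : U 𝔤) (t : U 𝔤 ⊗[ℂ] U 𝔤) :
    mulAntipodeMul 𝔤 (x ⊗ₜ t) = x * antipodeMul 𝔤 t := rfl

theorem mulAntipodeMul_leg23_leg12 (t u : U 𝔤 ⊗[ℂ] U 𝔤) :
    mulAntipodeMul 𝔤 (leg23 𝔤 t * leg12 𝔤 u) = mulAntipode 𝔤 u * antipodeMul 𝔤 t := by
  induction t using TensorProduct.induction_on with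
  | zero => simp
  | add t t' h h' => simp only [map_add, add_mul, mul_add, h, h']
  | tmul a b =>
    induction u using TensorProduct.induction_on with
    | zero => simp
    | add t t' h h' => simp only [map_add, add_mul, mul_add, h, h']
    | tmul c d =>
      rw [leg23_apply, leg12_tmul, Algebra.TensorProduct.tmul_mul_tmul,
        Algebra.TensorProduct.tmul_mul_tmul, mulAntipodeMul_tmul, antipodeMul_tmul,
        mulAntipode_tmul, antipodeMul_tmul, antipode_mul, one_mul, mul_one, mul_assoc, mul_assoc]

/-- The antipode axiom acts twice: Δ(b) is absorbed from the left by S(y) z, then Δ(c) by x S(y),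
leaving only counits. -/
theorem mulAntipodeMul_comul (t u : U 𝔤 ⊗[ℂ] U 𝔤) :
    mulAntipodeMul 𝔤 (comulRight 𝔤 t * comulLeft 𝔤 u) = counitRight 𝔤 t * counitLeft 𝔤 u := by
  induction t using TensorProduct.induction_on with
  | zero => simp
  | add t t' h h' => simp only [map_add, add_mul, h, h']
  | tmul a b =>
    induction u using TensorProduct.induction_on with
    | zero => simp
    | add t t' h h' => simp only [map_add, mul_add, h, h']
    | tmul c d =>
      -- With Δ(c) replaced by an arbitrary tensor `w`, the first absorption can be checked on pure
      -- tensors.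
      have key (w : U 𝔤 ⊗[ℂ] U 𝔤) :
          mulAntipodeMul 𝔤 (comulRight 𝔤 (a ⊗ₜ b) * (leg12 𝔤 w * (1 ⊗ₜ (1 ⊗ₜ d)))) =
            counit 𝔤 b • (a * mulAntipode 𝔤 w * d) := by
        induction w using TensorProduct.induction_on with
        | zero => simp
        | add t t' h h' => simp only [map_add, add_mul, mul_add, h, h', smul_add]
        | tmul e f =>
          rw [comulRight_tmul, leg12_tmul, Algebra.TensorProduct.tmul_mul_tmul,
            Algebra.TensorProduct.tmul_mul_tmul, Algebra.TensorProduct.tmul_mul_tmul,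
            mulAntipodeMul_tmul, antipodeMul_comul_mul, antipodeMul_tmul, mul_smul_comm,
            mulAntipode_tmul, mul_one, mul_one, one_mul, mul_assoc, mul_assoc, mul_assoc]
      rw [comulLeft_tmul, key, mulAntipode_comul, counitRight_tmul, counitLeft_tmul,
        ← Algebra.commutes, ← Algebra.smul_def, smul_mul_assoc, smul_mul_assoc, mul_smul_comm]

/-- The map x ⊗ y ⊗ z ↦ x S(y) z is applied to F₂₃⁻¹ F₁₂ = (id ⊗ Δ)F (Δ ⊗ id)F⁻¹. The left side
becomes βγ, the right side a product of counits of F and F⁻¹, which are 1. -/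
theorem beta_mul_gamma : T.beta * T.gamma = 1 := by
  have h1 := psMap_mul_swap (mulAntipodeMul 𝔤) (leg23 𝔤).toLinearMap (leg12 𝔤).toLinearMap
    (antipodeMul 𝔤) (mulAntipode 𝔤) mulAntipodeMul_leg23_leg12 T.Finv T.F
  have h2 := psMap_mul (mulAntipodeMul 𝔤) (comulRight 𝔤).toLinearMap (comulLeft 𝔤).toLinearMap
    (counitRight 𝔤).toLinearMap (counitLeft 𝔤).toLinearMap mulAntipodeMul_comul T.F T.Finv
  simp only [psMap_algHom] at h1 h2
  rw [beta, gamma_eq, ← h1, T.leg23_inv_mul_leg12, h2, T.counitRight_F, T.counitLeft_Finv, one_mul]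

end Twist

end Formal

section Formal
set_option linter.unusedSectionVars false
variable {𝔤 : Type*} [LieRing 𝔤] [LieAlgebra ℂ 𝔤] {ι : Type*} [Fintype ι] [DecidableEq ι]
  {s : Stat} {ρ : 𝔤 →ₗ⁅ℂ⁆ Matrix ι ι ℂ}

namespace Twist
variable (T : Twist 𝔤)

variable (𝔤) in
/-- `x ⊗ y ⊗ z ↦ x ⊗ y S(z)`. -/
noncomputable def contract : U 𝔤 ⊗[ℂ] (U 𝔤 ⊗[ℂ] U 𝔤) →ₗ[ℂ] U 𝔤 ⊗[ℂ] U 𝔤 :=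
  TensorProduct.map LinearMap.id (mulAntipode 𝔤)

theorem contract_tmul (x : U 𝔤) (t : U 𝔤 ⊗[ℂ] U 𝔤) :
    contract 𝔤 (x ⊗ₜ t) = x ⊗ₜ mulAntipode 𝔤 t := rfl

theorem contract_leg12_mul (t : U 𝔤 ⊗[ℂ] U 𝔤) (X : U 𝔤 ⊗[ℂ] (U 𝔤 ⊗[ℂ] U 𝔤)) :
    contract 𝔤 (leg12 𝔤 t * X) = t * contract 𝔤 X := by
  induction t using TensorProduct.induction_on with
  | zero => simp
  | add t t' h h' => simp only [map_add, add_mul, h, h']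
  | tmul a b =>
    induction X using TensorProduct.induction_on with
    | zero => simp
    | add t t' h h' => simp only [map_add, mul_add, h, h']
    | tmul c t =>
      induction t using TensorProduct.induction_on with
      | zero => simp
      | add t t' h h' => simp only [map_add, mul_add, TensorProduct.tmul_add, h, h']
      | tmul d e =>
        rw [leg12_tmul, Algebra.TensorProduct.tmul_mul_tmul, Algebra.TensorProduct.tmul_mul_tmul,
          contract_tmul, contract_tmul, Algebra.TensorProduct.tmul_mul_tmul, mulAntipode_tmul,
          mulAntipode_tmul, one_mul, mul_assoc]

theorem contract_mul_comulRight (X : U 𝔤 ⊗[ℂ] (U 𝔤 ⊗[ℂ] U 𝔤)) (t : U 𝔤 ⊗[ℂ] U 𝔤) :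
    contract 𝔤 (X * comulRight 𝔤 t) = contract 𝔤 X * (counitRight 𝔤 t ⊗ₜ 1) := by
  induction t using TensorProduct.induction_on with
  | zero => simp
  | add t t' h h' => simp only [map_add, mul_add, TensorProduct.add_tmul, h, h']
  | tmul a b =>
    induction X using TensorProduct.induction_on with
    | zero => simp
    | add t t' h h' => simp only [map_add, add_mul, h, h']
    | tmul c t =>
      rw [comulRight_tmul, Algebra.TensorProduct.tmul_mul_tmul, contract_tmul, contract_tmul,
        mulAntipode_mul_comul, counitRight_tmul, Algebra.TensorProduct.tmul_mul_tmul, mul_one,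
        mul_smul_comm, TensorProduct.smul_tmul]

/-- `F⁽¹⁾₍₁₎ ⊗ F⁽¹⁾₍₂₎ S(F⁽²⁾) = F⁻¹ (1 ⊗ β)`. -/
theorem contract_comulLeft : psMap (contract 𝔤) (mapPS (comulLeft 𝔤) T.F) =
    T.Finv * mapPS (Algebra.TensorProduct.includeRight : U 𝔤 →ₐ[ℂ] U 𝔤 ⊗[ℂ] U 𝔤) T.beta := by
  -- In this factorization F₁₂⁻¹ comes out of `contract` on the left, (id ⊗ Δ)F is swallowed by the
  -- counit on the right, and F₂₃ contracts to 1 ⊗ β.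
  have h0 : mapPS (comulLeft 𝔤) T.F =
      mapPS (leg12 𝔤) T.Finv * (mapPS (leg23 𝔤) T.F * mapPS (comulRight 𝔤) T.F) := by
    rw [← T.cocycle', ← mul_assoc, T.map_inv_mul, one_mul]
  have h1 := psMap_mul (contract 𝔤) (leg12 𝔤).toLinearMap LinearMap.id LinearMap.id (contract 𝔤)
    contract_leg12_mul T.Finv (mapPS (leg23 𝔤) T.F * mapPS (comulRight 𝔤) T.F)
  have h2 := psMap_mul (contract 𝔤) LinearMap.id (comulRight 𝔤).toLinearMap (contract 𝔤)
    ((Algebra.TensorProduct.includeLeft : U 𝔤 →ₐ[ℂ] U 𝔤 ⊗[ℂ] U 𝔤).comp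
      (counitRight 𝔤)).toLinearMap contract_mul_comulRight (mapPS (leg23 𝔤) T.F) T.F
  have h3 : mapPS ((Algebra.TensorProduct.includeLeft : U 𝔤 →ₐ[ℂ] U 𝔤 ⊗[ℂ] U 𝔤).comp
      (counitRight 𝔤)) T.F = 1 := by
    rw [← map_map (counitRight 𝔤) Algebra.TensorProduct.includeLeft _ fun _ => rfl,
      T.counitRight_F, map_one]
  simp only [psMap_algHom, psMap_id] at h1 h2
  rw [h0, h1, h2, h3, mul_one]
  congr 1

end Twist

theorem sandwich_tmul (c : CAlg s ι) (x y : U 𝔤) :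
    sandwich s ρ c (x ⊗ₜ y) = sigma s ρ x * c * sigma s ρ (antipode 𝔤 y) := rfl

theorem sandwich'_tmul (c : CAlg s ι) (x y : U 𝔤) :
    sandwich' s ρ c (x ⊗ₜ y) = sigma s ρ (antipode 𝔤 y) * c * sigma s ρ x := rfl

theorem rhoSigma_mul_one_tmul (i j : ι) (t : U 𝔤 ⊗[ℂ] U 𝔤) (w : U 𝔤) :
    rhoSigma s ρ i j (t * (1 ⊗ₜ w)) = rhoSigma s ρ i j t * sigma s ρ w := by
  simp [rhoSigma_mul, rhoSigma_one_tmul]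

/-- Moving σ(x) to the right of a^+_i by `sigma_mul_cre` leaves the entries of x₍₁₎ ⊗ x₍₂₎ S(y),
which is the contraction of (Δ ⊗ id)(x ⊗ y). -/
theorem sandwich_cre (i : ι) (t : U 𝔤 ⊗[ℂ] U 𝔤) : sandwich s ρ (cre s i) t =
    ∑ l, cre s l * rhoSigma s ρ l i (Twist.contract 𝔤 (comulLeft 𝔤 t)) := by
  induction t using TensorProduct.induction_on with
  | zero => simp
  | add t t' h h' => simp only [map_add, mul_add, Finset.sum_add_distrib, h, h']
  | tmul x y =>
    have key (w : U 𝔤 ⊗[ℂ] U 𝔤) : Twist.contract 𝔤 (leg12 𝔤 w * (1 ⊗ₜ (1 ⊗ₜ y))) =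
        w * (1 ⊗ₜ antipode 𝔤 y) := by
      rw [Twist.contract_leg12_mul, Twist.contract_tmul, mulAntipode_tmul, one_mul]
    rw [sandwich_tmul, sigma_mul_cre, comulLeft_tmul, key, Finset.sum_mul]
    simp only [rhoSigma_mul_one_tmul, mul_assoc]

/-- `A^+_i = a^+_l (ρ ⊗ σ)(F⁻¹)^l_i`. -/
theorem crePS_eq (T : Twist 𝔤) (i : ι) :
    crePS s ρ T i = ∑ l, PowerSeries.C (cre s l) * ent s ρ T.Finv l i := by
  have h1 : psMap (sandwich s ρ (cre s i)) T.F = ∑ l, PowerSeries.C (cre s l) *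
      ent s ρ (psMap (Twist.contract 𝔤) (mapPS (comulLeft 𝔤) T.F)) l i := by
    ext n
    simp only [map_sum, PowerSeries.coeff_C_mul, coeff_psMap, ent, sandwich_cre,
      PowerSeries.coeff_map]
    rfl
  have h2 (f : PowerSeries (U 𝔤 ⊗[ℂ] U 𝔤)) (g : PowerSeries (U 𝔤)) (l : ι) :
      ent s ρ (f * mapPS (Algebra.TensorProduct.includeRight : U 𝔤 →ₐ[ℂ] U 𝔤 ⊗[ℂ] U 𝔤) g) l i =
        ent s ρ f l i * mapPS (sigma s ρ) g := by
    have h3 := psMap_mul (rhoSigma s ρ l i) LinearMap.id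
      (Algebra.TensorProduct.includeRight : U 𝔤 →ₐ[ℂ] U 𝔤 ⊗[ℂ] U 𝔤).toLinearMap
      (rhoSigma s ρ l i) (sigma s ρ).toLinearMap (fun x y => rhoSigma_mul_one_tmul l i x y) f g
    simp only [psMap_algHom] at h3
    rw [ent, ent, ← h3]
    congr 2
    ext n; simp [coeff_psMap]
  -- The contraction leaves the factor σ(β), which σ(γ) cancels.
  rw [crePS, h1, T.contract_comulLeft, psMap_algHom]
  simp only [h2, Finset.sum_mul, mul_assoc, ← map_mul, T.beta_mul_gamma, map_one, mul_one]

section Star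
variable [StarAddMonoid 𝔤] [StarLieAlgebra 𝔤]

theorem star_jordan (M : Matrix ι ι ℂ) : star (jordan s M) = jordan s M.conjTranspose := by
  change star (∑ i, ∑ j, M i j • (cre s i * ann s j)) =
    ∑ i, ∑ j, M.conjTranspose i j • (cre s i * ann s j)
  simp only [star_sum, star_smul_CAlg, star_mul, star_ann, star_cre, Matrix.conjTranspose_apply]
  rw [Finset.sum_comm]
  rfl

theorem star_sigma (hρ : ∀ x, ρ (star x) = (ρ x).conjTranspose) (x : U 𝔤) :
    star (sigma s ρ x) = sigma s ρ (star x) := by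
  induction x using U_induction with
  | scalar c => rw [AlgHom.commutes, star_algebraMap, star_algebraMap_U, AlgHom.commutes]
  | inc x => rw [sigma_inc, star_jordan, star_inc, sigma_inc, hρ]
  | mul x y hx hy => rw [map_mul, star_mul, star_mul, map_mul, hx, hy]
  | add x y hx hy => rw [map_add, star_add, star_add, map_add, hx, hy]

theorem rhoU_star (hρ : ∀ x, ρ (star x) = (ρ x).conjTranspose) (x : U 𝔤) :
    rhoU ρ (star x) = (rhoU ρ x).conjTranspose := by
  induction x using U_induction with
  | scalar c =>
    rw [AlgHom.commutes, star_algebraMap_U, AlgHom.commutes, Matrix.algebraMap_eq_diagonal,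
      Matrix.algebraMap_eq_diagonal, Matrix.diagonal_conjTranspose]
    rfl
  | inc x => rw [star_inc, rhoU_inc, rhoU_inc, hρ]
  | mul x y hx hy => rw [star_mul, map_mul, map_mul, Matrix.conjTranspose_mul, hx, hy]
  | add x y hx hy => rw [star_add, map_add, map_add, Matrix.conjTranspose_add, hx, hy]

theorem star_rhoSigma (hρ : ∀ x, ρ (star x) = (ρ x).conjTranspose) (i j : ι)
    (t : U 𝔤 ⊗[ℂ] U 𝔤) : star (rhoSigma s ρ i j t) = rhoSigma s ρ j i (star t) := by
  induction t using TensorProduct.induction_on with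
  | zero => simp
  | add t t' h h' => simp only [map_add, star_add, h, h']
  | tmul x y =>
    rw [rhoSigma_tmul, star_smul_CAlg, star_sigma hρ, TensorProduct.star_tmul, rhoSigma_tmul,
      rhoU_star hρ, Matrix.conjTranspose_apply]
    rfl

theorem star_rhoRho (hρ : ∀ x, ρ (star x) = (ρ x).conjTranspose) (i j k m : ι)
    (t : U 𝔤 ⊗[ℂ] U 𝔤) : star (rhoRho ρ i j k m t) = rhoRho ρ k m i j (star t) := by
  induction t using TensorProduct.induction_on with
  | zero => simp
  | add t t' h h' => simp only [map_add, star_add, h, h']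
  | tmul x y =>
    rw [rhoRho_tmul, TensorProduct.star_tmul, rhoRho_tmul,
      rhoU_star hρ, rhoU_star hρ, Matrix.conjTranspose_apply, Matrix.conjTranspose_apply,
      star_mul, mul_comm]

theorem star_sandwich' (hρ : ∀ x, ρ (star x) = (ρ x).conjTranspose) (i : ι)
    (t : U 𝔤 ⊗[ℂ] U 𝔤) : star (sandwich' s ρ (ann s i) t) = sandwich s ρ (cre s i) (star t) := by
  induction t using TensorProduct.induction_on with
  | zero => simp
  | add t t' h h' => simp only [map_add, star_add, h, h']
  | tmul x y =>
    rw [sandwich'_tmul, TensorProduct.star_tmul, sandwich_tmul, star_mul, star_mul, star_ann,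
      star_sigma hρ, star_sigma hρ, star_antipode, mul_assoc]

namespace Twist

theorem IsUnitary.star_Finv {T : Twist 𝔤} (hT : T.IsUnitary) : psStar T.Finv = T.F := by
  rw [← hT, psStar_psStar]

theorem IsUnitary.star_gamma' {T : Twist 𝔤} (hT : T.IsUnitary) : psStar T.gamma' = T.gamma := by
  rw [gamma', psStar_psMap _ (antipodeMul 𝔤) _ T.F, hT, gamma_eq]
  intro t
  induction t using TensorProduct.induction_on with
  | zero => simp
  | add t t' h h' => simp only [map_add, star_add, h, h']
  | tmul x y =>
    change star (y * antipode 𝔤 x) = antipode 𝔤 (star x) * star y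
    rw [star_mul, star_antipode]

end Twist

/-- Unitarity exchanges F with F⁻¹ and γ' with γ, and σ intertwines the stars, so the defining
formulas correspond factor by factor. -/
theorem psStar_annPS (hρ : ∀ x, ρ (star x) = (ρ x).conjTranspose) {T : Twist 𝔤}
    (hT : T.IsUnitary) (i : ι) : psStar (annPS s ρ T i) = crePS s ρ T i := by
  rw [annPS, psStar_mul, crePS, psStar_psMap _ _ (star_sandwich' hρ i), hT.star_Finv,
    psStar_psMap _ (sigma s ρ).toLinearMap (fun x => star_sigma hρ x), hT.star_gamma']

/-- `A^i = (ρ ⊗ σ)(F)^i_l a^l`. -/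
theorem annPS_eq (hρ : ∀ x, ρ (star x) = (ρ x).conjTranspose) {T : Twist 𝔤}
    (hT : T.IsUnitary) (i : ι) :
    annPS s ρ T i = ∑ l, ent s ρ T.F i l * PowerSeries.C (ann s l) := by
  -- The formula is the star of the one for creators, which avoids a second Hopf algebra computation
  -- with γ'.
  rw [← psStar_psStar (annPS s ρ T i), psStar_annPS hρ hT, crePS_eq, psStar_sum]
  refine Finset.sum_congr rfl fun l _ => ?_
  rw [psStar_mul, psStar_C, star_cre, ent, psStar_psMap _ _ (star_rhoSigma hρ l i), hT.star_Finv,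
    ent]

end Star

theorem C_ann_mul_C_ann (k m : ι) : PowerSeries.C (ann s k) * PowerSeries.C (ann s m) =
    PowerSeries.C (algebraMap ℂ (CAlg s ι) s.sgn) *
      (PowerSeries.C (ann s m) * PowerSeries.C (ann s k)) := by
  rw [← map_mul, ← map_mul, ← map_mul, ann_mul_ann, Algebra.smul_def]

theorem C_cre_mul_C_cre (k m : ι) : PowerSeries.C (cre s k) * PowerSeries.C (cre s m) =
    PowerSeries.C (algebraMap ℂ (CAlg s ι) s.sgn) *
      (PowerSeries.C (cre s m) * PowerSeries.C (cre s k)) := by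
  rw [← map_mul, ← map_mul, ← map_mul, cre_mul_cre, Algebra.smul_def]

theorem C_ann_mul_C_cre (k m : ι) : PowerSeries.C (ann s k) * PowerSeries.C (cre s m) =
    (if k = m then 1 else 0) + PowerSeries.C (algebraMap ℂ (CAlg s ι) s.sgn) *
      (PowerSeries.C (cre s m) * PowerSeries.C (ann s k)) := by
  rw [← map_mul, ← map_mul, ← map_mul, ann_mul_cre, Algebra.smul_def, map_add]
  split_ifs <;> simp

end Formal

section Formal
set_option linter.unusedSectionVars false
variable {𝔤 : Type*} [LieRing 𝔤] [LieAlgebra ℂ 𝔤] [StarAddMonoid 𝔤] [StarLieAlgebra 𝔤]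
  {ι : Type*} [Fintype ι] [DecidableEq ι] {s : Stat} {ρ : 𝔤 →ₗ⁅ℂ⁆ Matrix ι ι ℂ}

theorem sum_sum_sum_sum_reverse {M : Type*} [AddCommMonoid M] (f : ι → ι → ι → ι → M) :
    ∑ m, ∑ k, ∑ v, ∑ u, f m k v u = ∑ u, ∑ v, ∑ k, ∑ m, f m k v u := by
  have h3 (f : ι → ι → ι → M) : ∑ m, ∑ k, ∑ v, f m k v = ∑ v, ∑ k, ∑ m, f m k v := by
    rw [Finset.sum_congr rfl fun _ _ => Finset.sum_comm, Finset.sum_comm]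
    exact Finset.sum_congr rfl fun _ _ => Finset.sum_comm
  rw [Finset.sum_congr rfl fun m _ => h3 (f m), Finset.sum_comm]
  refine Finset.sum_congr rfl fun u _ => ?_
  rw [h3 fun m v k => f m k v u]
  exact Finset.sum_comm

/-! ### The quantum commutation relations in `𝒜[[h]]` -/

/-- The inner annihilator is moved past the second dressing matrix. The first ρ-leg carries the
index j of the second factor, whence the order j, i of the indices. -/
theorem annPS_mul_annPS (hρ : ∀ x, ρ (star x) = (ρ x).conjTranspose) {T : Twist 𝔤}
    (hT : T.IsUnitary) (i j : ι) : annPS s ρ T i * annPS s ρ T j =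
      ∑ m, ∑ k, ent₂ s ρ (mapPS (leg23 𝔤) T.F * mapPS (comulRight 𝔤) T.F) j i m k *
        (PowerSeries.C (ann s k) * PowerSeries.C (ann s m)) := by
  simp only [annPS_eq hρ hT, ent₂_mul, ent₂_leg23, ite_mul, zero_mul, Finset.sum_ite_irrel,
    Finset.sum_const_zero, Finset.sum_ite_eq, Finset.mem_univ, if_true]
  rw [Finset.sum_mul_sum, Finset.sum_comm]
  refine Finset.sum_congr rfl fun m _ => ?_
  simp only [Finset.sum_mul]
  rw [Finset.sum_comm]
  refine Finset.sum_congr rfl fun l _ => ?_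
  rw [mul_assoc, ← mul_assoc (PowerSeries.C (ann s l)), ann_mul_ent, Finset.sum_mul,
    Finset.mul_sum]
  simp only [mul_assoc]

theorem crePS_mul_crePS (T : Twist 𝔤) (i j : ι) : crePS s ρ T i * crePS s ρ T j =
      ∑ l, ∑ k, PowerSeries.C (cre s l) * PowerSeries.C (cre s k) *
        ent₂ s ρ (mapPS (comulRight 𝔤) T.Finv * mapPS (leg23 𝔤) T.Finv) l k i j := by
  simp only [crePS_eq, ent₂_mul, ent₂_leg23, mul_ite, mul_zero, Finset.sum_ite_irrel,
    Finset.sum_const_zero, Finset.sum_ite_eq', Finset.mem_univ, if_true]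
  rw [Finset.sum_mul_sum]
  refine Finset.sum_congr rfl fun l _ => ?_
  simp only [Finset.mul_sum]
  rw [Finset.sum_comm]
  refine Finset.sum_congr rfl fun m _ => ?_
  rw [mul_assoc, ← mul_assoc (ent s ρ T.Finv l i), ent_mul_cre, Finset.sum_mul,
    Finset.mul_sum]
  simp only [mul_assoc]

/-- The contraction term of the bare generators leaves (F F⁻¹)^i_j = δ^i_j. In the normally ordered
term the creator moves left through F and the annihilator right through F⁻¹; the ρ-legs then stand
in opposite order, which the exchange of legs corrects. -/
theorem annPS_mul_crePS (hρ : ∀ x, ρ (star x) = (ρ x).conjTranspose) {T : Twist 𝔤}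
    (hT : T.IsUnitary) (i j : ι) : annPS s ρ T i * crePS s ρ T j =
      (if i = j then 1 else 0) + PowerSeries.C (algebraMap ℂ (CAlg s ι) s.sgn) *
        ∑ k, ∑ n, PowerSeries.C (cre s k) *
          ent₂ s ρ (mapPS (comulRight 𝔤) T.F * mapPS (swap12 𝔤) (mapPS (comulRight 𝔤) T.Finv))
            i k n j * PowerSeries.C (ann s n) := by
  have h1 (l m : ι) : ent s ρ T.F i l * PowerSeries.C (ann s l) *
      (PowerSeries.C (cre s m) * ent s ρ T.Finv m j) =
      (if l = m then ent s ρ T.F i l * ent s ρ T.Finv l j else 0) +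
        PowerSeries.C (algebraMap ℂ (CAlg s ι) s.sgn) *
        ∑ k, ∑ n, PowerSeries.C (cre s k) * (ent₂ s ρ (mapPS (comulRight 𝔤) T.F) i k l m *
          ent₂ s ρ (mapPS (comulRight 𝔤) T.Finv) m l j n) * PowerSeries.C (ann s n) := by
    have e : ent s ρ T.F i l * PowerSeries.C (ann s l) *
        (PowerSeries.C (cre s m) * ent s ρ T.Finv m j) = ent s ρ T.F i l *
        (PowerSeries.C (ann s l) * PowerSeries.C (cre s m)) * ent s ρ T.Finv m j := by
      simp only [mul_assoc]
    have e2 : ent s ρ T.F i l * (PowerSeries.C (cre s m) * PowerSeries.C (ann s l)) *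
        ent s ρ T.Finv m j = (ent s ρ T.F i l * PowerSeries.C (cre s m)) *
        (PowerSeries.C (ann s l) * ent s ρ T.Finv m j) := by
      simp only [mul_assoc]
    rw [e, C_ann_mul_C_cre, mul_add, add_mul]
    congr 1
    · split_ifs with hlm <;> simp [hlm]
    · rw [← PowerSeries.map_C, scal_mul_left_comm, mul_assoc, e2, ent_mul_cre, ann_mul_ent,
        Finset.sum_mul_sum]
      simp only [mul_assoc]
  rw [annPS_eq hρ hT, crePS_eq, Finset.sum_mul_sum]
  simp only [h1, Finset.sum_add_distrib]
  congr 1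
  · simp only [Finset.sum_ite_eq, Finset.mem_univ, if_true]
    rw [← ent_mul, T.mul_inv, ent_one]
  · simp only [ent₂_mul, ent₂_swap, Finset.mul_sum, Finset.sum_mul]
    rw [Finset.sum_congr rfl fun l _ => Finset.sum_comm, Finset.sum_comm]
    refine Finset.sum_congr rfl fun k _ => ?_
    rw [Finset.sum_congr rfl fun l _ => Finset.sum_comm, Finset.sum_comm]

/-- Exchanging the bare generators gives the sign, exchanging the legs of the dressing gives R
(`swap_cocycle`, `swap_inv_cocycle`, `comulRight_mul_swap`); what remains is the renaming of
summation indices. -/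
theorem satisfiesQCR_formal (hρ : ∀ x, ρ (star x) = (ρ x).conjTranspose) {T : Twist 𝔤}
    (hT : T.IsUnitary) : SatisfiesQCR (PowerSeries.C (algebraMap ℂ (CAlg s ι) s.sgn))
      (PowerSeries.C (algebraMap ℂ (CAlg s ι) s.sgn)) (fun i j h k => scal (RPS ρ T i j h k))
      (annPS s ρ T) (crePS s ρ T) := by
  refine ⟨fun i j => ?_, fun i j => ?_, fun i j => ?_⟩
  · have h1 (k m : ι) : ent₂ s ρ (mapPS (leg23 𝔤) T.F * mapPS (comulRight 𝔤) T.F) j i m k =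
        ∑ v, ∑ u, scal (RPS ρ T i j v u) *
          ent₂ s ρ (mapPS (leg23 𝔤) T.F * mapPS (comulRight 𝔤) T.F) v u k m := by
      rw [← ent₂_swap, T.swap_cocycle, ent₂_mul]
      simp only [ent₂_leg12_universalR]
    have h2 (k m : ι) (x : PowerSeries (CAlg s ι)) :
        x * (PowerSeries.C (ann s k) * PowerSeries.C (ann s m)) =
        PowerSeries.C (algebraMap ℂ (CAlg s ι) s.sgn) *
          (x * (PowerSeries.C (ann s m) * PowerSeries.C (ann s k))) := by
      rw [C_ann_mul_C_ann, ← PowerSeries.map_C, scal_mul_left_comm]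
    rw [annPS_mul_annPS hρ hT, Finset.sum_congr rfl fun m _ => Finset.sum_congr rfl fun k _ => by
      rw [h1, h2]]
    simp only [annPS_mul_annPS hρ hT, ← Finset.mul_sum]
    congr 1
    simp only [Finset.sum_mul, Finset.mul_sum]
    rw [sum_sum_sum_sum_reverse]
    simp only [mul_assoc]
  · have h1 (k l : ι) :
        ent₂ s ρ (mapPS (comulRight 𝔤) T.Finv * mapPS (leg23 𝔤) T.Finv) l k i j =
        ∑ u, ∑ v, scal (RPS ρ T v u i j) *
          ent₂ s ρ (mapPS (comulRight 𝔤) T.Finv * mapPS (leg23 𝔤) T.Finv) k l u v := by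
      rw [← ent₂_swap, T.swap_inv_cocycle, ent₂_mul]
      simp only [ent₂_leg12_flip_universalR, scal_commute]
    have h2 (k l : ι) (x : PowerSeries (CAlg s ι)) :
        PowerSeries.C (cre s l) * PowerSeries.C (cre s k) * x =
        PowerSeries.C (algebraMap ℂ (CAlg s ι) s.sgn) *
          (PowerSeries.C (cre s k) * PowerSeries.C (cre s l) * x) := by
      rw [C_cre_mul_C_cre, mul_assoc]
    rw [crePS_mul_crePS, Finset.sum_congr rfl fun l _ => Finset.sum_congr rfl fun k _ => by
      rw [h1, h2]]
    simp only [crePS_mul_crePS, ← Finset.mul_sum]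
    congr 1
    simp only [Finset.mul_sum]
    rw [sum_sum_sum_sum_reverse, Finset.sum_comm]
    simp only [scal_mul_left_comm]
  · rw [annPS_mul_crePS hρ hT]
    congr 2
    have h1 (k n : ι) : ent₂ s ρ (mapPS (comulRight 𝔤) T.F *
        mapPS (swap12 𝔤) (mapPS (comulRight 𝔤) T.Finv)) i k n j =
        ∑ u, ∑ v, scal (RPS ρ T u i j v) * (ent s ρ T.Finv k u * ent s ρ T.F v n) := by
      rw [T.comulRight_mul_swap, ent₂_mul]
      simp only [ent₂_mul, ent₂_leg23, ent₂_swap, ent₂_leg12_flip_universalR, ite_mul, mul_ite,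
        zero_mul, mul_zero, Finset.sum_ite_irrel, Finset.sum_const_zero, Finset.sum_ite_eq,
        Finset.sum_ite_eq', Finset.mem_univ, if_true, Finset.sum_mul]
      rw [Finset.sum_comm]
      refine Finset.sum_congr rfl fun u _ => Finset.sum_congr rfl fun v _ => ?_
      rw [← scal_commute, mul_assoc]
    simp only [h1, crePS_eq, annPS_eq hρ hT, Finset.mul_sum, Finset.sum_mul]
    rw [sum_sum_sum_sum_reverse, Finset.sum_comm]
    simp only [scal_mul_left_comm, mul_assoc]

end Formal

/-! ### Conjugation by a unitary formal series. -/

section Formal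
set_option linter.unusedSectionVars false
variable {ι : Type*} [Fintype ι] [DecidableEq ι]

theorem SatisfiesQCR.map {A B : Type*} [Ring A] [Ring B] (φ : A →+* B) {c₁ c₂ : A}
    {R : ι → ι → ι → ι → A} {X Xp : ι → A} (h : SatisfiesQCR c₁ c₂ R X Xp) :
    SatisfiesQCR (φ c₁) (φ c₂) (fun i j h k => φ (R i j h k)) (fun i => φ (X i))
      (fun i => φ (Xp i)) := by
  obtain ⟨h1, h2, h3⟩ := h
  refine ⟨fun i j => ?_, fun i j => ?_, fun i j => ?_⟩
  · simpa only [map_mul, map_sum] using congrArg φ (h1 i j)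
  · simpa only [map_mul, map_sum] using congrArg φ (h2 i j)
  · simpa only [map_mul, map_sum, map_add, apply_ite φ, map_one, map_zero] using
      congrArg φ (h3 i j)

/-- Conjugation by an invertible element. -/
def conjHom {A : Type*} [Ring A] (a b : A) (hab : a * b = 1) (hba : b * a = 1) : A →+* A where
  toFun x := a * x * b
  map_one' := by rw [mul_one, hab]
  map_mul' x y := by
    rw [mul_assoc (a * x) b, ← mul_assoc b, ← mul_assoc b, hba, one_mul]
    simp only [mul_assoc]
  map_zero' := by simp
  map_add' x y := by rw [mul_add, add_mul]

variable {𝔤 : Type*} [LieRing 𝔤] [LieAlgebra ℂ 𝔤] [StarAddMonoid 𝔤] [StarLieAlgebra 𝔤]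
  {s : Stat} {ρ : 𝔤 →ₗ⁅ℂ⁆ Matrix ι ι ℂ}

/-- The elements `α A^i α⁻¹`, `α A^+_i α⁻¹` satisfy the relations in `𝒜[[h]]`. -/
theorem satisfiesQCR_conj (hρ : ∀ x, ρ (star x) = (ρ x).conjTranspose) {T : Twist 𝔤}
    (hT : T.IsUnitary) {α : PowerSeries (CAlg s ι)} (hα : IsUnitaryPS α) :
    SatisfiesQCR (PowerSeries.C (algebraMap ℂ (CAlg s ι) s.sgn))
        (PowerSeries.C (algebraMap ℂ (CAlg s ι) s.sgn))
        (fun i j h k => PowerSeries.map (algebraMap ℂ (CAlg s ι)) (RPS ρ T i j h k))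
        (fun i => α * annPS s ρ T i * psStar α) (fun i => α * crePS s ρ T i * psStar α) := by
  -- Scalar series are central, so the entries of R and the constants are unaffected by the
  -- conjugation.
  have hs (f : PowerSeries ℂ) : conjHom α (psStar α) hα.2.1 hα.2.2 (scal f) = scal f := by
    change α * scal f * psStar α = scal f
    rw [← scal_commute, mul_assoc, hα.2.1, mul_one]
  have h := (satisfiesQCR_formal (s := s) hρ hT).map (conjHom α (psStar α) hα.2.1 hα.2.2)
  rw [← PowerSeries.map_C] at h ⊢
  simp only [hs] at h
  exact h

theorem psStar_conj_annPS (hρ : ∀ x, ρ (star x) = (ρ x).conjTranspose) {T : Twist 𝔤}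
    (hT : T.IsUnitary) (α : PowerSeries (CAlg s ι)) (i : ι) :
    psStar (α * annPS s ρ T i * psStar α) = α * crePS s ρ T i * psStar α := by
  rw [psStar_mul, psStar_mul, psStar_psStar, psStar_annPS hρ hT, mul_assoc]

end Formal

/-! ### Values of formal power series -/

section Values
set_option linter.unusedSectionVars false
variable {H : Type*} [NormedAddCommGroup H] [InnerProductSpace ℂ H] {D : Submodule ℂ H}
  {s : Stat} {ι : Type*} [Fintype ι] [DecidableEq ι]
  (π : CAlg s ι →ₐ[ℂ] Module.End ℂ D) (h : ℝ)

/-- The series `π(x)` converges to `T` at `h`, and its coefficients map every vector to a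
finite-dimensional subspace. -/
def Evals (x : PowerSeries (CAlg s ι)) (T : Module.End ℂ D) : Prop :=
  (∀ v : D, ∃ W : Submodule ℂ D, FiniteDimensional ℂ W ∧ ∀ n, π (PowerSeries.coeff n x) v ∈ W) ∧
    IsValue π h x (fun v => (T v : H))

variable {π h}

theorem Evals.unique {x : PowerSeries (CAlg s ι)} {T T' : Module.End ℂ D} (hT : Evals π h x T)
    (hT' : Evals π h x T') : T = T' :=
  LinearMap.ext fun v => Subtype.ext ((hT.2 v).unique (hT'.2 v))

theorem hasSum_submodule {W : Submodule ℂ D} {f : ℕ → W} {w : W}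
    (hf : HasSum (fun n => ((f n : D) : H)) ((w : D) : H)) : HasSum f w := by
  have hi : Topology.IsInducing (D.subtype ∘ₗ W.subtype) :=
    Topology.IsInducing.subtypeVal.comp Topology.IsInducing.subtypeVal
  exact (hi.hasSum_iff f w).1 hf

theorem summable_norm_of_summable_complex {E : Type*} [NormedAddCommGroup E] [NormedSpace ℂ E]
    [FiniteDimensional ℂ E] {f : ℕ → E} (hf : Summable f) : Summable fun n => ‖f n‖ := by
  have : FiniteDimensional ℝ E := FiniteDimensional.complexToReal E
  exact summable_norm_iff.2 hf

/-- D need not be complete, but a finite-dimensional subspace is closed in H, so the sum stays in W.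
-/
theorem mem_of_hasSum {W : Submodule ℂ D} [FiniteDimensional ℂ W] {f : ℕ → D} {v : D}
    (hf : HasSum (fun n => (f n : H)) (v : H)) (hW : ∀ n, f n ∈ W) : v ∈ W := by
  have hc : IsClosed (W.map D.subtype : Set H) := Submodule.closed_of_finiteDimensional _
  have : (v : H) ∈ W.map D.subtype :=
    hc.mem_of_tendsto hf (.of_forall fun s => Submodule.sum_mem _ fun n _ =>
      Submodule.mem_map_of_mem (f := D.subtype) (hW n))
  obtain ⟨w, hw, hwv⟩ := this
  rwa [← Subtype.ext hwv]

/-- In finite dimension unconditional convergence is absolute. This provides the absolute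
convergence needed for Cauchy products. -/
theorem summable_norm_of_finiteDimensional {W : Submodule ℂ D} [FiniteDimensional ℂ W] {f : ℕ → D}
    {v : D} (hf : HasSum (fun n => (f n : H)) (v : H)) (hW : ∀ n, f n ∈ W) :
    Summable fun n => ‖f n‖ := by
  have hv := mem_of_hasSum hf hW
  have h1 : HasSum (fun n => (⟨f n, hW n⟩ : W)) ⟨v, hv⟩ := hasSum_submodule hf
  have h2 := summable_norm_of_summable_complex (E := W) h1.summable
  exact h2

theorem Evals.add {x y : PowerSeries (CAlg s ι)} {T S : Module.End ℂ D} (hx : Evals π h x T)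
    (hy : Evals π h y S) : Evals π h (x + y) (T + S) := by
  refine ⟨fun v => ?_, fun v => ?_⟩
  · obtain ⟨W, hW, h1⟩ := hx.1 v
    obtain ⟨W', hW', h2⟩ := hy.1 v
    refine ⟨W ⊔ W', inferInstance, fun n => ?_⟩
    rw [map_add, map_add]
    exact Submodule.add_mem_sup (h1 n) (h2 n)
  · simpa using (hx.2 v).add (hy.2 v)

theorem Evals.const (a : CAlg s ι) : Evals π h (PowerSeries.C a) (π a) := by
  refine ⟨fun v => ⟨Submodule.span ℂ {π a v}, inferInstance, fun n => ?_⟩, fun v => ?_⟩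
  · rw [PowerSeries.coeff_C]
    split_ifs
    · exact Submodule.mem_span_singleton_self _
    · simp
  · have := hasSum_single (f := fun n : ℕ => (h : ℂ) ^ n •
      ((π (PowerSeries.coeff n (PowerSeries.C a)) v : D) : H)) 0 fun n hn => by
        simp [PowerSeries.coeff_C, hn]
    simpa using this

theorem Evals.scal {f : PowerSeries ℂ} {c : ℂ}
    (hf : HasSum (fun n : ℕ => (h : ℂ) ^ n * PowerSeries.coeff n f) c) :
    Evals π h (scal f) (algebraMap ℂ (Module.End ℂ D) c) := by
  refine ⟨fun v => ⟨Submodule.span ℂ {v}, inferInstance, fun n => ?_⟩, fun v => ?_⟩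
  · rw [PowerSeries.coeff_map, AlgHom.commutes, Module.algebraMap_end_apply]
    exact Submodule.smul_mem _ _ (Submodule.mem_span_singleton_self v)
  · have := hf.smul_const (v : H)
    simpa [Module.algebraMap_end_apply, smul_smul] using this

variable [CompleteSpace H]

/-- All vectors π(yₙ)v lie in one finite-dimensional space W. Expanded in a basis of W, the product
series becomes a finite sum of Cauchy products of the vector series for x on a basis vector with the
scalar series of a coordinate, all absolutely convergent. -/
theorem Evals.mul {x y : PowerSeries (CAlg s ι)} {T S : Module.End ℂ D} (hx : Evals π h x T)
    (hy : Evals π h y S) : Evals π h (x * y) (T * S) := by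
  have key (v : D) : (∃ W : Submodule ℂ D, FiniteDimensional ℂ W ∧
      ∀ n, π (PowerSeries.coeff n (x * y)) v ∈ W) ∧
      HasSum (fun n : ℕ => (h : ℂ) ^ n • ((π (PowerSeries.coeff n (x * y)) v : D) : H))
        (T (S v) : H) := by
    obtain ⟨W, hW, hWy⟩ := hy.1 v
    let e := Module.finBasis ℂ W
    choose W' hW' hWx using fun k => hx.1 (e k : D)
    have hSv : S v ∈ W := mem_of_hasSum (f := fun n => (h : ℂ) ^ n • π (PowerSeries.coeff n y) v)
      (by simpa using hy.2 v) fun n => W.smul_mem _ (hWy n)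
    let c (k) : W →L[ℂ] ℂ := LinearMap.toContinuousLinearMap (e.coord k)
    have hexp (w : W) : (w : D) = ∑ k, c k w • (e k : D) := by
      have h1 := congrArg (W.subtype) (e.sum_repr w)
      rw [map_sum] at h1
      exact h1.symm
    have hc : HasSum (fun n : ℕ => (⟨(h : ℂ) ^ n • π (PowerSeries.coeff n y) v,
        W.smul_mem _ (hWy n)⟩ : W)) ⟨S v, hSv⟩ :=
      hasSum_submodule (by simpa using hy.2 v)
    have hxe (k) := hx.2 (e k : D)
    have hprod (k) := hasSum_antidiagonal_of_summable_norm (β := fun (a : H) (b : ℂ) => b • a)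
      (fun b f s hf => hf.const_smul b) (fun a f s hf => hf.smul_const a)
      (fun a b => by rw [norm_smul, mul_comm]) (hxe k)
      (summable_norm_of_finiteDimensional (W := W' k)
        (f := fun n => (h : ℂ) ^ n • π (PowerSeries.coeff n x) (e k)) (by simpa using hxe k)
        fun n => (W' k).smul_mem _ (hWx k n))
      (hc.mapL (c k)) (summable_norm_iff.2 (hc.mapL (c k)).summable)
    have hsum := hasSum_sum fun k (_ : k ∈ Finset.univ) => hprod k
    have hcoe (n : ℕ) : π (PowerSeries.coeff n (x * y)) v =
        ∑ p ∈ Finset.HasAntidiagonal.antidiagonal n, ∑ k,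
          c k ⟨π (PowerSeries.coeff p.2 y) v, hWy p.2⟩ • π (PowerSeries.coeff p.1 x) (e k) := by
      rw [PowerSeries.coeff_mul, map_sum, LinearMap.sum_apply]
      refine Finset.sum_congr rfl fun p _ => ?_
      rw [map_mul, Module.End.mul_apply]
      have := congrArg (π (PowerSeries.coeff p.1 x)) (hexp ⟨π (PowerSeries.coeff p.2 y) v, hWy p.2⟩)
      simpa using this
    constructor
    · refine ⟨⨆ k, W' k, inferInstance, fun n => ?_⟩
      rw [hcoe]
      exact Submodule.sum_mem _ fun p _ => Submodule.sum_mem _ fun k _ =>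
        Submodule.smul_mem _ _ (Submodule.mem_iSup_of_mem k (hWx k _))
    · have e1 : (T (S v) : H) = ∑ k, c k ⟨S v, hSv⟩ • (T (e k) : H) := by
        have := congrArg (fun w : D => (T w : H)) (hexp ⟨S v, hSv⟩)
        simpa using this
      rw [e1]
      convert hsum using 2 with n
      rw [hcoe, Submodule.coe_sum, Finset.smul_sum, Finset.sum_comm]
      refine Finset.sum_congr rfl fun p hp => ?_
      rw [Submodule.coe_sum, Finset.smul_sum]
      refine Finset.sum_congr rfl fun k _ => ?_
      have e2 : c k ⟨(h : ℂ) ^ p.2 • π (PowerSeries.coeff p.2 y) v, W.smul_mem _ (hWy p.2)⟩ =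
          (h : ℂ) ^ p.2 * c k ⟨π (PowerSeries.coeff p.2 y) v, hWy p.2⟩ :=
        (c k).map_smul ((h : ℂ) ^ p.2) ⟨π (PowerSeries.coeff p.2 y) v, hWy p.2⟩
      rw [e2, ← Finset.HasAntidiagonal.mem_antidiagonal.1 hp, Submodule.coe_smul, smul_smul,
        smul_smul, pow_add]
      congr 1
      ring
  exact ⟨fun v => (key v).1, fun v => (key v).2⟩

variable (π h) in
/-- The pairs of a series and its value form a ring. -/
noncomputable def evalRing : Subring (PowerSeries (CAlg s ι) × Module.End ℂ D) where
  carrier := {p | Evals π h p.1 p.2}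
  mul_mem' hx hy := Evals.mul hx hy
  add_mem' hx hy := Evals.add hx hy
  one_mem' := by
    have := Evals.const (π := π) (h := h) 1
    rwa [map_one, map_one] at this
  zero_mem' := by
    have := Evals.const (π := π) (h := h) 0
    rwa [map_zero, map_zero] at this
  neg_mem' {x} hx := by
    have := (Evals.const (π := π) (h := h) (-1)).mul hx
    rw [map_neg, map_neg, map_one, map_one, neg_one_mul] at this
    have h2 : (-1 : Module.End ℂ D) * x.2 = -x.2 := LinearMap.ext fun v => by
      rw [Module.End.mul_apply]; rfl
    rwa [h2] at this

end Values

section FockSpace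
set_option linter.unusedSectionVars false
variable {H : Type*} [NormedAddCommGroup H] [InnerProductSpace ℂ H] {D : Submodule ℂ H}
  {s : Stat} {ι : Type*} [Fintype ι] [DecidableEq ι]
  {π : CAlg s ι →ₐ[ℂ] Module.End ℂ D} {L : Type*} {Ω : L → D}

/-! ### Invariant subspaces of the Fock space -/

/-- The span of the `k`-particle vectors over the vacuum `v`. -/
def particleSpan (π : CAlg s ι →ₐ[ℂ] Module.End ℂ D) (v : D) (k : ℕ) : Submodule ℂ D :=
  Submodule.span ℂ ((fun w : List ι => π (w.map (cre s)).prod v) '' {w | w.length = k})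

theorem finiteDimensional_particleSpan (v : D) (k : ℕ) :
    FiniteDimensional ℂ (particleSpan π v k) :=
  FiniteDimensional.span_of_finite ℂ ((List.finite_length_eq ι k).image _)

theorem cre_mem_particleSpan {v : D} {k : ℕ} (i : ι) {x : D} (hx : x ∈ particleSpan π v k) :
    π (cre s i) x ∈ particleSpan π v (k + 1) := by
  induction hx using Submodule.span_induction with
  | mem x h =>
    obtain ⟨w, hw, rfl⟩ := h
    refine Submodule.subset_span ⟨i :: w, by simpa using hw, ?_⟩
    simp [Module.End.mul_apply]
  | zero => simp
  | add x y _ _ hx hy => rw [map_add]; exact Submodule.add_mem _ hx hy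
  | smul c x _ hx => rw [map_smul]; exact Submodule.smul_mem _ c hx

theorem jordan_vacuum (hπ : IsFockRep π Ω) (M : Matrix ι ι ℂ) (l : L) :
    π (jordan s M) (Ω l) = 0 := by
  have : π (jordan s M) (Ω l) = ∑ i, ∑ j, M i j • π (cre s i) (π (ann s j) (Ω l)) := by
    change π (∑ i, ∑ j, M i j • (cre s i * ann s j)) (Ω l) = _
    simp [LinearMap.sum_apply, Module.End.mul_apply]
  simp [this, hπ.vacuum]

theorem jordan_cre_apply (M : Matrix ι ι ℂ) (i : ι) (v : D) :
    π (jordan s M) (π (cre s i) v) =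
      ∑ l, M l i • π (cre s l) v + π (cre s i) (π (jordan s M) v) := by
  have := congrArg (fun x => π x v) (jordan_mul_cre s M i)
  simpa [LinearMap.sum_apply, Module.End.mul_apply] using this

/-- Bilinears conserve the particle number: commuting them to the right replaces one creator at a
time by other creators, until they annihilate the vacuum. -/
theorem jordan_mem_particleSpan (hπ : IsFockRep π Ω) (M : Matrix ι ι ℂ) (l : L) {k : ℕ} {x : D}
    (hx : x ∈ particleSpan π (Ω l) k) : π (jordan s M) x ∈ particleSpan π (Ω l) k := by
  induction hx using Submodule.span_induction with
  | mem x h =>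
    obtain ⟨w, hw, rfl⟩ := h
    simp only
    induction w generalizing k with
    | nil => simp [jordan_vacuum hπ]
    | cons i w ih =>
      obtain rfl : w.length + 1 = k := hw
      have hw' : π (w.map (cre s)).prod (Ω l) ∈ particleSpan π (Ω l) w.length :=
        Submodule.subset_span ⟨w, rfl, rfl⟩
      rw [List.map_cons, List.prod_cons, map_mul, Module.End.mul_apply, jordan_cre_apply]
      exact Submodule.add_mem _
        (Submodule.sum_mem _ fun m _ => Submodule.smul_mem _ _ (cre_mem_particleSpan m hw'))
        (cre_mem_particleSpan i (ih rfl))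
  | zero => simp
  | add x y _ _ hx hy => rw [map_add]; exact Submodule.add_mem _ hx hy
  | smul c x _ hx => rw [map_smul]; exact Submodule.smul_mem _ c hx

theorem number_monomial (hπ : IsFockRep π Ω) (l : L) (w : List ι) :
    π (jordan s 1) (π (w.map (cre s)).prod (Ω l)) =
      ((w.length : ℝ) : ℂ) • π (w.map (cre s)).prod (Ω l) := by
  induction w with
  | nil => simp [jordan_vacuum hπ]
  | cons i w ih =>
    rw [List.map_cons, List.prod_cons, map_mul, Module.End.mul_apply, jordan_cre_apply, ih]
    simp [Matrix.one_apply, add_smul, add_comm]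

variable {𝔤 : Type*} [LieRing 𝔤] [LieAlgebra ℂ 𝔤] (ρ : 𝔤 →ₗ⁅ℂ⁆ Matrix ι ι ℂ)

theorem sigma_mem_particleSpan (hπ : IsFockRep π Ω) (x : U 𝔤) (l : L) {k : ℕ} {v : D}
    (hv : v ∈ particleSpan π (Ω l) k) : π (sigma s ρ x) v ∈ particleSpan π (Ω l) k := by
  induction x using U_induction generalizing v with
  | scalar c =>
    rw [AlgHom.commutes, AlgHom.commutes, Module.algebraMap_end_apply]
    exact Submodule.smul_mem _ c hv
  | inc x => rw [sigma_inc]; exact jordan_mem_particleSpan hπ _ l hv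
  | mul x y hx hy => rw [map_mul, map_mul, Module.End.mul_apply]; exact hx (hy hv)
  | add x y hx hy =>
    rw [map_add, map_add, LinearMap.add_apply]
    exact Submodule.add_mem _ (hx hv) (hy hv)

/-- Every vector lies in a finite-dimensional subspace invariant under `σ(U 𝔤)`. -/
theorem exists_sigma_invariant (hπ : IsFockRep π Ω) (v : D) :
    ∃ W : Submodule ℂ D, FiniteDimensional ℂ W ∧ v ∈ W ∧
      ∀ x : U 𝔤, ∀ w ∈ W, π (sigma s ρ x) w ∈ W := by
  have hv : v ∈ Submodule.span ℂ
      (Set.range fun p : List ι × L => π (p.1.map (cre s)).prod (Ω p.2)) := by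
    rw [hπ.span]; trivial
  induction hv using Submodule.span_induction with
  | mem v h =>
    obtain ⟨⟨w, l⟩, rfl⟩ := h
    exact ⟨particleSpan π (Ω l) w.length, finiteDimensional_particleSpan _ _,
      Submodule.subset_span ⟨w, rfl, rfl⟩, fun x _ h => sigma_mem_particleSpan ρ hπ x l h⟩
  | zero => exact ⟨⊥, inferInstance, Submodule.zero_mem _, fun x w hw => by
      rw [(Submodule.mem_bot ℂ).1 hw, map_zero]; exact Submodule.zero_mem _⟩
  | add v w _ _ hv hw =>
    obtain ⟨V, _, hv, hV⟩ := hv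
    obtain ⟨W, _, hw, hW⟩ := hw
    refine ⟨V ⊔ W, inferInstance, Submodule.add_mem_sup hv hw, fun x y hy => ?_⟩
    obtain ⟨a, ha, b, hb, rfl⟩ := Submodule.mem_sup.1 hy
    rw [map_add]
    exact Submodule.add_mem_sup (hV x a ha) (hW x b hb)
  | smul c v _ hv =>
    obtain ⟨V, hf, hv, hV⟩ := hv
    exact ⟨V, hf, V.smul_mem c hv, hV⟩

theorem rhoSigma_mem {W : Submodule ℂ D} (hW : ∀ x : U 𝔤, ∀ w ∈ W, π (sigma s ρ x) w ∈ W)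
    (i j : ι) (t : U 𝔤 ⊗[ℂ] U 𝔤) {w : D} (hw : w ∈ W) : π (rhoSigma s ρ i j t) w ∈ W := by
  induction t using TensorProduct.induction_on with
  | zero => simp
  | tmul x y =>
    rw [rhoSigma_tmul, map_smul]
    exact W.smul_mem _ (hW y w hw)
  | add x y hx hy =>
    rw [map_add, map_add]
    exact W.add_mem hx hy

/-! ### Matrix elements on one-particle vectors -/

/-- One-particle vectors carry the representation ρ itself. Matrix elements of (ρ ⊗ σ)(F) on them
are therefore entries of (ρ ⊗ ρ)(F), which is how the convergence of R is obtained; it is also why a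
vacuum is needed. -/
theorem sigma_cre_vacuum (hπ : IsFockRep π Ω) (l : L) (y : U 𝔤) (m : ι) :
    π (sigma s ρ y) (π (cre s m) (Ω l)) = ∑ j, rhoU ρ y j m • π (cre s j) (Ω l) := by
  induction y using U_induction generalizing m with
  | scalar c =>
    rw [AlgHom.commutes, AlgHom.commutes, AlgHom.commutes, Module.algebraMap_end_apply]
    simp [Matrix.algebraMap_matrix_apply]
  | inc x =>
    rw [sigma_inc, rhoU_inc, jordan_cre_apply, jordan_vacuum hπ, map_zero, add_zero]
  | mul x y hx hy =>
    rw [map_mul, map_mul, Module.End.mul_apply, hy, map_sum, map_mul]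
    simp only [map_smul, hx, Matrix.mul_apply, Finset.sum_smul, Finset.smul_sum, smul_smul]
    rw [Finset.sum_comm]
    simp only [mul_comm]
  | add x y hx hy =>
    rw [map_add, map_add, LinearMap.add_apply, hx, hy, map_add]
    simp [add_smul, Finset.sum_add_distrib]

theorem rhoSigma_cre_vacuum (hπ : IsFockRep π Ω) (l : L) (i k m : ι) (t : U 𝔤 ⊗[ℂ] U 𝔤) :
    π (rhoSigma s ρ i k t) (π (cre s m) (Ω l)) =
      ∑ j, rhoRho ρ i j k m t • π (cre s j) (Ω l) := by
  induction t using TensorProduct.induction_on with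
  | zero => simp
  | tmul x y =>
    rw [rhoSigma_tmul, map_smul, LinearMap.smul_apply, sigma_cre_vacuum ρ hπ, Finset.smul_sum]
    simp only [rhoRho_tmul, smul_smul]
  | add x y hx hy =>
    rw [map_add, map_add, LinearMap.add_apply, hx, hy]
    simp [add_smul, Finset.sum_add_distrib]

theorem inner_cre_vacuum (hπ : IsFockRep π Ω) (l : L) (i j : ι) :
    inner ℂ ((π (cre s i) (Ω l) : D) : H) ((π (cre s j) (Ω l) : D) : H) =
      if i = j then (1 : ℂ) else 0 := by
  rw [← hπ.adjoint, ← Module.End.mul_apply, ← map_mul, ann_mul_cre]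
  rw [map_add, map_smul, map_mul, LinearMap.add_apply, LinearMap.smul_apply, Module.End.mul_apply,
    hπ.vacuum, map_zero, smul_zero, add_zero]
  by_cases h : i = j
  · subst h
    simp [inner_self_eq_norm_sq_to_K, hπ.orthonormal.1 l]
  · simp [h, Ne.symm h]

theorem inner_rhoSigma_cre_vacuum (hπ : IsFockRep π Ω) (l : L) (i j k m : ι)
    (t : U 𝔤 ⊗[ℂ] U 𝔤) : inner ℂ ((π (cre s j) (Ω l) : D) : H)
      ((π (rhoSigma s ρ i k t) (π (cre s m) (Ω l)) : D) : H) = rhoRho ρ i j k m t := by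
  rw [rhoSigma_cre_vacuum ρ hπ, Submodule.coe_sum, inner_sum]
  simp [inner_smul_right, inner_cre_vacuum hπ]

end FockSpace

/-! ### Convergence -/

section Convergence
set_option linter.unusedSectionVars false
variable {H : Type*} [NormedAddCommGroup H] [InnerProductSpace ℂ H] [CompleteSpace H]
  {D : Submodule ℂ H} {s : Stat} {ι : Type*} [Fintype ι] [DecidableEq ι]
  {π : CAlg s ι →ₐ[ℂ] Module.End ℂ D} {h : ℝ}

/-- The limit stays in D because the series of each vector runs in a finite-dimensional, hence
closed, subspace. -/
theorem exists_evals {x : PowerSeries (CAlg s ι)}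
    (hW : ∀ v : D, ∃ W : Submodule ℂ D, FiniteDimensional ℂ W ∧
      ∀ n, π (PowerSeries.coeff n x) v ∈ W)
    (hs : ∀ v : D, Summable fun n : ℕ =>
      (h : ℂ) ^ n • ((π (PowerSeries.coeff n x) v : D) : H)) :
    ∃ T : Module.End ℂ D, Evals π h x T := by
  have hmem (v : D) : ∑' n : ℕ, (h : ℂ) ^ n • ((π (PowerSeries.coeff n x) v : D) : H) ∈ D := by
    obtain ⟨W, _, hW⟩ := hW v
    have hc : IsClosed (W.map D.subtype : Set H) := Submodule.closed_of_finiteDimensional _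
    have := hc.mem_of_tendsto (hs v).hasSum (.of_forall fun s => Submodule.sum_mem _ fun n _ =>
      Submodule.smul_mem _ _ (Submodule.mem_map_of_mem (f := D.subtype) (hW n)))
    obtain ⟨w, -, hw⟩ := this
    rw [← hw]
    exact w.2
  refine ⟨{ toFun := fun v => ⟨_, hmem v⟩, map_add' := fun v w => ?_, map_smul' := fun c v => ?_ },
    hW, fun v => (hs v).hasSum⟩
  · apply Subtype.ext
    rw [Submodule.coe_add, ← (hs v).tsum_add (hs w)]
    simp
  · apply Subtype.ext
    rw [RingHom.id_apply, Submodule.coe_smul, ← (hs v).tsum_const_smul]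
    simp [smul_comm c]

/-- Pointwise convergence on a finite-dimensional space passes to the adjoints. -/
theorem summable_star (hadj : ∀ x, FormallyAdjoint (π x) (π (star x)))
    {x : PowerSeries (CAlg s ι)} {W : Submodule ℂ D} [FiniteDimensional ℂ W] {v : D} (hv : v ∈ W)
    (hW : ∀ n, ∀ w ∈ W, π (star (PowerSeries.coeff n x)) w ∈ W)
    (hs : ∀ v : D, Summable fun n : ℕ =>
      (h : ℂ) ^ n • ((π (PowerSeries.coeff n x) v : D) : H)) :
    Summable fun n : ℕ => (h : ℂ) ^ n • ((π (PowerSeries.coeff n (psStar x)) v : D) : H) := by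
  let e := stdOrthonormalBasis ℂ W
  -- In an orthonormal basis e of W the coordinates of the adjoint terms are ⟨hⁿ π(xₙ) eₖ, v⟩, and
  -- these are summable since the original series converges on the finitely many eₖ.
  have key (n : ℕ) : (h : ℂ) ^ n • ((π (PowerSeries.coeff n (psStar x)) v : D) : H) =
      ∑ k, inner ℂ ((h : ℂ) ^ n • ((π (PowerSeries.coeff n x) (e k) : D) : H)) (v : H) •
        ((e k : D) : H) := by
    have h1 := congrArg (fun w : W => ((w : D) : H))
      (e.sum_repr ⟨π (star (PowerSeries.coeff n x)) v, hW n v hv⟩)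
    simp only [Submodule.coe_sum, Submodule.coe_smul] at h1
    rw [coeff_psStar, ← h1, Finset.smul_sum]
    refine Finset.sum_congr rfl fun k _ => ?_
    rw [smul_smul, OrthonormalBasis.repr_apply_apply, inner_smul_left, map_pow, Complex.conj_ofReal]
    congr 2
    exact (hadj _ _ _).symm
  simp only [key]
  refine summable_sum fun k _ => ?_
  have h1 := (hs (e k)).hasSum.map (innerSLFlip ℂ (v : H)).toLinearMap.toAddMonoidHom
      (innerSLFlip ℂ (v : H)).continuous
  exact h1.summable.smul_const _

theorem Evals.formallyAdjoint (hadj : ∀ x, FormallyAdjoint (π x) (π (star x)))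
    {x : PowerSeries (CAlg s ι)} {T T' : Module.End ℂ D} (hT : Evals π h x T)
    (hT' : Evals π h (psStar x) T') : FormallyAdjoint T T' := fun v w => by
  have h1 := (hT.2 v).map (innerSLFlip ℂ (w : H)).toLinearMap.toAddMonoidHom
      (innerSLFlip ℂ (w : H)).continuous
  have h2 := (hT'.2 w).mapL (innerSL ℂ (v : H))
  have h3 : ∀ n : ℕ, inner ℂ ((h : ℂ) ^ n • ((π (PowerSeries.coeff n x) v : D) : H)) (w : H) =
      inner ℂ (v : H) ((h : ℂ) ^ n • ((π (PowerSeries.coeff n (psStar x)) w : D) : H)) := fun n => by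
    rw [inner_smul_left, inner_smul_right, map_pow, Complex.conj_ofReal, coeff_psStar]
    congr 1
    exact hadj _ _ _
  have h4 : HasSum (fun n : ℕ => inner ℂ (v : H)
      ((h : ℂ) ^ n • ((π (PowerSeries.coeff n (psStar x)) w : D) : H))) (inner ℂ (T v : H) (w : H)) := by
    simp only [← h3]
    exact h1
  exact h4.unique h2

theorem Evals.sum {κ : Type*} (t : Finset κ) {x : κ → PowerSeries (CAlg s ι)}
    {T : κ → Module.End ℂ D} (hx : ∀ k, Evals π h (x k) (T k)) :
    Evals π h (∑ k ∈ t, x k) (∑ k ∈ t, T k) := by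
  have := sum_mem (S := evalRing π h) (t := t) (f := fun k => (x k, T k)) fun k _ => hx k
  have h2 : (∑ k ∈ t, (x k, T k)) = (∑ k ∈ t, x k, ∑ k ∈ t, T k) :=
    Prod.ext Prod.fst_sum Prod.snd_sum
  rwa [h2] at this

theorem Evals.delta {i j : ι} : Evals π h (if i = j then 1 else 0) (if i = j then 1 else 0) := by
  split_ifs
  · exact (evalRing π h).one_mem
  · exact (evalRing π h).zero_mem

/-- The commutation relations pass to the values of formal power series. -/
theorem satisfiesQCR_of_evals {c₁ c₂ : ℂ} {R : ι → ι → ι → ι → PowerSeries ℂ}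
    {X Xp : ι → PowerSeries (CAlg s ι)}
    (hq : SatisfiesQCR (PowerSeries.C (algebraMap ℂ (CAlg s ι) c₁))
      (PowerSeries.C (algebraMap ℂ (CAlg s ι) c₂)) (fun i j k l => scal (R i j k l)) X Xp)
    {r : ι → ι → ι → ι → ℂ} (hr : ∀ i j k l,
      HasSum (fun n : ℕ => (h : ℂ) ^ n * PowerSeries.coeff n (R i j k l)) (r i j k l))
    {B Bp : ι → Module.End ℂ D} (hB : ∀ i, Evals π h (X i) (B i))
    (hBp : ∀ i, Evals π h (Xp i) (Bp i)) :
    SatisfiesQCR (algebraMap ℂ (Module.End ℂ D) c₁) (algebraMap ℂ (Module.End ℂ D) c₂)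
      (fun i j k l => algebraMap ℂ (Module.End ℂ D) (r i j k l)) B Bp := by
  have hc (c : ℂ) : Evals π h (PowerSeries.C (algebraMap ℂ (CAlg s ι) c))
      (algebraMap ℂ (Module.End ℂ D) c) := by
    have := Evals.const (π := π) (h := h) (algebraMap ℂ (CAlg s ι) c)
    rwa [AlgHom.commutes] at this
  obtain ⟨h1, h2, h3⟩ := hq
  refine ⟨fun i j => ?_, fun i j => ?_, fun i j => ?_⟩
  · refine ((hB i).mul (hB j)).unique ?_
    rw [h1]
    exact (hc _).mul (Evals.sum _ fun u => Evals.sum _ fun v =>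
      (Evals.scal (hr _ _ _ _)).mul ((hB u).mul (hB v)))
  · refine ((hBp i).mul (hBp j)).unique ?_
    rw [h2]
    exact (hc _).mul (Evals.sum _ fun u => Evals.sum _ fun v =>
      (Evals.scal (hr _ _ _ _)).mul ((hBp u).mul (hBp v)))
  · refine ((hB i).mul (hBp j)).unique ?_
    rw [h3]
    exact Evals.delta.add ((hc _).mul (Evals.sum _ fun u => Evals.sum _ fun v =>
      (Evals.scal (hr _ _ _ _)).mul ((hBp u).mul (hB v))))

theorem hasSum_coeff_mul {f g : PowerSeries ℂ} {a b z : ℂ}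
    (hf : HasSum (fun n : ℕ => z ^ n * PowerSeries.coeff n f) a)
    (hg : HasSum (fun n : ℕ => z ^ n * PowerSeries.coeff n g) b) :
    HasSum (fun n : ℕ => z ^ n * PowerSeries.coeff n (f * g)) (a * b) := by
  have := hasSum_antidiagonal_of_summable_norm (β := fun x y : ℂ => x * y)
    (fun b f s hf => hf.mul_right b) (fun a f s hf => hf.mul_left a)
    (fun a b => (norm_mul a b).le) hf (summable_norm_iff.2 hf.summable) hg
    (summable_norm_iff.2 hg.summable)
  refine (funext fun n => ?_ : _ = fun n : ℕ => z ^ n * PowerSeries.coeff n (f * g)) ▸ this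
  rw [PowerSeries.coeff_mul, Finset.mul_sum]
  refine Finset.sum_congr rfl fun p hp => ?_
  rw [← Finset.HasAntidiagonal.mem_antidiagonal.1 hp, pow_add]
  ring

end Convergence

theorem HasSum.of_eq {E : Type*} [AddCommMonoid E] [TopologicalSpace E] {f g : ℕ → E} {a : E}
    (hf : HasSum f a) (hfg : ∀ n, f n = g n) : HasSum g a := funext hfg ▸ hf

/-! ### The twisted Fock representation at a value of `h`. -/

section TwistedFock
set_option linter.unusedSectionVars false
variable {𝔤 : Type*} [LieRing 𝔤] [LieAlgebra ℂ 𝔤] [StarAddMonoid 𝔤] [StarLieAlgebra 𝔤]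
  {ι : Type*} [Fintype ι] [DecidableEq ι] {ρ : 𝔤 →ₗ⁅ℂ⁆ Matrix ι ι ℂ} {T : Twist 𝔤} {s : Stat}
  {H : Type*} [NormedAddCommGroup H] [InnerProductSpace ℂ H] [CompleteSpace H]
  {D : Submodule ℂ H} {π : CAlg s ι →ₐ[ℂ] Module.End ℂ D} {L : Type*} {Ω : L → D} {h : ℝ}

theorem psStar_ent (hρ : ∀ x, ρ (star x) = (ρ x).conjTranspose) (hT : T.IsUnitary) (i j : ι) :
    psStar (ent s ρ T.F i j) = ent s ρ T.Finv j i := by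
  ext n
  rw [coeff_psStar, ent, ent, coeff_psMap, coeff_psMap, star_rhoSigma hρ, ← hT, coeff_psStar]

theorem exists_evals_ent (hπ : IsFockRep π Ω)
    (hs : ∀ i j (v : D), Summable fun n : ℕ => (h : ℂ) ^ n •
        ((π (rhoSigma s ρ i j (PowerSeries.coeff n T.F)) v : D) : H)) (i j : ι) :
    ∃ S, Evals π h (ent s ρ T.F i j) S := by
  refine exists_evals (fun v => ?_) fun v => ?_
  · obtain ⟨W, hf, hv, hW⟩ := exists_sigma_invariant ρ hπ v
    refine ⟨W, hf, fun n => ?_⟩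
    rw [ent, coeff_psMap]
    exact rhoSigma_mem ρ hW _ _ _ hv
  · simpa only [ent, coeff_psMap] using hs i j v

/-- Convergence is assumed for F only. By unitarity the entries for F⁻¹ are the adjoints of those
for F, and on invariant finite-dimensional subspaces summability passes to adjoints. -/
theorem exists_evals_ent_inv (hρ : ∀ x, ρ (star x) = (ρ x).conjTranspose) (hT : T.IsUnitary)
    (hπ : IsFockRep π Ω)
    (hs : ∀ i j (v : D), Summable fun n : ℕ => (h : ℂ) ^ n •
        ((π (rhoSigma s ρ i j (PowerSeries.coeff n T.F)) v : D) : H)) (i j : ι) :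
    ∃ S, Evals π h (ent s ρ T.Finv i j) S := by
  refine exists_evals (fun v => ?_) fun v => ?_
  · obtain ⟨W, hf, hv, hW⟩ := exists_sigma_invariant ρ hπ v
    refine ⟨W, hf, fun n => ?_⟩
    rw [ent, coeff_psMap]
    exact rhoSigma_mem ρ hW _ _ _ hv
  · obtain ⟨W, _, hv, hW⟩ := exists_sigma_invariant ρ hπ v
    rw [← psStar_ent hρ hT]
    refine summable_star hπ.formallyAdjoint hv (fun n w hw => ?_) ?_
    · rw [ent, coeff_psMap, star_rhoSigma hρ]
      exact rhoSigma_mem ρ hW _ _ _ hw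
    · simpa only [ent, coeff_psMap] using hs j i

/-- The entries of `(ρ ⊗ ρ)(F)` are matrix elements of `(ρ ⊗ σ)(F)` on one-particle vectors. -/
theorem exists_hasSum_rhoRho (hπ : IsFockRep π Ω) [Nonempty L]
    (hs : ∀ i j (v : D), Summable fun n : ℕ => (h : ℂ) ^ n •
        ((π (rhoSigma s ρ i j (PowerSeries.coeff n T.F)) v : D) : H)) (i j k m : ι) :
    ∃ r, HasSum (fun n : ℕ => (h : ℂ) ^ n *
      PowerSeries.coeff n (psMap (rhoRho ρ i j k m) T.F)) r := by
  let l : L := Classical.arbitrary L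
  have h1 := (hs i k (π (cre s m) (Ω l))).hasSum.mapL
    (innerSL ℂ ((π (cre s j) (Ω l) : D) : H))
  refine ⟨_, HasSum.of_eq h1 fun n => ?_⟩
  rw [coeff_psMap, ← inner_rhoSigma_cre_vacuum ρ hπ l, innerSL_apply_apply, inner_smul_right]

theorem exists_hasSum_rhoRho_inv (hρ : ∀ x, ρ (star x) = (ρ x).conjTranspose) (hT : T.IsUnitary)
    (hπ : IsFockRep π Ω) [Nonempty L]
    (hs : ∀ i j (v : D), Summable fun n : ℕ => (h : ℂ) ^ n •
        ((π (rhoSigma s ρ i j (PowerSeries.coeff n T.F)) v : D) : H)) (i j k m : ι) :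
    ∃ r, HasSum (fun n : ℕ => (h : ℂ) ^ n *
      PowerSeries.coeff n (psMap (rhoRho ρ i j k m) T.Finv)) r := by
  obtain ⟨r, hr⟩ := exists_hasSum_rhoRho hπ hs k m i j
  refine ⟨_, HasSum.of_eq hr.star fun n => ?_⟩
  rw [← hT, coeff_psMap, coeff_psMap, coeff_psStar, ← star_rhoRho hρ, star_mul', star_pow]
  congr 2
  exact Complex.conj_ofReal h

theorem RPS_eq_sum (i j k m : ι) : RPS ρ T i j k m = ∑ p : ι × ι,
    psMap (rhoRho ρ j i p.2 p.1) T.F * psMap (rhoRho ρ p.1 p.2 k m) T.Finv := by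
  rw [RPS_eq, Twist.universalR_eq, psMap_mul_sum _ _ _ (rhoRho_mul ρ i j k m)]
  refine Finset.sum_congr rfl fun p _ => ?_
  congr 1
  ext n
  rw [coeff_psMap, coeff_psMap, ← rhoRho_flip, PowerSeries.coeff_map]
  exact congrArg _ (flip12_flip12 _)

theorem exists_hasSum_RPS (hρ : ∀ x, ρ (star x) = (ρ x).conjTranspose) (hT : T.IsUnitary)
    (hπ : IsFockRep π Ω) [Nonempty L]
    (hs : ∀ i j (v : D), Summable fun n : ℕ => (h : ℂ) ^ n •
        ((π (rhoSigma s ρ i j (PowerSeries.coeff n T.F)) v : D) : H)) (i j k m : ι) :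
    ∃ r, HasSum (fun n : ℕ => (h : ℂ) ^ n * PowerSeries.coeff n (RPS ρ T i j k m)) r := by
  choose f hf using fun p : ι × ι => exists_hasSum_rhoRho hπ hs j i p.2 p.1
  choose g hg using fun p : ι × ι => exists_hasSum_rhoRho_inv hρ hT hπ hs p.1 p.2 k m
  refine ⟨_, HasSum.of_eq
    (hasSum_sum fun p (_ : p ∈ Finset.univ) => hasSum_coeff_mul (hf p) (hg p)) fun n => ?_⟩
  rw [RPS_eq_sum, map_sum, Finset.mul_sum]

/-- The dressing matrices F⁻¹ and F meet in the middle and cancel, so the deformed number operator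
is the classical one and has the Fock monomials as eigenvectors. -/
theorem sum_crePS_mul_annPS (hρ : ∀ x, ρ (star x) = (ρ x).conjTranspose) (hT : T.IsUnitary) :
    ∑ i, crePS s ρ T i * annPS s ρ T i = PowerSeries.C (jordan s (1 : Matrix ι ι ℂ)) := by
  have h1 (l m : ι) : ∑ i, ent s ρ T.Finv l i * ent s ρ T.F i m =
      if l = m then (1 : PowerSeries (CAlg s ι)) else 0 := by
    rw [← ent_mul, T.inv_mul, ent_one]
  have h2 : jordan s (1 : Matrix ι ι ℂ) = ∑ l, cre s l * ann s l := by
    change ∑ i, ∑ j, (1 : Matrix ι ι ℂ) i j • (cre s i * ann s j) = _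
    simp [Matrix.one_apply]
  have h3 (i : ι) : crePS s ρ T i * annPS s ρ T i = ∑ l, ∑ m, PowerSeries.C (cre s l) *
      (ent s ρ T.Finv l i * ent s ρ T.F i m) * PowerSeries.C (ann s m) := by
    rw [crePS_eq, annPS_eq hρ hT, Finset.sum_mul_sum]
    simp only [mul_assoc]
  simp only [h3]
  rw [Finset.sum_comm]
  simp only [Finset.sum_comm (s := Finset.univ (α := ι)) (t := Finset.univ (α := ι))
    (f := fun i m => _ * (ent s ρ T.Finv _ i * ent s ρ T.F i m) * _), ← Finset.sum_mul,
    ← Finset.mul_sum, h1]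
  simp [h2]

/-- The values at `h` of the deformed generators form a `*`-representation. -/
theorem exists_qcrStarRep (hρ : ∀ x, ρ (star x) = (ρ x).conjTranspose) (hT : T.IsUnitary)
    (hπ : IsFockRep π Ω) [Nonempty L]
    (hs : ∀ i j (v : D), Summable fun n : ℕ => (h : ℂ) ^ n •
        ((π (rhoSigma s ρ i j (PowerSeries.coeff n T.F)) v : D) : H)) :
    ∃ R : ι → ι → ι → ι → ℂ,
      (∀ i j k l, HasSum (fun n : ℕ => (h : ℂ) ^ n * PowerSeries.coeff n (RPS ρ T i j k l))
        (R i j k l)) ∧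
      ∃ B Bp : ι → Module.End ℂ D,
        (∀ i, IsValue π h (annPS s ρ T i) (fun v => (B i v : H))) ∧
        (∀ i, IsValue π h (crePS s ρ T i) (fun v => (Bp i v : H))) ∧
        IsQCRStarRep s.sgn s.sgn R (fun i => closedOp (B i)) (fun i => closedOp (Bp i)) D ∧
        ∀ α : PowerSeries (CAlg s ι), IsUnitaryPS α →
          ConvergesAt π h α → ConvergesAt π h (psStar α) →
          ∃ V : H ≃ₗᵢ[ℂ] H, IsValue π h α (fun v => V (v : H)) ∧
            IsQCRStarRep s.sgn s.sgn R (fun i => conj V (closedOp (B i)))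
              (fun i => conj V (closedOp (Bp i))) (D.map (V.toLinearEquiv : H →ₗ[ℂ] H)) := by
  choose R hR using exists_hasSum_RPS hρ hT hπ hs
  choose F hF using exists_evals_ent hπ hs
  choose G hG using exists_evals_ent_inv hρ hT hπ hs
  have hB (i : ι) : Evals π h (annPS s ρ T i) (∑ l, F i l * π (ann s l)) := by
    rw [annPS_eq hρ hT]
    exact Evals.sum _ fun l => (hF i l).mul (Evals.const _)
  have hBp (i : ι) : Evals π h (crePS s ρ T i) (∑ l, π (cre s l) * G l i) := by
    rw [crePS_eq]
    exact Evals.sum _ fun l => (Evals.const _).mul (hG l i)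
  have hadj (i : ι) : FormallyAdjoint (∑ l, F i l * π (ann s l)) (∑ l, π (cre s l) * G l i) :=
    (hB i).formallyAdjoint hπ.formallyAdjoint (by rw [psStar_annPS hρ hT]; exact hBp i)
  have hq := satisfiesQCR_of_evals (satisfiesQCR_formal (s := s) hρ hT) hR hB hBp
  have hN : ∑ i, (∑ l, π (cre s l) * G l i) * (∑ l, F i l * π (ann s l)) = π (jordan s 1) := by
    refine (Evals.sum _ fun i => (hBp i).mul (hB i)).unique ?_
    rw [sum_crePS_mul_annPS hρ hT]
    exact Evals.const _
  have heig : ∀ v ∈ Set.range fun p : List ι × L => π (p.1.map (cre s)).prod (Ω p.2),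
      ∃ c : ℝ, (∑ i, (∑ l, π (cre s l) * G l i) * (∑ l, F i l * π (ann s l))) v =
        (c : ℂ) • v := by
    rintro _ ⟨⟨w, l⟩, rfl⟩
    rw [hN]
    exact ⟨_, number_monomial hπ l w⟩
  refine ⟨R, hR, _, _, fun i => (hB i).2, fun i => (hBp i).2,
    isQCRStarRep_closedOp hπ.dense hadj hq hπ.span heig, fun α hu hα hα' => ?_⟩
  obtain ⟨V, hV⟩ := exists_unitary_value hπ.dense hπ.formallyAdjoint hu hα hα'
  exact ⟨V, hV, isQCRStarRep_conj V hπ.dense hadj hq hπ.span heig⟩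

end TwistedFock

/-! ### Occupation numbers -/

section Generators
set_option linter.unusedSectionVars false
variable {H : Type*} [NormedAddCommGroup H] [InnerProductSpace ℂ H] {D : Submodule ℂ H}
  {s : Stat} {ι : Type*} [Fintype ι] [DecidableEq ι] (π : CAlg s ι →ₐ[ℂ] Module.End ℂ D)

theorem ann_ann_apply (i j : ι) (v : D) :
    π (ann s i) (π (ann s j) v) = s.sgn • π (ann s j) (π (ann s i) v) := by
  simpa [Module.End.mul_apply] using congrArg (fun x => π x v) (ann_mul_ann s i j)

theorem cre_cre_apply (i j : ι) (v : D) :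
    π (cre s i) (π (cre s j) v) = s.sgn • π (cre s j) (π (cre s i) v) := by
  simpa [Module.End.mul_apply] using congrArg (fun x => π x v) (cre_mul_cre s i j)

theorem ann_cre_apply (i j : ι) (v : D) : π (ann s i) (π (cre s j) v) =
    (if i = j then v else 0) + s.sgn • π (cre s j) (π (ann s i) v) := by
  have := congrArg (fun x => π x v) (ann_mul_cre s i j)
  split_ifs with h <;> simpa [Module.End.mul_apply, h] using this

theorem number_cre (k i : ι) (v : D) : π (cre s k) (π (ann s k) (π (cre s i) v)) =
    (if k = i then π (cre s i) v else 0) + π (cre s i) (π (cre s k) (π (ann s k) v)) := by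
  rw [ann_cre_apply, map_add, map_smul, cre_cre_apply π k i, smul_smul, Stat.sgn_mul_sgn, one_smul]
  split_ifs with h <;> simp [h]

theorem number_ann (k i : ι) (v : D) : π (cre s k) (π (ann s k) (π (ann s i) v)) =
    π (ann s i) (π (cre s k) (π (ann s k) v)) - if k = i then π (ann s i) v else 0 := by
  rw [ann_cre_apply, ann_ann_apply π i k, map_smul, smul_smul, Stat.sgn_mul_sgn, one_smul]
  split_ifs with h h' h'
  · simp [h]
  · exact absurd h.symm h'
  · exact absurd h'.symm h
  · simp

end Generators

section Occupation
set_option linter.unusedSectionVars false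
variable {H : Type*} [NormedAddCommGroup H] [InnerProductSpace ℂ H] {D : Submodule ℂ H}
  {s : Stat} (π : CAlg s (Fin 2) →ₐ[ℂ] Module.End ℂ D)

/-- `v` has `m` quanta in the mode `↑` and `n` in the mode `↓`. -/
def IsOcc (m n : ℕ) (v : D) : Prop :=
  π (cre s 0) (π (ann s 0) v) = (m : ℂ) • v ∧ π (cre s 1) (π (ann s 1) v) = (n : ℂ) • v

variable {π} {m n m' n' : ℕ} {v w : D}

theorem IsOcc.smul (hv : IsOcc π m n v) (c : ℂ) : IsOcc π m n (c • v) := by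
  constructor <;> simp [hv.1, hv.2, smul_comm c]

theorem IsOcc.cre0 (hv : IsOcc π m n v) : IsOcc π (m + 1) n (π (cre s 0) v) := by
  constructor
  · rw [number_cre, hv.1]; simp [add_smul, add_comm]
  · rw [number_cre, hv.2]; simp

theorem IsOcc.cre1 (hv : IsOcc π m n v) : IsOcc π m (n + 1) (π (cre s 1) v) := by
  constructor
  · rw [number_cre, hv.1]; simp
  · rw [number_cre, hv.2]; simp [add_smul, add_comm]

theorem IsOcc.ann0 (hv : IsOcc π (m + 1) n v) : IsOcc π m n (π (ann s 0) v) := by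
  constructor
  · rw [number_ann, hv.1]; simp [add_smul]
  · rw [number_ann, hv.2]; simp

theorem IsOcc.ann1 (hv : IsOcc π m (n + 1) v) : IsOcc π m n (π (ann s 1) v) := by
  constructor
  · rw [number_ann, hv.1]; simp
  · rw [number_ann, hv.2]; simp [add_smul]

variable {L : Type*} {Ω : L → D}

/-- Positivity: ‖a v‖² = ⟨v, a^+ a v⟩. -/
theorem IsFockRep.ann_eq_zero (hπ : IsFockRep π Ω) {i : Fin 2}
    (hv : π (cre s i) (π (ann s i) v) = 0) : π (ann s i) v = 0 := by
  have h := hπ.adjoint i v (π (ann s i) v)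
  rw [hv, Submodule.coe_zero, inner_zero_right, inner_self_eq_zero] at h
  exact Subtype.ext h

theorem IsOcc.ann0_zero (hv : IsOcc π 0 n v) (hπ : IsFockRep π Ω) : π (ann s 0) v = 0 :=
  hπ.ann_eq_zero (by rw [hv.1]; simp)

theorem IsOcc.ann1_zero (hv : IsOcc π m 0 v) (hπ : IsFockRep π Ω) : π (ann s 1) v = 0 :=
  hπ.ann_eq_zero (by rw [hv.2]; simp)

/-- Vectors with different occupation numbers are orthogonal. -/
theorem IsOcc.inner_eq_zero (hv : IsOcc π m n v) (hw : IsOcc π m' n' w) (hπ : IsFockRep π Ω)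
    (h : ¬(m = m' ∧ n = n')) : inner ℂ (v : H) (w : H) = 0 := by
  have hsym (i : Fin 2) (x y : D) : inner ℂ ((π (cre s i) (π (ann s i) x) : D) : H) (y : H) =
      inner ℂ (x : H) ((π (cre s i) (π (ann s i) y) : D) : H) := by
    rw [← hπ.adjoint, ← inner_conj_symm, ← hπ.adjoint, inner_conj_symm]
  have key (i : Fin 2) (a b : ℕ) (h1 : π (cre s i) (π (ann s i) v) = (a : ℂ) • v)
      (h2 : π (cre s i) (π (ann s i) w) = (b : ℂ) • w) (hab : a ≠ b) :
      inner ℂ (v : H) (w : H) = 0 := by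
    have h3 := hsym i v w
    rw [h1, h2, Submodule.coe_smul, Submodule.coe_smul, inner_smul_left, inner_smul_right,
      Complex.conj_natCast] at h3
    have h4 : ((a : ℂ) - b) * inner ℂ (v : H) (w : H) = 0 := by rw [sub_mul, h3, sub_self]
    refine (mul_eq_zero.1 h4).resolve_left ?_
    rw [sub_eq_zero]
    exact_mod_cast hab
  by_cases hm : m = m'
  · exact key 1 n n' hv.2 hw.2 fun hn => h ⟨hm, hn⟩
  · exact key 0 m m' hv.1 hw.1 hm

theorem isOcc_monomial (hπ : IsFockRep π Ω) (l : L) (w : List (Fin 2)) :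
    IsOcc π (w.count 0) (w.count 1) (π (w.map (cre s)).prod (Ω l)) := by
  induction w with
  | nil => constructor <;> simp [hπ.vacuum]
  | cons i w ih =>
    rw [List.map_cons, List.prod_cons, map_mul, Module.End.mul_apply]
    fin_cases i
    · simpa using ih.cre0
    · simpa using ih.cre1

theorem span_isOcc (hπ : IsFockRep π Ω) : Submodule.span ℂ {v | ∃ m n, IsOcc π m n v} = ⊤ := by
  rw [← top_le_iff, ← hπ.span]
  refine Submodule.span_mono ?_
  rintro _ ⟨⟨w, l⟩, rfl⟩
  exact ⟨_, _, isOcc_monomial hπ l w⟩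

theorem ext_isOcc (hπ : IsFockRep π Ω) {T S : Module.End ℂ D}
    (h : ∀ m n v, IsOcc π m n v → T v = S v) : T = S :=
  LinearMap.ext_on (span_isOcc hπ) fun v ⟨m, n, hv⟩ => h m n v hv

theorem formallyAdjoint_of_isOcc (hπ : IsFockRep π Ω) {T S : Module.End ℂ D}
    (h : ∀ m n v m' n' w, IsOcc π m n v → IsOcc π m' n' w →
      inner ℂ (T v : H) (w : H) = inner ℂ (v : H) (S w : H)) : FormallyAdjoint T S := by
  intro x y
  have hx : x ∈ Submodule.span ℂ {v | ∃ m n, IsOcc π m n v} := by rw [span_isOcc hπ]; trivial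
  have hy : y ∈ Submodule.span ℂ {v | ∃ m n, IsOcc π m n v} := by rw [span_isOcc hπ]; trivial
  induction hx using Submodule.span_induction with
  | mem x hx =>
    obtain ⟨m, n, hx⟩ := hx
    induction hy using Submodule.span_induction with
    | mem y hy =>
      obtain ⟨m', n', hy⟩ := hy
      exact h m n x m' n' y hx hy
    | zero => simp
    | add y y' _ _ h1 h2 => simp [h1, h2]
    | smul c y _ h1 => simp [h1]
  | zero => simp
  | add x x' _ _ h1 h2 => simp [h1, h2]
  | smul c x _ h1 => simp [h1]

/-- `T` is defined to be diagonal in a basis of joint eigenvectors. A joint eigenvector `v` outside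
the basis has nonzero coordinates only at basis vectors with the same occupation numbers, so `T`
multiplies it by the same value. -/
theorem exists_isNumFun (hπ : IsFockRep π Ω) (φ : ℕ → ℕ → ℝ) : ∃ T, IsNumFun π φ T := by
  let e := Module.Basis.ofSpan (span_isOcc hπ).ge
  have he (k) : ∃ m n, IsOcc π m n (e k) :=
    Module.Basis.ofSpan_subset (span_isOcc hπ).ge ⟨k, rfl⟩
  choose a b hab using he
  have hrepr (i : Fin 2) (c : _ → ℕ) (hc : ∀ k, π (cre s i) (π (ann s i) (e k)) = (c k : ℂ) • e k)
      (v : D) (k) : e.repr (π (cre s i) (π (ann s i) v)) k = c k * e.repr v k := by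
    have : (e.coord k) ∘ₗ (π (cre s i) * π (ann s i)) = (c k : ℂ) • e.coord k := by
      refine e.ext fun k' => ?_
      simp only [LinearMap.comp_apply, Module.End.mul_apply, hc, map_smul, LinearMap.smul_apply,
        Module.Basis.coord_apply, Module.Basis.repr_self]
      by_cases hk : k' = k
      · rw [hk]
      · simp [Finsupp.single_eq_of_ne (Ne.symm hk)]
    exact LinearMap.congr_fun this v
  refine ⟨e.constr ℂ fun k => ((φ (a k) (b k) : ℝ) : ℂ) • e k, fun m n v h0 h1 => ?_⟩
  rw [map_mul, Module.End.mul_apply] at h0 h1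
  refine e.repr.injective (Finsupp.ext fun k => ?_)
  have hT : e.repr (e.constr ℂ (fun k => ((φ (a k) (b k) : ℝ) : ℂ) • e k) v) k =
      ((φ (a k) (b k) : ℝ) : ℂ) * e.repr v k := by
    have : (e.coord k) ∘ₗ (e.constr ℂ fun k => ((φ (a k) (b k) : ℝ) : ℂ) • e k) =
        ((φ (a k) (b k) : ℝ) : ℂ) • e.coord k := by
      refine e.ext fun k' => ?_
      simp only [LinearMap.comp_apply, Module.Basis.constr_basis, map_smul, LinearMap.smul_apply,
        Module.Basis.coord_apply, Module.Basis.repr_self]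
      by_cases hk : k' = k
      · rw [hk]
      · simp [Finsupp.single_eq_of_ne (Ne.symm hk)]
    exact LinearMap.congr_fun this v
  rw [hT, map_smul, Finsupp.smul_apply, smul_eq_mul]
  by_cases hz : e.repr v k = 0
  · rw [hz, mul_zero, mul_zero]
  have e0 := hrepr 0 a (fun k => (hab k).1) v k
  have e1 := hrepr 1 b (fun k => (hab k).2) v k
  rw [h0, map_smul, Finsupp.smul_apply, smul_eq_mul] at e0
  rw [h1, map_smul, Finsupp.smul_apply, smul_eq_mul] at e1
  have e2 : m = a k := by exact_mod_cast mul_right_cancel₀ hz e0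
  have e3 : n = b k := by exact_mod_cast mul_right_cancel₀ hz e1
  rw [e2, e3]

theorem IsOcc.numFun_apply (hv : IsOcc π m n v) (hπ : IsFockRep π Ω) (φ : ℕ → ℕ → ℝ) :
    numFun π φ v = ((φ m n : ℝ) : ℂ) • v := by
  have h := exists_isNumFun hπ φ
  rw [numFun, dif_pos h]
  exact h.choose_spec m n v (by rw [map_mul]; exact hv.1) (by rw [map_mul]; exact hv.2)

end Occupation

/-! ### `q`-numbers -/

theorem qnum_zero (z : ℝ) : qnum z 0 = 0 := by simp [qnum]

theorem qnum_one (z : ℝ) : qnum z 1 = 1 := by simp [qnum]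

theorem qnum_succ' (z : ℝ) (n : ℕ) : qnum z (n + 1) = 1 + z * qnum z n := by
  rw [qnum, Finset.sum_range_succ', pow_zero, add_comm, qnum, Finset.mul_sum]
  simp only [pow_succ']

theorem qnum_nonneg {z : ℝ} (hz : 0 ≤ z) (n : ℕ) : 0 ≤ qnum z n :=
  Finset.sum_nonneg fun _ _ => pow_nonneg hz _

theorem qnum_succ_pos {z : ℝ} (hz : 0 ≤ z) (n : ℕ) : 0 < qnum z (n + 1) := by
  rw [qnum_succ']
  have := mul_nonneg hz (qnum_nonneg hz n)
  linarith

theorem mul_qnum (z : ℝ) (n : ℕ) : (z - 1) * qnum z n = z ^ n - 1 := by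
  rw [mul_comm]
  exact geom_sum_mul z n

theorem qsym_natCast_succ {q : ℝ} (hq : 0 < q) (n : ℕ) :
    q ^ n * qsym q ((n : ℝ) + 1) = qnum (q ^ 2) (n + 1) := by
  by_cases h : q = 1
  · subst h
    simp [qsym, qnum]
  have h1 : q ^ 2 - 1 ≠ 0 := by
    rw [sub_ne_zero]
    exact fun h2 => h ((pow_eq_one_iff_of_nonneg hq.le two_ne_zero).1 h2)
  have h2 : q - q⁻¹ = (q ^ 2 - 1) / q := by field_simp
  have h3 : q ^ ((n : ℝ) + 1) = q ^ (n + 1) := by exact_mod_cast Real.rpow_natCast q (n + 1)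
  rw [qsym, if_neg h, Real.rpow_neg hq.le, h3, h2]
  have h4 := mul_qnum (q ^ 2) (n + 1)
  have h5 : qnum (q ^ 2) (n + 1) = ((q ^ 2) ^ (n + 1) - 1) / (q ^ 2 - 1) := by
    rw [← h4, mul_div_cancel_left₀ _ h1]
  rw [h5]
  field_simp
  ring

theorem sqrt_mul_eq_mul_sqrt_div {x : ℝ} (hx : 0 ≤ x) (y : ℝ) : √(x * y) = x * √(y / x) := by
  rcases hx.eq_or_lt with rfl | hx
  · simp
  rw [show x * y = x ^ 2 * (y / x) by field_simp, Real.sqrt_mul (by positivity),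
    Real.sqrt_sq hx.le]

/-- With x = 1 + j + j₀, y = j - j₀ and √(x[x]) = x√([x]/x), both a and b are combinations of
√([x]/x) and √([y]/y). In a + y b the second root cancels and the first gets the coefficient x + y =
1 + 2j. At y = 0 the convention 0/0 = 0 is harmless, since the factor y is present. -/
theorem aFun_add_mul_bFun {q j j₀ : ℝ} (hx : 0 < 1 + j + j₀) (hy : 0 ≤ j - j₀) :
    aFun q j j₀ + (j - j₀) * bFun q j j₀ = q ^ ((j - j₀) / 2) *
      (√((1 + 2 * j) / qsym q (1 + 2 * j)) * √(qsym q (1 + j + j₀) / (1 + j + j₀))) := by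
  have hs : 0 < 1 + 2 * j := by linarith
  rw [aFun, bFun, sqrt_mul_eq_mul_sqrt_div hx.le, sqrt_mul_eq_mul_sqrt_div hy,
    sqrt_mul_eq_mul_sqrt_div hs.le, ← inv_div (qsym q (1 + 2 * j)), Real.sqrt_inv,
    div_eq_mul_inv, mul_inv]
  have h1 := mul_inv_cancel₀ hs.ne'
  linear_combination q ^ ((j - j₀) / 2) * (√(qsym q (1 + 2 * j) / (1 + 2 * j)))⁻¹ *
    √(qsym q (1 + j + j₀) / (1 + j + j₀)) * h1

/-- The complementary combination a - x b, in which the first root cancels instead. -/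
theorem aFun_sub_mul_bFun {q j j₀ : ℝ} (hx : 0 ≤ 1 + j + j₀) (hy : 0 < j - j₀) :
    aFun q j j₀ - (1 + j + j₀) * bFun q j j₀ = q ^ ((j - j₀) / 2) * q ^ (-(1 + 2 * j) / 2) *
      (√((1 + 2 * j) / qsym q (1 + 2 * j)) * √(qsym q (j - j₀) / (j - j₀))) := by
  have hs : 0 < 1 + 2 * j := by linarith
  rw [aFun, bFun, sqrt_mul_eq_mul_sqrt_div hx, sqrt_mul_eq_mul_sqrt_div hy.le,
    sqrt_mul_eq_mul_sqrt_div hs.le, ← inv_div (qsym q (1 + 2 * j)), Real.sqrt_inv,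
    div_eq_mul_inv, mul_inv]
  have h1 := mul_inv_cancel₀ hs.ne'
  linear_combination q ^ ((j - j₀) / 2) * q ^ (-(1 + 2 * j) / 2) *
    (√(qsym q (1 + 2 * j) / (1 + 2 * j)))⁻¹ * √(qsym q (j - j₀) / (j - j₀)) * h1

theorem qsym_natCast_succ_pos {q : ℝ} (hq : 0 < q) (n : ℕ) : 0 < qsym q ((n : ℝ) + 1) := by
  have h1 := qnum_succ_pos (z := q ^ 2) (by positivity) n
  rw [← qsym_natCast_succ hq] at h1
  exact pos_of_mul_pos_right h1 (by positivity)

theorem sqrt_qnum_mul_sqrt_qsym {q : ℝ} (hq : 0 < q) (n : ℕ) :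
    √(qnum (q ^ 2) (n + 1) / ((n : ℝ) + 1)) * √(((n : ℝ) + 1) / qsym q ((n : ℝ) + 1)) =
      √(q ^ n) := by
  have h := qsym_natCast_succ_pos hq n
  rw [← qsym_natCast_succ hq, ← Real.sqrt_mul (by positivity)]
  congr 1
  field_simp

theorem rpow_half {q : ℝ} (hq : 0 < q) (n : ℕ) : q ^ ((n : ℝ) / 2) = √(q ^ n) := by
  rw [Real.sqrt_eq_rpow, ← Real.rpow_natCast, ← Real.rpow_mul hq.le]
  congr 1
  ring

/-- The factor of the mode `↑` (Bose statistics). -/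
theorem bose_coeff_up {q : ℝ} (hq : 0 < q) (m n : ℕ) :
    √(qnum (q ^ 2) (m + n + 1) / ((m : ℝ) + n + 1)) *
      (aFun q (((m : ℝ) + n) / 2) (((m : ℝ) - n) / 2) +
        n * bFun q (((m : ℝ) + n) / 2) (((m : ℝ) - n) / 2)) =
      q ^ n * √(qnum (q ^ 2) (m + 1) / ((m : ℝ) + 1)) := by
  have e1 : ((m : ℝ) + n) / 2 - ((m : ℝ) - n) / 2 = n := by ring
  have e2 : 1 + ((m : ℝ) + n) / 2 + ((m : ℝ) - n) / 2 = m + 1 := by ring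
  have e3 : 1 + 2 * (((m : ℝ) + n) / 2) = ((m + n : ℕ) : ℝ) + 1 := by push_cast; ring
  have e4 : (m : ℝ) + n + 1 = ((m + n : ℕ) : ℝ) + 1 := by push_cast; ring
  have h := aFun_add_mul_bFun (q := q) (j := ((m : ℝ) + n) / 2) (j₀ := ((m : ℝ) - n) / 2)
    (by rw [e2]; positivity) (by rw [e1]; positivity)
  rw [e1, e2, e3] at h
  rw [h, e4, mul_left_comm, ← mul_assoc (√_), sqrt_qnum_mul_sqrt_qsym hq, rpow_half hq,
    ← qsym_natCast_succ hq m, pow_add, Real.sqrt_mul (by positivity), mul_div_assoc,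
    Real.sqrt_mul (by positivity) (_ / _)]
  nth_rewrite 3 [← Real.sq_sqrt (show 0 ≤ q ^ n by positivity)]
  ring

/-- The factor of the mode `↓` (Bose statistics). -/
theorem bose_coeff_down {q : ℝ} (hq : 0 < q) (m n : ℕ) :
    √(qnum (q ^ 2) (m + n + 1) / ((m : ℝ) + n + 1)) *
      (aFun q (((m : ℝ) + n) / 2) (((m : ℝ) - n) / 2 - 1) -
        m * bFun q (((m : ℝ) + n) / 2) (((m : ℝ) - n) / 2 - 1)) =
      √(qnum (q ^ 2) (n + 1) / ((n : ℝ) + 1)) := by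
  have e1 : ((m : ℝ) + n) / 2 - (((m : ℝ) - n) / 2 - 1) = n + 1 := by ring
  have e2 : 1 + ((m : ℝ) + n) / 2 + (((m : ℝ) - n) / 2 - 1) = m := by ring
  have e3 : 1 + 2 * (((m : ℝ) + n) / 2) = ((m + n : ℕ) : ℝ) + 1 := by push_cast; ring
  have e4 : (m : ℝ) + n + 1 = ((m + n : ℕ) : ℝ) + 1 := by push_cast; ring
  have h := aFun_sub_mul_bFun (q := q) (j := ((m : ℝ) + n) / 2) (j₀ := ((m : ℝ) - n) / 2 - 1)
    (by rw [e2]; positivity) (by rw [e1]; positivity)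
  rw [e1, e2, e3] at h
  have e5 : q ^ (((n : ℝ) + 1) / 2) * q ^ (-(((m + n : ℕ) : ℝ) + 1) / 2) = (√(q ^ m))⁻¹ := by
    rw [← Real.rpow_add hq, ← rpow_half hq, ← Real.rpow_neg hq.le]
    congr 1
    push_cast
    ring
  have e6 : √(q ^ m) ≠ 0 := (Real.sqrt_pos.2 (by positivity)).ne'
  rw [h, e4, e5, mul_left_comm, ← mul_assoc (√_), sqrt_qnum_mul_sqrt_qsym hq,
    ← qsym_natCast_succ hq n, pow_add, Real.sqrt_mul (by positivity), mul_div_assoc,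
    Real.sqrt_mul (by positivity) (_ / _)]
  field_simp

/-- Since [2]_q = q + q⁻¹, the normalization g(1) and the prefactor of a and b at spin 1/2 multiply
to 1/2; this settles the one-particle fermionic states. -/
theorem fermi_sqrt {q : ℝ} (hq : 0 < q) :
    √((1 + (q ^ 2)⁻¹) / 2) * (q ^ (1 / 2 : ℝ) / √(2 * qsym q 2)) = 2⁻¹ := by
  have h2 : qsym q 2 = q + q⁻¹ := by
    have := qsym_natCast_succ hq 1
    norm_num [qnum, Finset.sum_range_succ] at this
    rw [show (2 : ℝ) = 1 + 1 by norm_num] at this ⊢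
    field_simp
    rw [mul_comm] at this
    norm_num at this ⊢
    linarith
  rw [h2, ← Real.sqrt_eq_rpow, ← Real.sqrt_div hq.le, ← Real.sqrt_mul (by positivity)]
  rw [show (1 + (q ^ 2)⁻¹) / 2 * (q / (2 * (q + q⁻¹))) = (2⁻¹) ^ 2 by field_simp]
  exact Real.sqrt_sq (by norm_num)

/-! ### Action of the deformed generators on vectors with given occupation numbers -/

/-- The square root of the base of the `q`-numbers. -/
noncomputable def Stat.root : Stat → ℝ → ℝ
  | .bose, q => q
  | .fermi, q => q⁻¹

theorem Stat.base_eq (s : Stat) (q : ℝ) : s.base q = s.root q ^ 2 := by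
  cases s <;> simp [Stat.base, Stat.root]

theorem Stat.root_pos (s : Stat) {q : ℝ} (hq : 0 < q) : 0 < s.root q := by
  cases s
  · exact hq
  · exact inv_pos.2 hq

/-- `√((k)_z / k)`. -/
noncomputable def modeFactor (s : Stat) (q : ℝ) (k : ℕ) : ℝ := √(qnum (s.base q) k / k)

theorem modeFactor_sq_mul (s : Stat) {q : ℝ} (k : ℕ) :
    modeFactor s q k ^ 2 * k = qnum (s.base q) k := by
  have hb : 0 ≤ s.base q := by rw [s.base_eq]; positivity
  rw [modeFactor, Real.sq_sqrt (div_nonneg (qnum_nonneg hb k) (by positivity))]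
  rcases eq_or_ne k 0 with rfl | hk
  · simp [qnum_zero]
  · field_simp

/-- The coefficient of `a^+_↑` in `Ã^+_↑` at occupation numbers `m`, `n`. -/
noncomputable def upCoeff (s : Stat) (q : ℝ) (m n : ℕ) : ℂ :=
  (√(qnum (s.base q) (m + n + 1) / ((m : ℝ) + n + 1)) : ℝ) *
    ((aFun q (s.spin m n) (((m : ℝ) - n) / 2 - 0) : ℝ) +
      s.sgn * n * (bFun q (s.spin m n) (((m : ℝ) - n) / 2) : ℝ))

/-- The coefficient of `a^+_↓` in `Ã^+_↓` at occupation numbers `m`, `n`. -/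
noncomputable def downCoeff (s : Stat) (q : ℝ) (m n : ℕ) : ℂ :=
  (√(qnum (s.base q) (m + n + 1) / ((m : ℝ) + n + 1)) : ℝ) *
    ((aFun q (s.spin m n) (((m : ℝ) - n) / 2 - 1) : ℝ) -
      s.sgn * m * (bFun q (s.spin (m - 1) (n + 1)) ((((m - 1 : ℕ) : ℝ) - (n + 1 : ℕ)) / 2) : ℝ))

theorem upCoeff_bose {q : ℝ} (hq : 0 < q) (m n : ℕ) :
    upCoeff .bose q m n = ((q ^ n * modeFactor .bose q (m + 1) : ℝ) : ℂ) := by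
  have h := bose_coeff_up hq m n
  rw [modeFactor, Stat.base, Nat.cast_add m 1, Nat.cast_one, ← h, upCoeff, Stat.sgn, Stat.base,
    Stat.spin, sub_zero]
  push_cast
  ring

theorem downCoeff_bose {q : ℝ} (hq : 0 < q) (m n : ℕ) :
    downCoeff .bose q m n = ((modeFactor .bose q (n + 1) : ℝ) : ℂ) := by
  have h := bose_coeff_down hq m n
  rw [modeFactor, Stat.base, Nat.cast_add n 1, Nat.cast_one, ← h, downCoeff, Stat.sgn, Stat.base,
    Stat.spin, Stat.spin]
  -- For m = 0 the truncated m - 1 in `downCoeff` does not matter, because that term carries the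
  -- factor m.
  rcases m with _ | m
  · push_cast
    simp
  · have e1 : (((m + 1 - 1 : ℕ) : ℝ) + (n + 1 : ℕ)) / 2 = (((m + 1 : ℕ) : ℝ) + n) / 2 := by
      rw [Nat.add_sub_cancel]; push_cast; ring
    have e2 : (((m + 1 - 1 : ℕ) : ℝ) - (n + 1 : ℕ)) / 2 = (((m + 1 : ℕ) : ℝ) - n) / 2 - 1 := by
      rw [Nat.add_sub_cancel]; push_cast; ring
    rw [e1, e2]
    push_cast
    ring

theorem qsym_zero (q : ℝ) : qsym q 0 = 0 := by simp [qsym]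

theorem qsym_one {q : ℝ} (hq : 0 < q) : qsym q 1 = 1 := by
  simpa [qnum_one] using qsym_natCast_succ hq 0

theorem aFun_zero_zero {q : ℝ} (hq : 0 < q) : aFun q 0 0 = 1 := by
  simp [aFun, qsym_one hq, qsym_zero]

theorem aFun_zero_neg_one {q : ℝ} (hq : 0 < q) : aFun q 0 (-1) = 1 := by
  have : q ^ (1 / 2 : ℝ) * q ^ (-1 / 2 : ℝ) = 1 := by
    rw [← Real.rpow_add hq]; norm_num
  simpa [aFun, qsym_one hq, qsym_zero] using this

theorem aFun_half {q : ℝ} (hq : 0 < q) :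
    aFun q (1 / 2) (-(1 / 2)) = q ^ (1 / 2 : ℝ) / √(2 * qsym q 2) * (1 + q⁻¹) := by
  rw [aFun]
  norm_num [qsym_one hq, Real.rpow_neg_one]

theorem bFun_half {q : ℝ} (hq : 0 < q) :
    bFun q (1 / 2) (-(1 / 2)) = q ^ (1 / 2 : ℝ) / √(2 * qsym q 2) * (1 - q⁻¹) := by
  rw [bFun]
  norm_num [qsym_one hq, Real.rpow_neg_one]

theorem qnum_two (z : ℝ) : qnum z 2 = 1 + z := by
  rw [qnum_succ', qnum_one, mul_one]

theorem modeFactor_one (s : Stat) (q : ℝ) : modeFactor s q 1 = 1 := by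
  simp [modeFactor, qnum_one]

/-- Only m = 0 and n ≤ 1 matter: at m = 1 the creator a^+_↑ gives zero, whatever its coefficient. -/
theorem upCoeff_fermi {q : ℝ} (hq : 0 < q) {n : ℕ} (hn : n ≤ 1) :
    upCoeff .fermi q 0 n = ((q⁻¹ ^ n : ℝ) : ℂ) := by
  have h := fermi_sqrt hq
  interval_cases n
  · norm_num [upCoeff, Stat.spin, aFun_zero_zero hq, qnum_one]
  · have e1 : Stat.spin .fermi 0 1 = 1 / 2 := by norm_num [Stat.spin]
    have e2 : (((0 : ℕ) : ℝ) - (1 : ℕ)) / 2 = -(1 / 2) := by norm_num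
    have e3 : √((1 + (q ^ 2)⁻¹) / 2) * (q ^ (1 / 2 : ℝ) / √(2 * qsym q 2) * (1 + q⁻¹) -
        q ^ (1 / 2 : ℝ) / √(2 * qsym q 2) * (1 - q⁻¹)) = q⁻¹ := by
      linear_combination 2 * q⁻¹ * h
    have e4 : ((0 : ℕ) : ℝ) + (1 : ℕ) + 1 = 2 := by norm_num
    refine Eq.trans ?_ (congrArg Complex.ofReal (e3.trans (pow_one _).symm))
    rw [upCoeff, sub_zero, e1, e2, aFun_half hq, bFun_half hq, Stat.sgn, Stat.base, qnum_two, e4]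
    push_cast
    ring

theorem downCoeff_fermi {q : ℝ} (hq : 0 < q) {m : ℕ} (hm : m ≤ 1) :
    downCoeff .fermi q m 0 = 1 := by
  have h := fermi_sqrt hq
  interval_cases m
  · norm_num [downCoeff, Stat.spin, aFun_zero_neg_one hq, qnum_one]
  · have e1 : Stat.spin .fermi 1 0 = 1 / 2 := by norm_num [Stat.spin]
    have e1' : Stat.spin .fermi (1 - 1) (0 + 1) = 1 / 2 := by norm_num [Stat.spin]
    have e2 : (((1 - 1 : ℕ) : ℝ) - (0 + 1 : ℕ)) / 2 = -(1 / 2) := by norm_num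
    have e2' : (((1 : ℕ) : ℝ) - (0 : ℕ)) / 2 - 1 = -(1 / 2) := by norm_num
    have e3 : √((1 + (q ^ 2)⁻¹) / 2) * (q ^ (1 / 2 : ℝ) / √(2 * qsym q 2) * (1 + q⁻¹) +
        q ^ (1 / 2 : ℝ) / √(2 * qsym q 2) * (1 - q⁻¹)) = 1 := by
      linear_combination 2 * h
    have e4 : ((1 : ℕ) : ℝ) + (0 : ℕ) + 1 = 2 := by norm_num
    refine Eq.trans ?_ ((congrArg Complex.ofReal e3).trans Complex.ofReal_one)
    rw [downCoeff, e1, e1', e2, e2', aFun_half hq, bFun_half hq, Stat.sgn, Stat.base, qnum_two, e4]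
    push_cast
    ring

section Action
set_option linter.unusedSectionVars false
variable {H : Type*} [NormedAddCommGroup H] [InnerProductSpace ℂ H] {D : Submodule ℂ H}
  {s : Stat} {π : CAlg s (Fin 2) →ₐ[ℂ] Module.End ℂ D} {m n : ℕ} {v : D}
  {L : Type*} {Ω : L → D} {q : ℝ}

theorem su2Cre_zero_apply (q : ℝ) (v : D) : su2Cre π q 0 v =
    π (cre s 0) (aOp π q 0 (fOp π q v)) +
      π (cre s 1) (π (cre s 0) (π (ann s 1) (bOp π q (fOp π q v)))) := by
  simp [su2Cre, su2Finv, jPlus, Fin.sum_univ_two, Module.End.mul_apply]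

theorem su2Cre_one_apply (q : ℝ) (v : D) : su2Cre π q 1 v =
    -π (cre s 0) (bOp π q (π (cre s 1) (π (ann s 0) (fOp π q v)))) +
      π (cre s 1) (aOp π q 1 (fOp π q v)) := by
  simp [su2Cre, su2Finv, jMinus, Fin.sum_univ_two, Module.End.mul_apply]

theorem su2Ann_zero_apply (q : ℝ) (v : D) : su2Ann π q 0 v =
    fOp π q (aOp π q 0 (π (ann s 0) v) +
      bOp π q (π (cre s 1) (π (ann s 0) (π (ann s 1) v)))) := by
  simp [su2Ann, su2F, jMinus, Fin.sum_univ_two, Module.End.mul_apply]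

theorem su2Ann_one_apply (q : ℝ) (v : D) : su2Ann π q 1 v =
    fOp π q (-π (cre s 0) (π (ann s 1) (bOp π q (π (ann s 0) v))) +
      aOp π q 1 (π (ann s 1) v)) := by
  simp [su2Ann, su2F, jPlus, Fin.sum_univ_two, Module.End.mul_apply]

/-- In a^+_↓ j_+ b the two creators are exchanged at the cost of the sign, after which a^+_↓ a^↓
contributes n. -/
theorem IsOcc.su2Cre_zero (hv : IsOcc π m n v) (hπ : IsFockRep π Ω) :
    su2Cre π q 0 v = upCoeff s q m n • π (cre s 0) v := by
  rw [su2Cre_zero_apply, fOp, hv.numFun_apply hπ, aOp, bOp]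
  simp only [map_smul]
  rw [hv.numFun_apply hπ, hv.numFun_apply hπ]
  simp only [map_smul]
  rw [cre_cre_apply π 1 0, hv.2, map_smul, upCoeff]
  module

/-- Here b acts after j_-, hence on occupation numbers m - 1 and n + 1; this explains the shifted
arguments in `downCoeff`. -/
theorem IsOcc.su2Cre_one (hv : IsOcc π m n v) (hπ : IsFockRep π Ω) :
    su2Cre π q 1 v = downCoeff s q m n • π (cre s 1) v := by
  rw [su2Cre_one_apply, fOp, hv.numFun_apply hπ, aOp, bOp, downCoeff]
  simp only [map_smul]
  rw [hv.numFun_apply hπ]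
  rcases m with _ | m
  · rw [hv.ann0_zero hπ]
    simp only [map_zero, zero_add, map_smul, Nat.cast_zero]
    module
  · rw [hv.ann0.cre1.numFun_apply hπ]
    simp only [map_smul]
    rw [cre_cre_apply π 0 1, hv.1, map_smul, Nat.add_sub_cancel]
    module

theorem IsOcc.su2Ann_zero (hv : IsOcc π (m + 1) n v) (hπ : IsFockRep π Ω) :
    su2Ann π q 0 v = upCoeff s q m n • π (ann s 0) v := by
  rw [su2Ann_zero_apply, ann_ann_apply π 0 1, map_smul, hv.ann0.2, smul_smul, map_smul, aOp, bOp,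
    hv.ann0.numFun_apply hπ, hv.ann0.numFun_apply hπ, map_add, map_smul, map_smul, map_smul, fOp,
    hv.ann0.numFun_apply hπ, upCoeff]
  module

theorem IsOcc.su2Ann_zero_zero (hv : IsOcc π 0 n v) (hπ : IsFockRep π Ω) :
    su2Ann π q 0 v = 0 := by
  rw [su2Ann_zero_apply, ann_ann_apply π 0 1, hv.ann0_zero hπ]
  simp

theorem IsOcc.su2Ann_one (hv : IsOcc π m (n + 1) v) (hπ : IsFockRep π Ω) :
    su2Ann π q 1 v = downCoeff s q m n • π (ann s 1) v := by
  rw [su2Ann_one_apply, aOp, hv.ann1.numFun_apply hπ, downCoeff]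
  rcases m with _ | m
  · rw [hv.ann0_zero hπ]
    simp only [map_zero, neg_zero, zero_add, map_smul]
    rw [fOp, hv.ann1.numFun_apply hπ]
    simp only [Nat.cast_zero, Nat.zero_add]
    module
  · rw [bOp, hv.ann0.numFun_apply hπ]
    simp only [map_smul]
    rw [ann_ann_apply π 1 0, map_smul, hv.ann1.1, map_add, map_neg, map_smul, map_smul, map_smul,
      map_smul, fOp, hv.ann1.numFun_apply hπ, Nat.add_sub_cancel]
    module

theorem IsOcc.su2Ann_one_zero (hv : IsOcc π m 0 v) (hπ : IsFockRep π Ω) :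
    su2Ann π q 1 v = 0 := by
  rw [su2Ann_one_apply, hv.ann1_zero hπ]
  rcases m with _ | m
  · rw [hv.ann0_zero hπ]; simp
  · rw [bOp, hv.ann0.numFun_apply hπ, map_smul, ann_ann_apply π 1 0, hv.ann1_zero hπ]
    simp

end Action

/-! ### Occupation numbers for Fermi statistics. -/

section Fermi
set_option linter.unusedSectionVars false
variable {H : Type*} [NormedAddCommGroup H] [InnerProductSpace ℂ H] {D : Submodule ℂ H}
  {π : CAlg .fermi (Fin 2) →ₐ[ℂ] Module.End ℂ D} {m n : ℕ} {v : D}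

theorem fermi_cre_cre (i : Fin 2) (v : D) :
    π (cre .fermi i) (π (cre .fermi i) v) = 0 := by
  have h := cre_cre_apply π i i v
  rw [Stat.sgn, neg_one_smul] at h
  have h2 : (2 : ℂ) • π (cre .fermi i) (π (cre .fermi i) v) = 0 := by
    rw [two_smul]
    nth_rewrite 1 [h]
    exact neg_add_cancel _
  exact (smul_eq_zero.1 h2).resolve_left two_ne_zero

/-- The number operator of a fermionic mode is idempotent, so an eigenvalue k on a nonzero vector
satisfies k² = k. -/
theorem fermi_number_le_one (i : Fin 2) {k : ℕ}
    (h : π (cre .fermi i) (π (ann .fermi i) v) = (k : ℂ) • v) : v = 0 ∨ k ≤ 1 := by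
  have h1 : π (cre .fermi i) (π (ann .fermi i) (π (cre .fermi i) (π (ann .fermi i) v))) =
      π (cre .fermi i) (π (ann .fermi i) v) := by
    rw [ann_cre_apply, if_pos rfl, map_add, map_smul, fermi_cre_cre, smul_zero, add_zero]
  rw [h, map_smul, map_smul, h, smul_smul] at h1
  have h2 : ((k : ℂ) * k - k) • v = 0 := by rw [sub_smul, h1, sub_self]
  rcases smul_eq_zero.1 h2 with h3 | h3
  · right
    have h4 : k * k = k := by exact_mod_cast sub_eq_zero.1 h3
    rcases Nat.eq_zero_or_pos k with h5 | h5
    · omega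
    · exact (Nat.eq_of_mul_eq_mul_left h5 (by rw [h4, mul_one])).le
  · exact Or.inl h3

theorem fermi_cre_eq_zero (i : Fin 2)
    (h : π (cre .fermi i) (π (ann .fermi i) v) = v) : π (cre .fermi i) v = 0 := by
  rw [← h, fermi_cre_cre]

end Fermi

/-! ### Weights of the deformed generators, uniformly in the statistics. -/

section Action
set_option linter.unusedSectionVars false
variable {H : Type*} [NormedAddCommGroup H] [InnerProductSpace ℂ H] {D : Submodule ℂ H}
  {s : Stat} {π : CAlg s (Fin 2) →ₐ[ℂ] Module.End ℂ D} {m n : ℕ} {v : D}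
  {L : Type*} {Ω : L → D} {q : ℝ}

/-- Stated on vectors because for fermions the coefficients are compared only where a^+_↑ v can be
nonzero. -/
theorem IsOcc.upCoeff_smul (hv : IsOcc π m n v) (hq : 0 < q) :
    upCoeff s q m n • π (cre s 0) v =
      ((s.root q ^ n * modeFactor s q (m + 1) : ℝ) : ℂ) • π (cre s 0) v := by
  cases s with
  | bose => rw [upCoeff_bose hq]; rfl
  | fermi =>
    rcases fermi_number_le_one 0 hv.1 with rfl | hm
    · simp
    rcases fermi_number_le_one 1 hv.2 with rfl | hn
    · simp
    interval_cases m
    · rw [upCoeff_fermi hq hn, modeFactor_one, mul_one]; rfl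
    · rw [fermi_cre_eq_zero 0 (by simpa using hv.1)]; simp

theorem IsOcc.downCoeff_smul (hv : IsOcc π m n v) (hq : 0 < q) :
    downCoeff s q m n • π (cre s 1) v =
      ((modeFactor s q (n + 1) : ℝ) : ℂ) • π (cre s 1) v := by
  cases s with
  | bose => rw [downCoeff_bose hq]
  | fermi =>
    rcases fermi_number_le_one 0 hv.1 with rfl | hm
    · simp
    rcases fermi_number_le_one 1 hv.2 with rfl | hn
    · simp
    interval_cases n
    · rw [downCoeff_fermi hq hm, modeFactor_one, Complex.ofReal_one]
    · rw [fermi_cre_eq_zero 1 (by simpa using hv.2)]; simp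

/-- `Ã^+_↑` on a vector with occupation numbers `m`, `n`. -/
theorem IsOcc.cre_up (hv : IsOcc π m n v) (hπ : IsFockRep π Ω) (hq : 0 < q) :
    su2Cre π q 0 v = ((s.root q ^ n * modeFactor s q (m + 1) : ℝ) : ℂ) • π (cre s 0) v := by
  rw [hv.su2Cre_zero hπ, hv.upCoeff_smul hq]

theorem IsOcc.cre_down (hv : IsOcc π m n v) (hπ : IsFockRep π Ω) (hq : 0 < q) :
    su2Cre π q 1 v = ((modeFactor s q (n + 1) : ℝ) : ℂ) • π (cre s 1) v := by
  rw [hv.su2Cre_one hπ, hv.downCoeff_smul hq]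

theorem IsOcc.ann_up (hv : IsOcc π m n v) (hπ : IsFockRep π Ω) (hq : 0 < q) :
    su2Ann π q 0 v = ((s.root q ^ n * modeFactor s q m : ℝ) : ℂ) • π (ann s 0) v := by
  rcases m with _ | m
  · rw [hv.su2Ann_zero_zero hπ, hv.ann0_zero hπ, smul_zero]
  -- The comparison of coefficients is applied to a^↑ v, where a^+_↑ gives back (m + 1) v: either
  -- the coefficients agree or v = 0.
  have h1 := hv.ann0.upCoeff_smul hq
  rw [hv.1, smul_smul, smul_smul, ← sub_eq_zero, ← sub_smul, ← sub_mul] at h1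
  rw [hv.su2Ann_zero hπ, ← sub_eq_zero, ← sub_smul]
  rcases smul_eq_zero.1 h1 with h2 | h2
  · rw [(mul_eq_zero.1 h2).resolve_right (by exact_mod_cast Nat.succ_ne_zero m), zero_smul]
  · rw [h2, map_zero, smul_zero]

theorem IsOcc.ann_down (hv : IsOcc π m n v) (hπ : IsFockRep π Ω) (hq : 0 < q) :
    su2Ann π q 1 v = ((modeFactor s q n : ℝ) : ℂ) • π (ann s 1) v := by
  rcases n with _ | n
  · rw [hv.su2Ann_one_zero hπ, hv.ann1_zero hπ, smul_zero]
  have h1 := hv.ann1.downCoeff_smul hq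
  rw [hv.2, smul_smul, smul_smul, ← sub_eq_zero, ← sub_smul, ← sub_mul] at h1
  rw [hv.su2Ann_one hπ, ← sub_eq_zero, ← sub_smul]
  rcases smul_eq_zero.1 h1 with h2 | h2
  · rw [(mul_eq_zero.1 h2).resolve_right (by exact_mod_cast Nat.succ_ne_zero n), zero_smul]
  · rw [h2, map_zero, smul_zero]

end Action

/-! ### The quantum commutation relations for `U_h su(2)`. -/

section SU2Rep
set_option linter.unusedSectionVars false
variable {H : Type*} [NormedAddCommGroup H] [InnerProductSpace ℂ H] {D : Submodule ℂ H}
  {s : Stat} {π : CAlg s (Fin 2) →ₐ[ℂ] Module.End ℂ D} {m n : ℕ} {v : D}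
  {L : Type*} {Ω : L → D} {q : ℝ}

/-- The weights are real and match whenever the occupation numbers do; otherwise both sides vanish
by orthogonality. -/
theorem formallyAdjoint_su2 (hπ : IsFockRep π Ω) (hq : 0 < q) (i : Fin 2) :
    FormallyAdjoint (su2Ann π q i) (su2Cre π q i) := by
  refine formallyAdjoint_of_isOcc hπ fun m n v m' n' w hv hw => ?_
  fin_cases i
  · change inner ℂ (su2Ann π q 0 v : H) (w : H) = inner ℂ (v : H) (su2Cre π q 0 w : H)
    rw [hv.ann_up hπ hq, hw.cre_up hπ hq, Submodule.coe_smul, Submodule.coe_smul, inner_smul_left,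
      inner_smul_right, hπ.adjoint, Complex.conj_ofReal]
    by_cases h : m = m' + 1 ∧ n = n'
    · rw [h.1, h.2]
    · rw [hv.inner_eq_zero hw.cre0 hπ h, mul_zero, mul_zero]
  · change inner ℂ (su2Ann π q 1 v : H) (w : H) = inner ℂ (v : H) (su2Cre π q 1 w : H)
    rw [hv.ann_down hπ hq, hw.cre_down hπ hq, Submodule.coe_smul, Submodule.coe_smul,
      inner_smul_left, inner_smul_right, hπ.adjoint, Complex.conj_ofReal]
    by_cases h : m = m' ∧ n = n' + 1
    · rw [h.2]
    · rw [hv.inner_eq_zero hw.cre1 hπ h, mul_zero, mul_zero]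

/-- The eigenvalue of `Ã^+_↑ Ã^↑`. -/
theorem IsOcc.number_up (hv : IsOcc π m n v) (hπ : IsFockRep π Ω) (hq : 0 < q) :
    su2Cre π q 0 (su2Ann π q 0 v) =
      ((s.base q ^ n * qnum (s.base q) m : ℝ) : ℂ) • v := by
  rcases m with _ | m
  · rw [hv.ann_up hπ hq, hv.ann0_zero hπ, qnum_zero]; simp
  rw [hv.ann_up hπ hq, map_smul, hv.ann0.cre_up hπ hq, hv.1, smul_smul, smul_smul,
    ← modeFactor_sq_mul, s.base_eq]
  congr 1
  push_cast
  ring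

theorem IsOcc.number_down (hv : IsOcc π m n v) (hπ : IsFockRep π Ω) (hq : 0 < q) :
    su2Cre π q 1 (su2Ann π q 1 v) = ((qnum (s.base q) n : ℝ) : ℂ) • v := by
  rcases n with _ | n
  · rw [hv.ann_down hπ hq, hv.ann1_zero hπ, qnum_zero]; simp
  rw [hv.ann_down hπ hq, map_smul, hv.ann1.cre_down hπ hq, hv.2, smul_smul, smul_smul,
    ← modeFactor_sq_mul]
  congr 1
  push_cast
  ring

theorem IsOcc.ann_cre_up (hv : IsOcc π m n v) (hπ : IsFockRep π Ω) (hq : 0 < q) :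
    su2Ann π q 0 (su2Cre π q 0 v) =
      ((s.root q ^ n * modeFactor s q (m + 1) : ℝ) ^ 2 * (1 + s.sgn * m) : ℂ) • v := by
  rw [hv.cre_up hπ hq, map_smul, hv.cre0.ann_up hπ hq, ann_cre_apply, if_pos rfl, hv.1]
  module

theorem IsOcc.ann_cre_down (hv : IsOcc π m n v) (hπ : IsFockRep π Ω) (hq : 0 < q) :
    su2Ann π q 1 (su2Cre π q 1 v) =
      ((modeFactor s q (n + 1) : ℝ) ^ 2 * (1 + s.sgn * n) : ℂ) • v := by
  rw [hv.cre_down hπ hq, map_smul, hv.cre1.ann_down hπ hq, ann_cre_apply, if_pos rfl, hv.2]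
  module

theorem Stat.c₁_eq (s : Stat) (q : ℝ) : s.c₁ q = s.sgn * (s.root q : ℂ)⁻¹ := by
  cases s <;> simp [Stat.c₁, Stat.sgn, Stat.root]

theorem Stat.c₂_eq (s : Stat) (q : ℝ) : s.c₂ q = s.sgn * s.root q := by
  cases s <;> simp [Stat.c₂, Stat.sgn, Stat.root]

theorem Stat.root_ne_zero (s : Stat) (hq : 0 < q) : (s.root q : ℂ) ≠ 0 :=
  Complex.ofReal_ne_zero.2 (s.root_pos hq).ne'

/-- Ã^↑ carries the weight `root`^n and Ã^↓ lowers n by one, so interchanging them costs one power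
of `root`, besides the statistics sign. The other relations between different modes arise in the
same way. -/
theorem su2_ann_ann (hπ : IsFockRep π Ω) (hq : 0 < q) :
    su2Ann π q 0 * su2Ann π q 1 = s.c₁ q • (su2Ann π q 1 * su2Ann π q 0) := by
  refine ext_isOcc hπ fun m n v hv => ?_
  rw [LinearMap.smul_apply, Module.End.mul_apply, Module.End.mul_apply, hv.ann_up hπ hq,
    hv.ann_down hπ hq, map_smul, map_smul]
  rcases m with _ | m
  · rw [hv.ann0_zero hπ, map_zero]
    rcases n with _ | n
    · rw [hv.ann1_zero hπ]; simp
    · rw [hv.ann1.ann_up hπ hq, hv.ann1.ann0_zero hπ]; simp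
  rcases n with _ | n
  · rw [hv.ann1_zero hπ, map_zero, hv.ann0.ann_down hπ hq, hv.ann0.ann1_zero hπ]; simp
  rw [hv.ann1.ann_up hπ hq, hv.ann0.ann_down hπ hq, ann_ann_apply π 0 1, s.c₁_eq]
  simp only [smul_smul]
  congr 1
  have := s.root_ne_zero hq
  push_cast
  field_simp
  ring

theorem su2_cre_cre (hπ : IsFockRep π Ω) (hq : 0 < q) :
    su2Cre π q 1 * su2Cre π q 0 = s.c₁ q • (su2Cre π q 0 * su2Cre π q 1) := by
  refine ext_isOcc hπ fun m n v hv => ?_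
  rw [LinearMap.smul_apply, Module.End.mul_apply, Module.End.mul_apply, hv.cre_up hπ hq,
    hv.cre_down hπ hq, map_smul, map_smul, hv.cre1.cre_up hπ hq, hv.cre0.cre_down hπ hq,
    cre_cre_apply π 1 0, s.c₁_eq]
  simp only [smul_smul]
  congr 1
  have := s.root_ne_zero hq
  push_cast
  field_simp
  ring

theorem su2_ann_cre_up_down (hπ : IsFockRep π Ω) (hq : 0 < q) :
    su2Ann π q 0 * su2Cre π q 1 = s.c₂ q • (su2Cre π q 1 * su2Ann π q 0) := by
  refine ext_isOcc hπ fun m n v hv => ?_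
  rw [LinearMap.smul_apply, Module.End.mul_apply, Module.End.mul_apply, hv.cre_down hπ hq,
    map_smul, hv.cre1.ann_up hπ hq, ann_cre_apply, if_neg (by decide), zero_add]
  rcases m with _ | m
  · rw [hv.su2Ann_zero_zero hπ, hv.ann0_zero hπ]; simp
  rw [hv.ann_up hπ hq, map_smul, hv.ann0.cre_down hπ hq, s.c₂_eq]
  simp only [smul_smul]
  congr 1
  push_cast
  ring

theorem su2_ann_cre_down_up (hπ : IsFockRep π Ω) (hq : 0 < q) :
    su2Ann π q 1 * su2Cre π q 0 = s.c₂ q • (su2Cre π q 0 * su2Ann π q 1) := by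
  refine ext_isOcc hπ fun m n v hv => ?_
  rw [LinearMap.smul_apply, Module.End.mul_apply, Module.End.mul_apply, hv.cre_up hπ hq,
    map_smul, hv.cre0.ann_down hπ hq, ann_cre_apply, if_neg (by decide), zero_add]
  rcases n with _ | n
  · rw [hv.su2Ann_one_zero hπ, hv.ann1_zero hπ]; simp
  rw [hv.ann_down hπ hq, map_smul, hv.ann1.cre_up hπ hq, s.c₂_eq]
  simp only [smul_smul]
  congr 1
  push_cast
  ring

theorem fermi_sq_eq_zero {π : CAlg .fermi (Fin 2) →ₐ[ℂ] Module.End ℂ D} (hπ : IsFockRep π Ω)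
    (hq : 0 < q) (i : Fin 2) : su2Cre π q i * su2Cre π q i = 0 := by
  refine ext_isOcc hπ fun m n v hv => ?_
  rw [Module.End.mul_apply, LinearMap.zero_apply]
  fin_cases i
  · change su2Cre π q 0 (su2Cre π q 0 v) = 0
    rw [hv.cre_up hπ hq, map_smul, hv.cre0.cre_up hπ hq, fermi_cre_cre, smul_zero, smul_zero]
  · change su2Cre π q 1 (su2Cre π q 1 v) = 0
    rw [hv.cre_down hπ hq, map_smul, hv.cre1.cre_down hπ hq, fermi_cre_cre, smul_zero, smul_zero]

theorem su2_cre_sq (hπ : IsFockRep π Ω) (hq : 0 < q) (i : Fin 2) :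
    su2Cre π q i * su2Cre π q i = (s.c₁ q * q) • (su2Cre π q i * su2Cre π q i) := by
  have hq' : (q : ℂ) ≠ 0 := Complex.ofReal_ne_zero.2 hq.ne'
  cases s with
  | bose => rw [Stat.c₁, inv_mul_cancel₀ hq', one_smul]
  | fermi => rw [fermi_sq_eq_zero hπ hq, smul_zero]

theorem su2_ann_sq (hπ : IsFockRep π Ω) (hq : 0 < q) (i : Fin 2) :
    su2Ann π q i * su2Ann π q i = (s.c₁ q * q) • (su2Ann π q i * su2Ann π q i) := by
  have hq' : (q : ℂ) ≠ 0 := Complex.ofReal_ne_zero.2 hq.ne'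
  cases s with
  | bose => rw [Stat.c₁, inv_mul_cancel₀ hq', one_smul]
  | fermi =>
    -- The square of the annihilator is formally adjoint to the square of the creator, which
    -- vanishes.
    have h : su2Ann π q i * su2Ann π q i = 0 := by
      ext v
      have h1 := (formallyAdjoint_su2 hπ hq i).mul (formallyAdjoint_su2 hπ hq i) v
        ((su2Ann π q i * su2Ann π q i) v)
      rw [fermi_sq_eq_zero hπ hq, LinearMap.zero_apply, Submodule.coe_zero, inner_zero_right,
        inner_self_eq_zero] at h1
      rw [h1]
      rfl
    rw [h, smul_zero]

/-- For bosons this is (n+1)_z = 1 + z (n)_z with z = q²; for fermions only n = 0, 1 are left. -/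
theorem su2_ann_cre_down (hπ : IsFockRep π Ω) (hq : 0 < q) :
    su2Ann π q 1 * su2Cre π q 1 = 1 + (s.c₂ q * q) • (su2Cre π q 1 * su2Ann π q 1) := by
  refine ext_isOcc hπ fun m n v hv => ?_
  rw [LinearMap.add_apply, LinearMap.smul_apply, Module.End.mul_apply, Module.End.mul_apply,
    hv.ann_cre_down hπ hq, hv.number_down hπ hq, Module.End.one_apply]
  have hq' : (q : ℂ) ≠ 0 := Complex.ofReal_ne_zero.2 hq.ne'
  cases s with
  | bose =>
    have h1 := modeFactor_sq_mul .bose (q := q) (n + 1)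
    rw [qnum_succ', Stat.base] at h1
    have h2 := congrArg Complex.ofReal h1
    push_cast at h2
    rw [smul_smul]
    nth_rewrite 2 [← one_smul ℂ v]
    rw [← add_smul]
    congr 1
    rw [Stat.sgn, Stat.c₂, Stat.base]
    linear_combination h2
  | fermi =>
    rcases fermi_number_le_one 1 hv.2 with rfl | hn
    · simp
    rw [smul_smul]
    nth_rewrite 2 [← one_smul ℂ v]
    rw [← add_smul]
    congr 1
    rw [Stat.sgn, Stat.c₂, neg_mul (q : ℂ)⁻¹, inv_mul_cancel₀ hq']
    interval_cases n
    · simp [modeFactor_one, qnum_zero]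
    · simp [qnum_one]

/-- For bosons, with z = q², this is z^n (m+1)_z = 1 + z z^n (m)_z + (z - 1)(n)_z, where (z -
1)(n)_z = z^n - 1 accounts for the off-diagonal entry of R. For fermions the possible occupation
numbers are checked one by one. -/
theorem su2_ann_cre_up (hπ : IsFockRep π Ω) (hq : 0 < q) :
    su2Ann π q 0 * su2Cre π q 0 = 1 + (s.c₂ q * q) • (su2Cre π q 0 * su2Ann π q 0) +
      (s.c₂ q * (q - (q : ℂ)⁻¹)) • (su2Cre π q 1 * su2Ann π q 1) := by
  refine ext_isOcc hπ fun m n v hv => ?_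
  simp only [LinearMap.add_apply, LinearMap.smul_apply, Module.End.mul_apply, Module.End.one_apply]
  rw [hv.ann_cre_up hπ hq, hv.number_down hπ hq, hv.number_up hπ hq, smul_smul, smul_smul]
  nth_rewrite 2 [← one_smul ℂ v]
  rw [← add_smul, ← add_smul]
  have hq' : (q : ℂ) ≠ 0 := Complex.ofReal_ne_zero.2 hq.ne'
  cases s with
  | bose =>
    have h1 := modeFactor_sq_mul .bose (q := q) (m + 1)
    rw [qnum_succ', Stat.base] at h1
    have h2 := congrArg Complex.ofReal h1
    have h3 := congrArg Complex.ofReal (mul_qnum (q ^ 2) n)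
    push_cast at h2 h3
    congr 1
    rw [Stat.sgn, Stat.c₂, Stat.base, Stat.root]
    push_cast
    have h4 : (q : ℂ) * (q - (q : ℂ)⁻¹) = q ^ 2 - 1 := by rw [mul_sub, mul_inv_cancel₀ hq']; ring
    rw [h4]
    linear_combination (q : ℂ) ^ (2 * n) * h2 - h3
  | fermi =>
    rcases fermi_number_le_one 0 hv.1 with rfl | hm
    · simp
    rcases fermi_number_le_one 1 hv.2 with rfl | hn
    · simp
    congr 1
    rw [Stat.sgn, Stat.c₂, Stat.base, Stat.root]
    interval_cases m <;> interval_cases n <;>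
      simp [modeFactor_one, qnum_zero, qnum_one] <;> field_simp <;> ring

theorem satisfiesQCR_su2 (hπ : IsFockRep π Ω) (hq : 0 < q) :
    SatisfiesQCR (algebraMap ℂ (Module.End ℂ D) (s.c₁ q)) (algebraMap ℂ (Module.End ℂ D) (s.c₂ q))
      (fun i j h k => algebraMap ℂ (Module.End ℂ D) (su2R q i j h k)) (su2Ann π q) (su2Cre π q) := by
  have hq' : (q : ℂ) ≠ 0 := Complex.ofReal_ne_zero.2 hq.ne'
  -- Both q⁻¹ and -q solve this quadratic equation for c₁. It makes the relation with the
  -- off-diagonal entry of R equivalent to the one without it.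
  have hc : s.c₁ q * (s.c₁ q + (q - (q : ℂ)⁻¹)) = 1 := by
    cases s <;> simp only [Stat.c₁] <;> field_simp <;> ring
  have haa := su2_ann_ann hπ hq
  have hcc := su2_cre_cre hπ hq
  refine ⟨fun i j => ?_, fun i j => ?_, fun i j => ?_⟩
  · simp only [← Algebra.smul_def]
    fin_cases i <;> fin_cases j
    · simpa [su2R, Fin.sum_univ_two, smul_smul, -Complex.coe_smul] using su2_ann_sq hπ hq 0
    · simpa [su2R, Fin.sum_univ_two] using haa
    · have : su2Ann π q 1 * su2Ann π q 0 = s.c₁ q • (su2Ann π q 0 * su2Ann π q 1 +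
          ((q : ℂ) - (q : ℂ)⁻¹) • (su2Ann π q 1 * su2Ann π q 0)) := by
        rw [haa, ← add_smul, smul_smul, hc, one_smul]
      simpa [su2R, Fin.sum_univ_two, add_comm] using this
    · simpa [su2R, Fin.sum_univ_two, smul_smul, -Complex.coe_smul] using su2_ann_sq hπ hq 1
  · simp only [← Algebra.smul_def]
    fin_cases i <;> fin_cases j
    · simpa [su2R, Fin.sum_univ_two, smul_smul, -Complex.coe_smul] using su2_cre_sq hπ hq 0
    · have : su2Cre π q 0 * su2Cre π q 1 = s.c₁ q • (su2Cre π q 1 * su2Cre π q 0 +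
          ((q : ℂ) - (q : ℂ)⁻¹) • (su2Cre π q 0 * su2Cre π q 1)) := by
        rw [hcc, ← add_smul, smul_smul, hc, one_smul]
      simpa [su2R, Fin.sum_univ_two, add_comm] using this
    · simpa [su2R, Fin.sum_univ_two] using hcc
    · simpa [su2R, Fin.sum_univ_two, smul_smul, -Complex.coe_smul] using su2_cre_sq hπ hq 1
  · simp only [← Algebra.smul_def]
    fin_cases i <;> fin_cases j
    · simpa [su2R, Fin.sum_univ_two, smul_smul, add_assoc, -Complex.coe_smul] using su2_ann_cre_up hπ hq
    · simpa [su2R, Fin.sum_univ_two] using su2_ann_cre_up_down hπ hq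
    · simpa [su2R, Fin.sum_univ_two] using su2_ann_cre_down_up hπ hq
    · simpa [su2R, Fin.sum_univ_two, smul_smul, -Complex.coe_smul] using su2_ann_cre_down hπ hq

theorem su2_number_eigen (hπ : IsFockRep π Ω) (hq : 0 < q) :
    ∀ v ∈ {v | ∃ m n, IsOcc π m n v},
      ∃ c : ℝ, (∑ i, su2Cre π q i * su2Ann π q i) v = (c : ℂ) • v := by
  rintro v ⟨m, n, hv⟩
  refine ⟨s.base q ^ n * qnum (s.base q) m + qnum (s.base q) n, ?_⟩
  rw [Fin.sum_univ_two, LinearMap.add_apply, Module.End.mul_apply, Module.End.mul_apply,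
    hv.number_up hπ hq, hv.number_down hπ hq, ← add_smul, Complex.ofReal_add]

variable [CompleteSpace H]

/-- The `U_h su(2)`-covariant deformed generators form a `*`-representation. -/
theorem isQCRStarRep_su2 (hπ : IsFockRep π Ω) (hq : 0 < q) :
    IsQCRStarRep (s.c₁ q) (s.c₂ q) (su2R q) (fun i => closedOp (su2Ann π q i))
        (fun i => closedOp (su2Cre π q i)) D ∧
      ∀ α : PowerSeries (CAlg s (Fin 2)), IsUnitaryPS α →
        ConvergesAt π (Real.log q) α → ConvergesAt π (Real.log q) (psStar α) →
        ∃ V : H ≃ₗᵢ[ℂ] H, IsValue π (Real.log q) α (fun v => V (v : H)) ∧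
          IsQCRStarRep (s.c₁ q) (s.c₂ q) (su2R q) (fun i => conj V (closedOp (su2Ann π q i)))
            (fun i => conj V (closedOp (su2Cre π q i)))
            (D.map (V.toLinearEquiv : H →ₗ[ℂ] H)) := by
  refine ⟨isQCRStarRep_closedOp hπ.dense (formallyAdjoint_su2 hπ hq) (satisfiesQCR_su2 hπ hq)
    (span_isOcc hπ) (su2_number_eigen hπ hq), fun α hu hα hα' => ?_⟩
  obtain ⟨V, hV⟩ := exists_unitary_value hπ.dense hπ.formallyAdjoint hu hα hα'
  exact ⟨V, hV, isQCRStarRep_conj V hπ.dense (formallyAdjoint_su2 hπ hq)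
    (satisfiesQCR_su2 hπ hq) (span_isOcc hπ) (su2_number_eigen hπ hq)⟩

end SU2Rep

/-! ### Operators given on a Hilbert basis -/

section OnBasis
set_option linter.unusedSectionVars false
variable {K : Type*} [NormedAddCommGroup K] [InnerProductSpace ℂ K] {S : Set (ℝ × ℝ)}
  (b : HilbertBasis S ℂ K)

/-- The operator on the span of the basis of which `onBasis` is the closure. -/
noncomputable abbrev onSpan (g : ℝ × ℝ → K) : K →ₗ.[ℂ] K :=
  ⟨Submodule.span ℂ (Set.range b),
    (Module.Basis.span b.orthonormal.linearIndependent).constr ℂ fun p : S => g p⟩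

theorem onSpan_graph (g : ℝ × ℝ → K) :
    (onSpan b g).graph = Submodule.span ℂ (Set.range fun p : S => (b p, g p)) := by
  let e := Module.Basis.span b.orthonormal.linearIndependent
  let φ : Submodule.span ℂ (Set.range b) →ₗ[ℂ] K × K :=
    (Submodule.span ℂ (Set.range b)).subtype.prod (e.constr ℂ fun p : S => g p)
  have h1 : (onSpan b g).graph = Submodule.map φ ⊤ := by
    ext x
    rw [LinearPMap.mem_graph_iff, Submodule.mem_map]
    constructor
    · rintro ⟨y, h1, h2⟩
      exact ⟨y, trivial, Prod.ext h1 h2⟩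
    · rintro ⟨y, -, rfl⟩
      exact ⟨y, rfl, rfl⟩
  rw [h1, ← e.span_eq, Submodule.map_span, ← Set.range_comp]
  congr 2
  funext p
  refine Prod.ext ?_ (e.constr_basis ℂ _ p)
  exact congrArg Subtype.val (Module.Basis.span_apply b.orthonormal.linearIndependent p)

theorem rawOp_graph_eq_span {H : Type*} [NormedAddCommGroup H] [InnerProductSpace ℂ H]
    {D : Submodule ℂ H} (B : Module.End ℂ D) {κ : Type*} {e : κ → D}
    (he : Submodule.span ℂ (Set.range e) = ⊤) :
    (rawOp B).graph = Submodule.span ℂ (Set.range fun p => ((e p : H), (B (e p) : H))) := by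
  let φ : D →ₗ[ℂ] H × H := D.subtype.prod (D.subtype ∘ₗ B)
  have h1 : (rawOp B).graph = Submodule.map φ ⊤ := by
    ext x
    rw [mem_rawOp_graph_iff, Submodule.mem_map]
    constructor
    · rintro ⟨y, rfl⟩
      exact ⟨y, trivial, rfl⟩
    · rintro ⟨y, -, rfl⟩
      exact ⟨y, rfl⟩
  rw [h1, ← he, Submodule.map_span, ← Set.range_comp]
  rfl

theorem conj_symm_conj {H K : Type*} [NormedAddCommGroup H] [InnerProductSpace ℂ H]
    [NormedAddCommGroup K] [InnerProductSpace ℂ K] (V : K ≃ₗᵢ[ℂ] H) (T : K →ₗ.[ℂ] K) :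
    conj V.symm (conj V T) = T := by
  apply LinearPMap.eq_of_eq_graph
  ext p
  rw [mem_conj_graph_iff, mem_conj_graph_iff]
  simp

/-- A unitary operator that maps the basis to a spanning family `e` of `D` carries `onBasis` to the
closure of an operator on `D`. -/
theorem conj_onBasis {H : Type*} [NormedAddCommGroup H] [InnerProductSpace ℂ H]
    {D : Submodule ℂ H} {B : Module.End ℂ D} {e : S → D}
    (he : Submodule.span ℂ (Set.range e) = ⊤) (V : K ≃ₗᵢ[ℂ] H) (hV : ∀ p, V (b p) = e p)
    {g : ℝ × ℝ → K} (hg : ∀ p : S, V (g p) = B (e p)) (hc : (rawOp B).IsClosable) :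
    conj V (onBasis b g) = closedOp B := by
  have h1 : conj V (onSpan b g) = rawOp B := by
    apply LinearPMap.eq_of_eq_graph
    let W : (K × K) ≃ₗ[ℂ] (H × H) := V.toLinearEquiv.prodCongr V.toLinearEquiv
    have h2 : (conj V (onSpan b g)).graph = (onSpan b g).graph.map (W : (K × K) →ₗ[ℂ] (H × H)) := by
      ext p
      rw [mem_conj_graph_iff, Submodule.mem_map]
      constructor
      · intro h
        exact ⟨_, h, Prod.ext (V.apply_symm_apply _) (V.apply_symm_apply _)⟩
      · rintro ⟨y, hy, rfl⟩
        have : (V.symm (W y).1, V.symm (W y).2) = y :=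
          Prod.ext (V.symm_apply_apply _) (V.symm_apply_apply _)
        change (V.symm (W y).1, V.symm (W y).2) ∈ _
        rwa [this]
    rw [h2, onSpan_graph, Submodule.map_span, ← Set.range_comp, rawOp_graph_eq_span B he]
    congr 2
    funext p
    exact Prod.ext (hV p) (hg p)
  -- Closability is not assumed on the side of the basis; it is pulled back along V.
  have h3 : (onSpan b g).IsClosable := by
    rw [← conj_symm_conj V (onSpan b g), h1]
    exact conj_isClosable V.symm hc
  change conj V (onSpan b g).closure = (rawOp B).closure
  rw [conj_closure V h3, h1]

/-- A weighted shift with nonvanishing weights has trivial kernel, and so has its closure. -/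
theorem onBasis_injective {g : ℝ × ℝ → K} (τ : S → S) (hτ : Function.Injective τ) (w : S → ℂ)
    (hw : ∀ p, w p ≠ 0) (hg : ∀ p : S, g p = w p • b (τ p)) {x : K}
    (hx : (x, 0) ∈ (onBasis b g).graph) : x = 0 := by
  -- This identity between coefficients is closed in the pair and holds on the graph since τ is
  -- injective. For a pair (x, 0) with nonzero weights it kills every coefficient of x.
  have key (p : S) : inner ℂ (b (τ p)) (0 : K) = w p * inner ℂ (b p) x := by
    refine closure_graph_subset (f := onSpan b g)
      (C := {y | inner ℂ (b (τ p)) y.2 = w p * inner ℂ (b p) y.1})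
      (isClosed_eq (by fun_prop) (by fun_prop)) (fun y hy => ?_) hx
    rw [onSpan_graph] at hy
    simp only [Set.mem_ofPred_eq]
    induction hy using Submodule.span_induction with
    | mem y hy =>
      obtain ⟨p', rfl⟩ := hy
      simp only [hg, inner_smul_right, orthonormal_iff_ite.1 b.orthonormal, hτ.eq_iff]
      split_ifs with h
      · rw [h]
      · simp
    | zero => simp
    | add y y' _ _ h h' => simp only [Prod.fst_add, Prod.snd_add, inner_add_right, h, h', mul_add]
    | smul c y _ h =>
      simp only [Prod.smul_fst, Prod.smul_snd, inner_smul_right, h]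
      ring
  refine b.repr.injective (lp.ext (funext fun p => ?_))
  rw [map_zero, lp.coeFn_zero, Pi.zero_apply, b.repr_apply_apply]
  have := key p
  rw [inner_zero_right] at this
  exact (mul_eq_zero.1 this.symm).resolve_left (hw p)

end OnBasis

/-! ### The labels of the Pusz–Woronowicz representations -/

section Labels
variable {q E : ℝ}

/-- In terms of the labels the arguments of the logarithms are (q² - 1)η_↓ and η/η_↓, so positivity
only depends on the signs of η and η_↓. -/
theorem logArg_one (h : q ^ 2 - 1 ≠ 0) (p : ℝ × ℝ) : logArg q 1 p = (q ^ 2 - 1) * p.2 := by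
  simp only [logArg, nuVal]
  norm_num
  field_simp
  ring

theorem logArg_zero (h : q ^ 2 - 1 ≠ 0) (p : ℝ × ℝ) : logArg q 0 p = p.1 / p.2 := by
  have h1 := logArg_one h p
  simp only [logArg, nuVal] at h1 ⊢
  norm_num at h1 ⊢
  rw [h1]
  have h2 : 1 + (q ^ 2 - 1) * (p.1 - (q ^ 2 - 1)⁻¹) = (q ^ 2 - 1) * p.1 := by
    field_simp
    ring
  rw [h2, mul_div_mul_left _ _ h]

theorem sq_sub_one_neg (hq : 0 < q) (hq1 : q < 1) : q ^ 2 - 1 < 0 := by nlinarith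

/-- As q² - 1 < 0, both labels must be negative. In class 1 they are; in classes 2 and 3 one has η ≥
0 > η_↓, and in classes 4 and 5 η_↓ ≥ 0. -/
theorem invDefined_iff (hq : 0 < q) (hq1 : q < 1) (hE : 0 < E) (c : PWClass) :
    InvDefined q (c.labels q E) ↔ c = PWClass.one := by
  have hn := sq_sub_one_neg hq hq1
  constructor
  · intro h
    cases c with
    | one => rfl
    | two =>
      have h1 := h (q ^ (2 * 0 : ℤ) * E, q ^ (2 * 0) / (q ^ 2 - 1)) ⟨0, 0, rfl⟩ 0
      rw [logArg_zero hn.ne] at h1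
      refine absurd h1 (not_lt.2 (div_nonpos_of_nonneg_of_nonpos (by positivity) ?_))
      exact div_nonpos_of_nonneg_of_nonpos (by positivity) hn.le
    | three =>
      have h1 := h (0, q ^ (2 * 0) / (q ^ 2 - 1)) ⟨0, rfl⟩ 0
      rw [logArg_zero hn.ne] at h1
      simp at h1
    | four =>
      have h1 := h (q ^ (2 * 0 : ℤ) * E, q ^ (2 * 1 : ℤ) * E) ⟨0, 1, one_pos, rfl⟩ 1
      rw [logArg_one hn.ne] at h1
      exact absurd h1 (not_lt.2 (mul_nonpos_of_nonpos_of_nonneg hn.le (by positivity)))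
    | five =>
      have h1 := h (q ^ (2 * 0 : ℤ) * E, 0) ⟨0, rfl⟩ 1
      rw [logArg_one hn.ne] at h1
      simp at h1
  · rintro rfl p ⟨m₁, m₂, -, rfl⟩ i
    fin_cases i
    · change 0 < logArg q 0 _
      rw [logArg_zero hn.ne]
      exact div_pos_of_neg_of_neg (div_neg_of_pos_of_neg (by positivity) hn)
        (div_neg_of_pos_of_neg (by positivity) hn)
    · change 0 < logArg q 1 _
      rw [logArg_one hn.ne]
      exact mul_pos_of_neg_of_neg hn (div_neg_of_pos_of_neg (by positivity) hn)

/-- Outside class 1 the operator `Ã^↑` shifts the labels without annihilating a basis vector. -/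
theorem nuVal_pos_and_down_mem (hq : 0 < q) (hq1 : q < 1) (hE : 0 < E) {c : PWClass}
    (hc : c ≠ PWClass.one) {p : ℝ × ℝ} (hp : p ∈ c.labels q E) :
    0 < nuVal q 0 p ∧ down q 0 p ∈ c.labels q E := by
  have hn := sq_sub_one_neg hq hq1
  have hz (n : ℤ) : q ^ (2 * n) * E / q ^ 2 = q ^ (2 * (n - 1)) * E := by
    rw [mul_sub, zpow_sub₀ hq.ne']
    norm_num
    norm_cast
    ring
  have hd (p : ℝ × ℝ) : down q 0 p = (p.1 / q ^ 2, p.2) := if_pos rfl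
  have hν (p : ℝ × ℝ) : nuVal q 0 p = p.1 - p.2 := if_pos rfl
  rw [hd, hν]
  cases c with
  | one => exact absurd rfl hc
  | two =>
    obtain ⟨n, m, rfl⟩ := hp
    refine ⟨?_, n - 1, m, by rw [hz]⟩
    have h1 : q ^ (2 * m) / (q ^ 2 - 1) < 0 := div_neg_of_pos_of_neg (by positivity) hn
    have h2 : 0 < q ^ (2 * n) * E := by positivity
    linarith
  | three =>
    obtain ⟨m, rfl⟩ := hp
    refine ⟨?_, m, by rw [zero_div]⟩
    have h1 : q ^ (2 * m) / (q ^ 2 - 1) < 0 := div_neg_of_pos_of_neg (by positivity) hn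
    linarith
  | four =>
    obtain ⟨n, m, h, rfl⟩ := hp
    refine ⟨?_, n - 1, m, by omega, by rw [hz]⟩
    have h1 : q ^ (2 * m) < q ^ (2 * n) := zpow_lt_zpow_right_of_lt_one₀ hq hq1 (by omega)
    have h2 := mul_lt_mul_of_pos_right h1 hE
    exact sub_pos.2 h2
  | five =>
    obtain ⟨n, rfl⟩ := hp
    refine ⟨?_, n - 1, by rw [hz]⟩
    rw [sub_zero]
    positivity

end Labels

/-! ### Absence of a vacuum outside class 1. -/

section Necessity
set_option linter.unusedSectionVars false
variable {H : Type*} [NormedAddCommGroup H] [InnerProductSpace ℂ H]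
  {D : Submodule ℂ H} {π : CAlg Stat.bose (Fin 2) →ₐ[ℂ] Module.End ℂ D} {L : Type*} [Nonempty L]
  {Ω : L → D} {K : Type*} [NormedAddCommGroup K] [InnerProductSpace ℂ K] {q E : ℝ}

/-- Outside class 1 there is no vacuum, hence no equivalence with a Fock representation. -/
theorem class_eq_one_of_conj (hπ : IsFockRep π Ω) (hq : 0 < q) (hq1 : q < 1) (hE : 0 < E)
    {c : PWClass} (b : HilbertBasis (c.labels q E) ℂ K) {z : Fin 2 → ℂ} (hz : ∀ i, ‖z i‖ = 1)
    (V : K ≃ₗᵢ[ℂ] H) (hV : conj V (pwAnn b q z 0) = closedOp (su2Ann π q 0)) :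
    c = PWClass.one := by
  by_contra hc
  let l : L := Classical.arbitrary L
  -- The vacuum has no quanta, so Π(Ã^↑) annihilates it; its preimage under V would be a nonzero
  -- vector in the kernel of an injective operator.
  have hΩ : IsOcc π 0 0 (Ω l) := by constructor <;> simp [hπ.vacuum]
  have h1 : ((Ω l : H), (0 : H)) ∈ (closedOp (su2Ann π q 0)).graph := by
    have h2 := mem_closedOp_graph (su2Ann π q 0) (Ω l)
    rwa [hΩ.su2Ann_zero_zero hπ] at h2
  rw [← hV, mem_conj_graph_iff, map_zero] at h1
  have hmem (p : c.labels q E) := nuVal_pos_and_down_mem hq hq1 hE hc p.2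
  have h3 := onBasis_injective b (fun p => ⟨down q 0 p, (hmem p).2⟩) (fun p p' h => ?_)
    (fun p => z 0 * (√(nuVal q 0 p) : ℝ)) (fun p => ?_) (fun p => ?_) h1
  · have h4 : (Ω l : H) = 0 := by simpa using h3
    have h5 : ‖(Ω l : H)‖ = 1 := hπ.orthonormal.1 l
    rw [h4, norm_zero] at h5
    exact zero_ne_one h5
  · have h4 : down q 0 p = down q 0 p' := congrArg Subtype.val h
    have h5 : ((p : ℝ × ℝ).1 / q ^ 2, (p : ℝ × ℝ).2) = ((p' : ℝ × ℝ).1 / q ^ 2, (p' : ℝ × ℝ).2) := h4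
    obtain ⟨h6, h7⟩ := Prod.ext_iff.1 h5
    refine Subtype.ext (Prod.ext ?_ h7)
    exact (div_left_inj' (by positivity)).1 h6
  · refine mul_ne_zero (fun h => ?_) ?_
    · have := hz 0
      rw [h, norm_zero] at this
      exact zero_ne_one this
    · exact Complex.ofReal_ne_zero.2 (Real.sqrt_pos.2 (hmem p).1).ne'
  · rw [ket, dif_pos (hmem p).2]

end Necessity

/-! ### The number basis of the irreducible Fock representation -/

section NumberBasis
set_option linter.unusedSectionVars false
variable {H : Type*} [NormedAddCommGroup H] [InnerProductSpace ℂ H]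
  {D : Submodule ℂ H} {π : CAlg Stat.bose (Fin 2) →ₐ[ℂ] Module.End ℂ D}
  {Ω : Unit → D}

/-- `(a^+_↑)^m (a^+_↓)^n v`. -/
noncomputable def powVec (π : CAlg Stat.bose (Fin 2) →ₐ[ℂ] Module.End ℂ D) (v : D) (m n : ℕ) : D :=
  (π (cre .bose 0) ^ m * π (cre .bose 1) ^ n) v

theorem cre_up_powVec (v : D) (m n : ℕ) :
    π (cre .bose 0) (powVec π v m n) = powVec π v (m + 1) n := by
  rw [powVec, powVec, pow_succ', mul_assoc, Module.End.mul_apply _ (_ * _)]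

theorem cre_down_powVec (v : D) (m n : ℕ) :
    π (cre .bose 1) (powVec π v m n) = powVec π v m (n + 1) := by
  have h : Commute (π (cre .bose 1)) (π (cre .bose 0) ^ m) := by
    refine Commute.pow_right ?_ m
    rw [Commute, SemiconjBy, ← map_mul, ← map_mul, cre_mul_cre, Stat.sgn, one_smul]
  rw [powVec, powVec, pow_succ', ← mul_assoc, ← h.eq, mul_assoc, Module.End.mul_apply _ (_ * _)]

theorem isOcc_powVec (hπ : IsFockRep π Ω) (l : Unit) (m n : ℕ) :
    IsOcc π m n (powVec π (Ω l) m n) := by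
  induction m with
  | zero =>
    induction n with
    | zero => constructor <;> simp [powVec, hπ.vacuum]
    | succ n ih => rw [← cre_down_powVec]; exact ih.cre1
  | succ m ih => rw [← cre_up_powVec]; exact ih.cre0

theorem ann_up_powVec (hπ : IsFockRep π Ω) (l : Unit) (m n : ℕ) :
    π (ann .bose 0) (powVec π (Ω l) (m + 1) n) = ((m : ℂ) + 1) • powVec π (Ω l) m n := by
  rw [← cre_up_powVec, ann_cre_apply, if_pos rfl, (isOcc_powVec hπ l m n).1, Stat.sgn]
  module

theorem ann_down_powVec (hπ : IsFockRep π Ω) (l : Unit) (m n : ℕ) :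
    π (ann .bose 1) (powVec π (Ω l) m (n + 1)) = ((n : ℂ) + 1) • powVec π (Ω l) m n := by
  rw [← cre_down_powVec, ann_cre_apply, if_pos rfl, (isOcc_powVec hπ l m n).2, Stat.sgn]
  module

theorem inner_powVec_self (hπ : IsFockRep π Ω) (l : Unit) (m n : ℕ) :
    inner ℂ (powVec π (Ω l) m n : H) (powVec π (Ω l) m n : H) =
      (m.factorial : ℂ) * n.factorial := by
  induction m with
  | zero =>
    induction n with
    | zero =>
      have : ‖(Ω l : H)‖ = 1 := hπ.orthonormal.1 l
      simp [powVec, inner_self_eq_norm_sq_to_K, this]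
    | succ n ih =>
      nth_rewrite 2 [← cre_down_powVec]
      rw [← hπ.adjoint, ann_down_powVec hπ, Submodule.coe_smul, inner_smul_left, ih,
        Nat.factorial_succ]
      simp
  | succ m ih =>
    nth_rewrite 2 [← cre_up_powVec]
    rw [← hπ.adjoint, ann_up_powVec hπ, Submodule.coe_smul, inner_smul_left, ih,
      Nat.factorial_succ m]
    simp
    ring

theorem span_powVec (hπ : IsFockRep π Ω) :
    Submodule.span ℂ (Set.range fun p : ℕ × ℕ => powVec π (Ω ()) p.1 p.2) = ⊤ := by
  rw [← top_le_iff, ← hπ.span]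
  refine Submodule.span_mono ?_
  rintro _ ⟨⟨w, l⟩, rfl⟩
  refine ⟨(w.count 0, w.count 1), ?_⟩
  simp only
  induction w with
  | nil => simp [powVec]
  | cons i w ih =>
    rw [List.map_cons, List.prod_cons, map_mul, Module.End.mul_apply, ← ih]
    fin_cases i
    · simpa using (cre_up_powVec _ _ _).symm
    · simpa using (cre_down_powVec _ _ _).symm

/-- The normalized number vectors with phases `z`. -/
noncomputable def numVec (π : CAlg Stat.bose (Fin 2) →ₐ[ℂ] Module.End ℂ D) (v : D)
    (z : Fin 2 → ℂ) (m n : ℕ) : D :=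
  (z 0 ^ m * z 1 ^ n * (√((m.factorial : ℝ) * n.factorial) : ℂ)⁻¹) • powVec π v m n

variable {z : Fin 2 → ℂ}

theorem conj_mul_self_of_norm {w : ℂ} (hw : ‖w‖ = 1) : starRingEnd ℂ w * w = 1 := by
  rw [Complex.conj_mul', hw]; simp

theorem sqrt_factorial_ne_zero (m n : ℕ) : (√((m.factorial : ℝ) * n.factorial) : ℂ) ≠ 0 := by
  rw [Complex.ofReal_ne_zero]
  exact (Real.sqrt_pos.2 (by positivity)).ne'

theorem sqrt_succ_factorial_left (m n : ℕ) : (√(((m + 1).factorial : ℝ) * n.factorial) : ℂ) =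
    (√((m : ℝ) + 1) : ℝ) * (√((m.factorial : ℝ) * n.factorial) : ℝ) := by
  rw [← Complex.ofReal_mul, ← Real.sqrt_mul (by positivity), Nat.factorial_succ]
  push_cast
  rw [mul_assoc]

theorem sqrt_succ_factorial_right (m n : ℕ) : (√((m.factorial : ℝ) * (n + 1).factorial) : ℂ) =
    (√((n : ℝ) + 1) : ℝ) * (√((m.factorial : ℝ) * n.factorial) : ℝ) := by
  rw [mul_comm, sqrt_succ_factorial_left, mul_comm (n.factorial : ℝ)]

theorem sqrt_succ_sq (m : ℕ) : ((√((m : ℝ) + 1) : ℝ) : ℂ) ^ 2 = m + 1 := by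
  rw [← Complex.ofReal_pow, Real.sq_sqrt (by positivity)]
  push_cast
  rfl

theorem sqrt_succ_ne_zero (m : ℕ) : ((√((m : ℝ) + 1) : ℝ) : ℂ) ≠ 0 := by
  rw [Complex.ofReal_ne_zero]
  exact (Real.sqrt_pos.2 (by positivity)).ne'

/-- The phases z_↑^m z_↓^n in `numVec` turn the bare matrix elements into those with the
Pusz–Woronowicz phases; z̄ z = 1 makes the creator pick up z̄. -/
theorem cre_up_numVec (hz : ∀ i, ‖z i‖ = 1) (v : D) (m n : ℕ) : π (cre .bose 0) (numVec π v z m n) =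
    (starRingEnd ℂ (z 0) * (√((m : ℝ) + 1) : ℝ)) • numVec π v z (m + 1) n := by
  rw [numVec, map_smul, cre_up_powVec, numVec, smul_smul, sqrt_succ_factorial_left]
  congr 1
  have h1 := conj_mul_self_of_norm (hz 0)
  have h2 := sqrt_succ_ne_zero m
  have h3 := sqrt_factorial_ne_zero m n
  field_simp
  linear_combination -(z 0 ^ m * z 1 ^ n) * h1

theorem cre_down_numVec (hz : ∀ i, ‖z i‖ = 1) (v : D) (m n : ℕ) :
    π (cre .bose 1) (numVec π v z m n) =
    (starRingEnd ℂ (z 1) * (√((n : ℝ) + 1) : ℝ)) • numVec π v z m (n + 1) := by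
  rw [numVec, map_smul, cre_down_powVec, numVec, smul_smul, sqrt_succ_factorial_right]
  congr 1
  have h1 := conj_mul_self_of_norm (hz 1)
  have h2 := sqrt_succ_ne_zero n
  have h3 := sqrt_factorial_ne_zero m n
  field_simp
  linear_combination -(z 0 ^ m * z 1 ^ n) * h1

theorem ann_up_numVec (hπ : IsFockRep π Ω) (l : Unit) (m n : ℕ) :
    π (ann .bose 0) (numVec π (Ω l) z (m + 1) n) =
    (z 0 * (√((m : ℝ) + 1) : ℝ)) • numVec π (Ω l) z m n := by
  rw [numVec, map_smul, ann_up_powVec hπ, numVec, smul_smul, smul_smul, sqrt_succ_factorial_left]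
  congr 1
  have h1 := sqrt_succ_sq m
  have h2 := sqrt_succ_ne_zero m
  have h3 := sqrt_factorial_ne_zero m n
  field_simp
  linear_combination -(z 0 ^ (m + 1) * z 1 ^ n) * h1

theorem ann_down_numVec (hπ : IsFockRep π Ω) (l : Unit) (m n : ℕ) :
    π (ann .bose 1) (numVec π (Ω l) z m (n + 1)) =
    (z 1 * (√((n : ℝ) + 1) : ℝ)) • numVec π (Ω l) z m n := by
  rw [numVec, map_smul, ann_down_powVec hπ, numVec, smul_smul, smul_smul,
    sqrt_succ_factorial_right]
  congr 1
  have h1 := sqrt_succ_sq n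
  have h2 := sqrt_succ_ne_zero n
  have h3 := sqrt_factorial_ne_zero m n
  field_simp
  linear_combination -(z 0 ^ m * z 1 ^ (n + 1)) * h1

theorem isOcc_numVec (hπ : IsFockRep π Ω) (l : Unit) (m n : ℕ) :
    IsOcc π m n (numVec π (Ω l) z m n) := (isOcc_powVec hπ l m n).smul _

theorem orthonormal_numVec (hπ : IsFockRep π Ω) (hz : ∀ i, ‖z i‖ = 1) :
    Orthonormal ℂ fun p : ℕ × ℕ => (numVec π (Ω ()) z p.1 p.2 : H) := by
  refine ⟨fun p => ?_, fun p p' hp => ?_⟩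
  · have h1 : ‖(powVec π (Ω ()) p.1 p.2 : H)‖ ^ 2 = (p.1.factorial : ℝ) * p.2.factorial := by
      have h2 := inner_powVec_self hπ () p.1 p.2
      rw [inner_self_eq_norm_sq_to_K] at h2
      have h3 : ((‖(powVec π (Ω ()) p.1 p.2 : H)‖ ^ 2 : ℝ) : ℂ) =
          (((p.1.factorial : ℝ) * p.2.factorial : ℝ) : ℂ) := by
        push_cast
        exact h2
      exact Complex.ofReal_injective h3
    simp only [numVec]
    rw [Submodule.coe_smul, norm_smul, norm_mul, norm_mul, norm_pow, norm_pow, hz, hz, norm_inv,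
      Complex.norm_real, ← h1, Real.sqrt_sq (norm_nonneg _), norm_norm, one_pow, one_pow, one_mul,
      one_mul]
    refine inv_mul_cancel₀ fun h4 => ?_
    rw [h4] at h1
    have : 0 < (p.1.factorial : ℝ) * p.2.factorial := by positivity
    rw [← h1] at this
    norm_num at this
  · exact (isOcc_numVec hπ () p.1 p.2).inner_eq_zero (isOcc_numVec hπ () p'.1 p'.2) hπ
      fun h => hp (Prod.ext h.1 h.2)

theorem span_numVec (hπ : IsFockRep π Ω) (hz : ∀ i, ‖z i‖ = 1) :
    Submodule.span ℂ (Set.range fun p : ℕ × ℕ => numVec π (Ω ()) z p.1 p.2) = ⊤ := by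
  rw [← top_le_iff, ← span_powVec hπ, Submodule.span_le]
  rintro _ ⟨p, rfl⟩
  have h0 (i : Fin 2) : z i ≠ 0 := fun h => by
    have := hz i
    rw [h, norm_zero] at this
    exact zero_ne_one this
  have h1 : z 0 ^ p.1 * z 1 ^ p.2 * (√((p.1.factorial : ℝ) * p.2.factorial) : ℂ)⁻¹ ≠ 0 :=
    mul_ne_zero (mul_ne_zero (pow_ne_zero _ (h0 0)) (pow_ne_zero _ (h0 1)))
      (inv_ne_zero (sqrt_factorial_ne_zero _ _))
  have h2 : powVec π (Ω ()) p.1 p.2 =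
      (z 0 ^ p.1 * z 1 ^ p.2 * (√((p.1.factorial : ℝ) * p.2.factorial) : ℂ)⁻¹)⁻¹ •
        numVec π (Ω ()) z p.1 p.2 := by
    rw [numVec, smul_smul, inv_mul_cancel₀ h1, one_smul]
  simp only [SetLike.mem_coe]
  rw [h2]
  exact Submodule.smul_mem _ _ (Submodule.subset_span ⟨p, rfl⟩)

end NumberBasis

/-! ### The labels of class 1 -/

section ClassOne
variable {q : ℝ}

/-- The label of class 1 with occupation numbers `m`, `n`. -/
noncomputable def occLabel (q : ℝ) (m n : ℕ) : ℝ × ℝ :=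
  (q ^ (2 * (m + n)) / (q ^ 2 - 1), q ^ (2 * n) / (q ^ 2 - 1))

theorem occLabel_mem (q E : ℝ) (m n : ℕ) : occLabel q m n ∈ PWClass.one.labels q E :=
  ⟨m + n, n, Nat.le_add_left n m, rfl⟩

/-- The parameters of class 1 are m₁ = m + n and m₂ = n, and the constraint m₂ ≤ m₁ makes the
subtraction m₁ - m₂ exact. Injectivity uses that the powers of q < 1 are distinct. -/
theorem occLabel_bijective (hq : 0 < q) (hq1 : q < 1) (E : ℝ) :
    Function.Bijective fun p : ℕ × ℕ =>
      (⟨occLabel q p.1 p.2, occLabel_mem q E p.1 p.2⟩ : PWClass.one.labels q E) := by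
  have hn := (sq_sub_one_neg hq hq1).ne
  constructor
  · rintro ⟨m, n⟩ ⟨m', n'⟩ h
    obtain ⟨h1, h2⟩ := Prod.ext_iff.1 (congrArg Subtype.val h)
    have inj := (pow_right_strictAnti₀ hq hq1).injective
    have h3 : 2 * (m + n) = 2 * (m' + n') := inj ((div_left_inj' hn).1 h1)
    have h4 : 2 * n = 2 * n' := inj ((div_left_inj' hn).1 h2)
    exact Prod.ext (by simp only; omega) (by simp only; omega)
  · rintro ⟨_, m₁, m₂, h, rfl⟩
    refine ⟨(m₁ - m₂, m₂), Subtype.ext ?_⟩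
    simp only [occLabel, Nat.sub_add_cancel h]

/-- The eigenvalue found for the deformed Fock representation in `IsOcc.number_up`. -/
theorem nuVal_zero_occLabel (hq : 0 < q) (hq1 : q < 1) (m n : ℕ) :
    nuVal q 0 (occLabel q m n) = (q ^ n) ^ 2 * qnum (q ^ 2) m := by
  have hn := (sq_sub_one_neg hq hq1).ne
  have h := mul_qnum (q ^ 2) m
  rw [nuVal, if_pos rfl, occLabel, ← sub_div, div_eq_iff hn]
  linear_combination -(q ^ n) ^ 2 * h

theorem nuVal_one_occLabel (hq : 0 < q) (hq1 : q < 1) (m n : ℕ) :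
    nuVal q 1 (occLabel q m n) = qnum (q ^ 2) n := by
  have hn := (sq_sub_one_neg hq hq1).ne
  have h := mul_qnum (q ^ 2) n
  rw [nuVal, if_neg one_ne_zero, occLabel, ← sub_div, div_eq_iff hn]
  linear_combination -h

theorem up_zero_occLabel (q : ℝ) (m n : ℕ) : up q 0 (occLabel q m n) = occLabel q (m + 1) n := by
  rw [up, if_pos rfl, occLabel, occLabel]
  refine Prod.ext ?_ rfl
  simp only
  ring

theorem up_one_occLabel (q : ℝ) (m n : ℕ) : up q 1 (occLabel q m n) = occLabel q m (n + 1) := by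
  rw [up, if_neg one_ne_zero, occLabel, occLabel]
  refine Prod.ext ?_ ?_ <;> simp only <;> ring

theorem down_zero_occLabel (hq : 0 < q) (m n : ℕ) :
    down q 0 (occLabel q (m + 1) n) = occLabel q m n := by
  rw [← up_zero_occLabel, up, down, if_pos rfl, if_pos rfl]
  refine Prod.ext ?_ rfl
  exact mul_div_cancel_left₀ _ (by positivity)

theorem down_one_occLabel (hq : 0 < q) (m n : ℕ) :
    down q 1 (occLabel q m (n + 1)) = occLabel q m n := by
  rw [← up_one_occLabel, up, down, if_neg one_ne_zero, if_neg one_ne_zero]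
  refine Prod.ext ?_ ?_ <;> exact mul_div_cancel_left₀ _ (by positivity)

theorem sqrt_nuVal_zero (hq : 0 < q) (hq1 : q < 1) (m n : ℕ) :
    √(nuVal q 0 (occLabel q (m + 1) n)) =
      q ^ n * modeFactor .bose q (m + 1) * √((m : ℝ) + 1) := by
  have h : qnum (q ^ 2) (m + 1) = qnum (q ^ 2) (m + 1) / ((m + 1 : ℕ) : ℝ) * ((m : ℝ) + 1) := by
    push_cast
    field_simp
  rw [nuVal_zero_occLabel hq hq1, Real.sqrt_mul (by positivity), Real.sqrt_sq (by positivity), h,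
    Real.sqrt_mul' _ (by positivity), mul_assoc]
  rfl

theorem sqrt_nuVal_one (hq : 0 < q) (hq1 : q < 1) (m n : ℕ) :
    √(nuVal q 1 (occLabel q m (n + 1))) = modeFactor .bose q (n + 1) * √((n : ℝ) + 1) := by
  have h : qnum (q ^ 2) (n + 1) = qnum (q ^ 2) (n + 1) / ((n + 1 : ℕ) : ℝ) * ((n : ℝ) + 1) := by
    push_cast
    field_simp
  rw [nuVal_one_occLabel hq hq1, h, Real.sqrt_mul' _ (by positivity)]
  rfl

theorem logArg_zero_occLabel (hq : 0 < q) (hq1 : q < 1) (m n : ℕ) :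
    logArg q 0 (occLabel q m n) = q ^ (2 * m) := by
  have hn := (sq_sub_one_neg hq hq1).ne
  rw [logArg_zero hn, occLabel]
  simp only
  field_simp
  ring

theorem logArg_one_occLabel (hq : 0 < q) (hq1 : q < 1) (m n : ℕ) :
    logArg q 1 (occLabel q m n) = q ^ (2 * n) := by
  have hn := (sq_sub_one_neg hq hq1).ne
  rw [logArg_one hn, occLabel]
  simp only
  field_simp

/-- At this label log[…]/(2 log q) is the classical occupation number m + 1, so `invFactor` replaces
the q-deformed eigenvalue under the root by the classical one. -/
theorem sqrt_nuVal_mul_invFactor_zero (hq : 0 < q) (hq1 : q < 1) (m n : ℕ) :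
    √(nuVal q 0 (occLabel q (m + 1) n)) * invFactor q 0 (occLabel q (m + 1) n) =
      √((m : ℝ) + 1) := by
  have hl := (Real.log_neg hq hq1).ne
  have h1 := qnum_succ_pos (z := q ^ 2) (by positivity) m
  rw [invFactor, logArg_zero_occLabel hq hq1, nuVal_zero_occLabel hq hq1,
    ← Real.sqrt_mul (by positivity), Real.log_pow]
  congr 1
  push_cast
  field_simp

theorem sqrt_nuVal_mul_invFactor_one (hq : 0 < q) (hq1 : q < 1) (m n : ℕ) :
    √(nuVal q 1 (occLabel q m (n + 1))) * invFactor q 1 (occLabel q m (n + 1)) =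
      √((n : ℝ) + 1) := by
  have hl := (Real.log_neg hq hq1).ne
  have h1 := qnum_succ_pos (z := q ^ 2) (by positivity) n
  rw [invFactor, logArg_one_occLabel hq hq1, nuVal_one_occLabel hq hq1,
    ← Real.sqrt_mul h1.le, Real.log_pow]
  congr 1
  push_cast
  field_simp

end ClassOne

/-! ### Unitary equivalence for class 1. -/

section Equivalence
set_option linter.unusedSectionVars false
variable {H : Type*} [NormedAddCommGroup H] [InnerProductSpace ℂ H] [CompleteSpace H]
  {D : Submodule ℂ H} {π : CAlg Stat.bose (Fin 2) →ₐ[ℂ] Module.End ℂ D}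
  {Ω : Unit → D} {K : Type*} [NormedAddCommGroup K] [InnerProductSpace ℂ K] [CompleteSpace K]
  {q E : ℝ} {z : Fin 2 → ℂ}

/-- A unitary operator that maps the basis vectors of class 1 to the number vectors. -/
theorem exists_unitary_numVec (hπ : IsFockRep π Ω) (hq : 0 < q) (hq1 : q < 1)
    (b : HilbertBasis (PWClass.one.labels q E) ℂ K) (hz : ∀ i, ‖z i‖ = 1) :
    ∃ V : K ≃ₗᵢ[ℂ] H, ∀ m n, V (ket b (occLabel q m n)) = numVec π (Ω ()) z m n := by
  let φ : ℕ × ℕ ≃ PWClass.one.labels q E := Equiv.ofBijective _ (occLabel_bijective hq hq1 E)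
  let e (p : PWClass.one.labels q E) : H := numVec π (Ω ()) z (φ.symm p).1 (φ.symm p).2
  have he : Orthonormal ℂ e := (orthonormal_numVec hπ hz).comp _ φ.symm.injective
  have hs : Submodule.span ℂ (Set.range e) = D := by
    have h1 : Set.range e =
        D.subtype '' Set.range fun p : ℕ × ℕ => numVec π (Ω ()) z p.1 p.2 := by
      rw [← Set.range_comp]
      exact φ.symm.surjective.range_comp (fun p : ℕ × ℕ => (numVec π (Ω ()) z p.1 p.2 : H))
    rw [h1, ← Submodule.map_span, span_numVec hπ hz, Submodule.map_top, Submodule.range_subtype]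
  let b' : HilbertBasis (PWClass.one.labels q E) ℂ H := HilbertBasis.mk he (by
    rw [hs, top_le_iff, ← Submodule.dense_iff_topologicalClosure_eq_top]
    exact hπ.dense)
  have hb' (p) : b' p = e p := congrFun (HilbertBasis.coe_mk he _) p
  refine ⟨b.repr.trans b'.repr.symm, fun m n => ?_⟩
  rw [ket, dif_pos (occLabel_mem q E m n), LinearIsometryEquiv.trans_apply, b.repr_self,
    b'.repr_symm_single, hb']
  change (numVec π (Ω ()) z (φ.symm (φ (m, n))).1 (φ.symm (φ (m, n))).2 : H) = _
  rw [φ.symm_apply_apply]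

theorem conj_onBasis_of_numVec (hπ : IsFockRep π Ω) (hq : 0 < q) (hq1 : q < 1)
    {b : HilbertBasis (PWClass.one.labels q E) ℂ K} (hz : ∀ i, ‖z i‖ = 1) {V : K ≃ₗᵢ[ℂ] H}
    (hV : ∀ m n, V (ket b (occLabel q m n)) = numVec π (Ω ()) z m n) {B Bp : Module.End ℂ D}
    (hB : FormallyAdjoint Bp B) {g : ℝ × ℝ → K}
    (hg : ∀ m n, V (g (occLabel q m n)) = B (numVec π (Ω ()) z m n)) :
    conj V (onBasis b g) = closedOp B := by
  let φ : ℕ × ℕ ≃ PWClass.one.labels q E := Equiv.ofBijective _ (occLabel_bijective hq hq1 E)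
  refine conj_onBasis b (e := fun p => numVec π (Ω ()) z (φ.symm p).1 (φ.symm p).2) ?_ V
    (fun p => ?_) (fun p => ?_) (hB.isClosable hπ.dense)
  · have h := φ.symm.surjective.range_comp (fun p : ℕ × ℕ => numVec π (Ω ()) z p.1 p.2)
    exact (congrArg (Submodule.span ℂ) h).trans (span_numVec hπ hz)
  · obtain ⟨⟨m, n⟩, rfl⟩ := φ.surjective p
    have h := hV m n
    rw [ket, dif_pos (occLabel_mem q E m n)] at h
    simp only [φ.symm_apply_apply]
    exact h
  · obtain ⟨⟨m, n⟩, rfl⟩ := φ.surjective p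
    simp only [φ.symm_apply_apply]
    exact hg m n

/-- The Pusz–Woronowicz representation of class 1 is carried to the deformed Fock representation,
and its image under `f⁻¹` to the Fock representation itself. -/
theorem exists_unitary_class_one (hπ : IsFockRep π Ω) (hq : 0 < q) (hq1 : q < 1)
    (b : HilbertBasis (PWClass.one.labels q E) ℂ K) (hz : ∀ i, ‖z i‖ = 1) :
    ∃ V : K ≃ₗᵢ[ℂ] H, ∀ i,
        conj V (pwAnn b q z i) = closedOp (su2Ann π q i) ∧
        conj V (pwCre b q z i) = closedOp (su2Cre π q i) ∧
        conj V (invAnn b q z i) = closedOp (π (ann Stat.bose i)) ∧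
        conj V (invCre b q z i) = closedOp (π (cre Stat.bose i)) := by
  obtain ⟨V, hV⟩ := exists_unitary_numVec hπ hq hq1 b hz
  have hocc (m n : ℕ) := isOcc_numVec (z := z) hπ () m n
  have hac (i : Fin 2) : FormallyAdjoint (π (ann .bose i)) (π (cre .bose i)) :=
    fun x y => hπ.adjoint i x y
  refine ⟨V, fun i => ⟨?_, ?_, ?_, ?_⟩⟩
  · refine conj_onBasis_of_numVec hπ hq hq1 hz hV (formallyAdjoint_su2 hπ hq i).symm
      fun m n => ?_
    fin_cases i
    · simp only [Fin.zero_eta, map_smul]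
      -- At m = 0 the lowered label leaves the set, but the weight √0 already gives zero.
      rcases m with _ | m
      · rw [(hocc 0 n).su2Ann_zero_zero hπ, nuVal_zero_occLabel hq hq1, qnum_zero]
        simp
      · rw [(hocc (m + 1) n).ann_up hπ hq, ann_up_numVec hπ, down_zero_occLabel hq, hV,
          sqrt_nuVal_zero hq hq1, smul_smul, Submodule.coe_smul]
        congr 1
        simp only [Stat.root]
        push_cast
        ring
    · simp only [Fin.mk_one, map_smul]
      rcases n with _ | n
      · rw [(hocc m 0).su2Ann_one_zero hπ, nuVal_one_occLabel hq hq1, qnum_zero]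
        simp
      · rw [(hocc m (n + 1)).ann_down hπ hq, ann_down_numVec hπ, down_one_occLabel hq, hV,
          sqrt_nuVal_one hq hq1, smul_smul, Submodule.coe_smul]
        congr 1
        push_cast
        ring
  · refine conj_onBasis_of_numVec hπ hq hq1 hz hV (formallyAdjoint_su2 hπ hq i) fun m n => ?_
    fin_cases i
    · simp only [Fin.zero_eta, map_smul]
      rw [(hocc m n).cre_up hπ hq, cre_up_numVec hz, up_zero_occLabel, hV,
        sqrt_nuVal_zero hq hq1, smul_smul, Submodule.coe_smul]
      congr 1
      simp only [Stat.root]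
      push_cast
      ring
    · simp only [Fin.mk_one, map_smul]
      rw [(hocc m n).cre_down hπ hq, cre_down_numVec hz, up_one_occLabel, hV,
        sqrt_nuVal_one hq hq1, smul_smul, Submodule.coe_smul]
      congr 1
      push_cast
      ring
  · refine conj_onBasis_of_numVec hπ hq hq1 hz hV (hac i).symm fun m n => ?_
    fin_cases i
    · simp only [Fin.zero_eta, map_smul]
      rcases m with _ | m
      · rw [(hocc 0 n).ann0_zero hπ, nuVal_zero_occLabel hq hq1, qnum_zero]
        simp
      · rw [ann_up_numVec hπ, down_zero_occLabel hq, hV, mul_assoc, ← Complex.ofReal_mul,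
          sqrt_nuVal_mul_invFactor_zero hq hq1, Submodule.coe_smul]
    · simp only [Fin.mk_one, map_smul]
      rcases n with _ | n
      · rw [(hocc m 0).ann1_zero hπ, nuVal_one_occLabel hq hq1, qnum_zero]
        simp
      · rw [ann_down_numVec hπ, down_one_occLabel hq, hV, mul_assoc, ← Complex.ofReal_mul,
          sqrt_nuVal_mul_invFactor_one hq hq1, Submodule.coe_smul]
  · refine conj_onBasis_of_numVec hπ hq hq1 hz hV (hac i) fun m n => ?_
    fin_cases i
    · simp only [Fin.zero_eta, map_smul]
      rw [cre_up_numVec hz, up_zero_occLabel, hV, mul_assoc, ← Complex.ofReal_mul,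
        sqrt_nuVal_mul_invFactor_zero hq hq1, Submodule.coe_smul]
    · simp only [Fin.mk_one, map_smul]
      rw [cre_down_numVec hz, up_one_occLabel, hV, mul_assoc, ← Complex.ofReal_mul,
        sqrt_nuVal_mul_invFactor_one hq hq1, Submodule.coe_smul]

end Equivalence

end FockDef

theorem mainTheorem8 :
    -- formal level: `f_α` is a `*`-homomorphism from the deformed algebra into `𝒜[[h]]`
    (∀ (𝔤 : Type*) [LieRing 𝔤] [LieAlgebra ℂ 𝔤] [StarAddMonoid 𝔤] [StarLieAlgebra 𝔤]
      (ι : Type*) [Fintype ι] [DecidableEq ι] (ρ : 𝔤 →ₗ⁅ℂ⁆ Matrix ι ι ℂ)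
      (_ : ∀ x, ρ (star x) = (ρ x).conjTranspose)
      (T : Twist 𝔤) (_ : T.IsUnitary) (s : Stat)
      (α : PowerSeries (CAlg s ι)) (_ : IsUnitaryPS α),
      SatisfiesQCR (PowerSeries.C (algebraMap ℂ (CAlg s ι) s.sgn))
        (PowerSeries.C (algebraMap ℂ (CAlg s ι) s.sgn))
        (fun i j h k => PowerSeries.map (algebraMap ℂ (CAlg s ι)) (RPS ρ T i j h k))
        (fun i => α * annPS s ρ T i * psStar α) (fun i => α * crePS s ρ T i * psStar α) ∧
      ∀ i, psStar (α * annPS s ρ T i * psStar α) = α * crePS s ρ T i * psStar α) ∧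
    -- Hilbert space level: `π ∘ f_α` is a `*`-representation on the Fock space
    (∀ (𝔤 : Type*) [LieRing 𝔤] [LieAlgebra ℂ 𝔤] [StarAddMonoid 𝔤] [StarLieAlgebra 𝔤]
      (ι : Type*) [Fintype ι] [DecidableEq ι] (ρ : 𝔤 →ₗ⁅ℂ⁆ Matrix ι ι ℂ)
      (_ : ∀ x, ρ (star x) = (ρ x).conjTranspose)
      (T : Twist 𝔤) (_ : T.IsUnitary) (s : Stat)
      (H : Type*) [NormedAddCommGroup H] [InnerProductSpace ℂ H] [CompleteSpace H]
      (D : Submodule ℂ H) (π : CAlg s ι →ₐ[ℂ] Module.End ℂ D)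
      (L : Type*) [Nonempty L] (Ω : L → D) (_ : IsFockRep π Ω) (h : ℝ)
      (_ : ∀ i j (v : D), Summable fun n : ℕ => (h : ℂ) ^ n •
        ((π (rhoSigma s ρ i j (PowerSeries.coeff n T.F)) v : D) : H)),
      ∃ R : ι → ι → ι → ι → ℂ,
        (∀ i j k l, HasSum (fun n : ℕ => (h : ℂ) ^ n * PowerSeries.coeff n (RPS ρ T i j k l))
          (R i j k l)) ∧
        ∃ B Bp : ι → Module.End ℂ D,
          (∀ i, IsValue π h (annPS s ρ T i) (fun v => (B i v : H))) ∧
          (∀ i, IsValue π h (crePS s ρ T i) (fun v => (Bp i v : H))) ∧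
          IsQCRStarRep s.sgn s.sgn R (fun i => closedOp (B i)) (fun i => closedOp (Bp i)) D ∧
          ∀ α : PowerSeries (CAlg s ι), IsUnitaryPS α →
            ConvergesAt π h α → ConvergesAt π h (psStar α) →
            ∃ V : H ≃ₗᵢ[ℂ] H, IsValue π h α (fun v => V (v : H)) ∧
              IsQCRStarRep s.sgn s.sgn R (fun i => conj V (closedOp (B i)))
                (fun i => conj V (closedOp (Bp i))) (D.map (V.toLinearEquiv : H →ₗ[ℂ] H))) ∧
    -- the same for `U_h su(2)`, `q = e^h > 0`
    (∀ (q : ℝ) (_ : 0 < q) (s : Stat)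
      (H : Type*) [NormedAddCommGroup H] [InnerProductSpace ℂ H] [CompleteSpace H]
      (D : Submodule ℂ H) (π : CAlg s (Fin 2) →ₐ[ℂ] Module.End ℂ D)
      (L : Type*) (Ω : L → D) (_ : IsFockRep π Ω),
      IsQCRStarRep (s.c₁ q) (s.c₂ q) (su2R q) (fun i => closedOp (su2Ann π q i))
        (fun i => closedOp (su2Cre π q i)) D ∧
      ∀ α : PowerSeries (CAlg s (Fin 2)), IsUnitaryPS α →
        ConvergesAt π (Real.log q) α → ConvergesAt π (Real.log q) (psStar α) →
        ∃ V : H ≃ₗᵢ[ℂ] H, IsValue π (Real.log q) α (fun v => V (v : H)) ∧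
          IsQCRStarRep (s.c₁ q) (s.c₂ q) (su2R q) (fun i => conj V (closedOp (su2Ann π q i)))
            (fun i => conj V (closedOp (su2Cre π q i)))
            (D.map (V.toLinearEquiv : H →ₗ[ℂ] H))) ∧
    -- `0 < q < 1`: only the Pusz–Woronowicz representation of class 1 corresponds to the
    -- irreducible bosonic Fock representation
    (∀ (q E : ℝ) (_ : 0 < q) (_ : q < 1) (_ : 0 < E)
      (H : Type*) [NormedAddCommGroup H] [InnerProductSpace ℂ H] [CompleteSpace H]
      (D : Submodule ℂ H) (π : CAlg Stat.bose (Fin 2) →ₐ[ℂ] Module.End ℂ D)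
      (Ω : Unit → D) (_ : IsFockRep π Ω) (c : PWClass)
      (K : Type*) [NormedAddCommGroup K] [InnerProductSpace ℂ K] [CompleteSpace K]
      (b : HilbertBasis (c.labels q E) ℂ K) (z : Fin 2 → ℂ) (_ : ∀ i, ‖z i‖ = 1),
      (InvDefined q (c.labels q E) ↔ c = PWClass.one) ∧
      ((∃ V : K ≃ₗᵢ[ℂ] H, ∀ i, conj V (pwAnn b q z i) = closedOp (su2Ann π q i) ∧
        conj V (pwCre b q z i) = closedOp (su2Cre π q i)) ↔ c = PWClass.one) ∧
      (c = PWClass.one → ∃ V : K ≃ₗᵢ[ℂ] H, ∀ i,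
        conj V (pwAnn b q z i) = closedOp (su2Ann π q i) ∧
        conj V (pwCre b q z i) = closedOp (su2Cre π q i) ∧
        conj V (invAnn b q z i) = closedOp (π (ann Stat.bose i)) ∧
        conj V (invCre b q z i) = closedOp (π (cre Stat.bose i)))) := by
  refine ⟨?_, ?_, ?_, ?_⟩
  · intro 𝔤 _ _ _ _ ι _ _ ρ hρ T hT s α hα
    exact ⟨satisfiesQCR_conj hρ hT hα, psStar_conj_annPS hρ hT α⟩
  · intro 𝔤 _ _ _ _ ι _ _ ρ hρ T hT s H _ _ _ D π L _ Ω hπ h hs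
    exact exists_qcrStarRep hρ hT hπ hs
  · intro q hq s H _ _ _ D π L Ω hπ
    exact isQCRStarRep_su2 hπ hq
  · intro q E hq hq1 hE H _ _ _ D π Ω hπ c K _ _ _ b z hz
    refine ⟨invDefined_iff hq hq1 hE c, ⟨?_, ?_⟩, ?_⟩
    · rintro ⟨V, hV⟩
      -- Intertwining the single operator Ã^↑ already forces class 1.
      exact class_eq_one_of_conj hπ hq hq1 hE b hz V (hV 0).1
    · rintro rfl
      obtain ⟨V, hV⟩ := exists_unitary_class_one hπ hq hq1 b hz
      exact ⟨V, fun i => ⟨(hV i).1, (hV i).2.1⟩⟩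
    · rintro rfl
      exact exists_unitary_class_one hπ hq hq1 b hz
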